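/- Conventions. Graphs are finite and simple. An instance of Token Jumping Independent Set Reconfiguration is a triple $(G,I_s,I_t)$, where $I_s$ and $I_t$ are independent sets of $G$ of the same size $k$ (the parameter). A token jump replaces an independent set $A$ by an independent set $(A\setminus\{v\})\cup\{w\}$ with $v\in A$ and $w\notin A$. The instance is a yes-instance if some finite (possibly empty) sequence of token jumps transforms $I_s$ into $I_t$. Two instances are equivalent if both or neither are yes-instances. Theorem. For every fixed positive integer $r$, Token Jumping Independent Set Reconfiguration on $K_{3,r}$-minor-free graphs has a kernel of size linear in $k$, which moreover is given by a subgraph. That is, for every positive integer $r$ there are a constant $c_r$, depending only on $r$, and a polynomial-time algorithm that, given an instance $(G,I_s,I_t)$ with $|I_s|=|I_t|=k$ and with $G$ being $K_{3,r}$-minor-free, outputs an equivalent instance $(G',I_s,I_t)$, where $G'$ is a ($K_{3,r}$-minor-free) subgraph of $G$ that contains $I_s\cup I_t$ and has at most $c_r k$ vertices. (The running time is at most a polynomial, depending only on $r$, in the number of vertices of $G$.) -/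

import Mathlib

namespace TokenJumping

/-- `H` is a minor of `G`: there are pairwise disjoint connected (in particular non-empty) branch
sets in `G`, one for each vertex of `H`, with an edge of `G` between the branch sets of any two
adjacent vertices of `H`. -/
def IsMinor {V W : Type*} (H : SimpleGraph W) (G : SimpleGraph V) : Prop :=
  ∃ B : W → Set V,
    (∀ w, (G.induce (B w)).Connected) ∧
    (∀ w w', w ≠ w' → Disjoint (B w) (B w')) ∧
    (∀ w w', H.Adj w w' → ∃ x ∈ B w, ∃ y ∈ B w', G.Adj x y)

/-- One token jump: the token on `v ∈ A` is moved to some other vertex `w` that carries no token,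
and the resulting token set is again independent. -/
def Jump {V : Type*} [DecidableEq V] (G : SimpleGraph V) (A B : Finset V) : Prop :=
  ∃ v ∈ A, ∃ w, w ∉ A ∧ B = insert w (A.erase v) ∧ G.IsIndepSet (B : Set V)

/-- An instance of Token Jumping Independent Set Reconfiguration: a finite graph with a source and
a target independent set of the same size. -/
structure Instance where
  /-- number of vertices -/
  n : ℕ
  graph : SimpleGraph (Fin n)
  source : Finset (Fin n)
  target : Finset (Fin n)
  source_indep : graph.IsIndepSet (source : Set (Fin n))
  target_indep : graph.IsIndepSet (target : Set (Fin n))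
  card_eq : source.card = target.card

/-- The parameter `k`: the number of tokens. -/
def Instance.k (I : Instance) : ℕ := I.source.card

/-- `I` is a yes-instance: some sequence of token jumps transforms the source into the target. -/
def Instance.IsYes (I : Instance) : Prop :=
  Relation.ReflTransGen (Jump I.graph) I.source I.target

/-! ### Random access machines

Programs of a random access machine with structured control flow.  The memory consists of
arrays `0, 1, 2, …` of natural numbers (a program mentions only finitely many of them), with indirect
addressing.  The arithmetic operations are addition and truncated subtraction, at unit cost, so
polynomial time on this machine is polynomial time on a Turing machine. -/

/-- The memory: `σ a i` is the content of cell `i` of array `a`. -/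
abbrev Store := ℕ → ℕ → ℕ

inductive Expr where
  | const (c : ℕ)
  | read (a : ℕ) (i : Expr)
  | plus (e f : Expr)
  | monus (e f : Expr)

def Expr.eval (σ : Store) : Expr → ℕ
  | .const c => c
  | .read a i => σ a (i.eval σ)
  | .plus e f => e.eval σ + f.eval σ
  | .monus e f => e.eval σ - f.eval σ

/-- Number of steps for the evaluation of an expression: one for each operation in it. -/
def Expr.cost : Expr → ℕ
  | .const _ => 1
  | .read _ i => i.cost + 1
  | .plus e f => e.cost + f.cost + 1
  | .monus e f => e.cost + f.cost + 1

/-- Programs.  `write a i e` stores the value of `e` in cell `i` of array `a`; the conditions of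
`cond` and `loop` hold when the expression is nonzero. -/
inductive Prog where
  | skip
  | write (a : ℕ) (i e : Expr)
  | seq (p q : Prog)
  | cond (e : Expr) (p q : Prog)
  | loop (e : Expr) (p : Prog)

/-- `Exec p σ t σ'`: the program `p`, started on the memory `σ`, halts after exactly `t` steps with
the memory `σ'`. -/
inductive Exec : Prog → Store → ℕ → Store → Prop where
  | skip (σ : Store) : Exec .skip σ 1 σ
  | write (a : ℕ) (i e : Expr) (σ : Store) :
      Exec (.write a i e) σ (i.cost + e.cost + 1)
        (Function.update σ a (Function.update (σ a) (i.eval σ) (e.eval σ)))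
  | seq {p q : Prog} {σ σ' σ'' : Store} {s t : ℕ} :
      Exec p σ s σ' → Exec q σ' t σ'' → Exec (.seq p q) σ (s + t) σ''
  | cond_true {e : Expr} {p q : Prog} {σ σ' : Store} {t : ℕ} :
      e.eval σ ≠ 0 → Exec p σ t σ' → Exec (.cond e p q) σ (e.cost + t + 1) σ'
  | cond_false {e : Expr} {p q : Prog} {σ σ' : Store} {t : ℕ} :
      e.eval σ = 0 → Exec q σ t σ' → Exec (.cond e p q) σ (e.cost + t + 1) σ'
  | loop_true {e : Expr} {p : Prog} {σ σ' σ'' : Store} {s t : ℕ} :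
      e.eval σ ≠ 0 → Exec p σ s σ' → Exec (.loop e p) σ' t σ'' →
        Exec (.loop e p) σ (e.cost + s + t + 1) σ''
  | loop_false {e : Expr} {p : Prog} {σ : Store} :
      e.eval σ = 0 → Exec (.loop e p) σ (e.cost + 1) σ

open Classical in
/-- The instance `I` is stored in the four arrays from `b` on: the number of vertices, the adjacency
matrix row by row, and the characteristic vectors of the source and of the target. -/
def Stored (σ : Store) (b : ℕ) (I : Instance) : Prop :=
  σ b 0 = I.n ∧
  (∀ u v : Fin I.n, σ (b + 1) (u * I.n + v) = if I.graph.Adj u v then 1 else 0) ∧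
  (∀ u : Fin I.n, σ (b + 2) u = if u ∈ I.source then 1 else 0) ∧
  (∀ u : Fin I.n, σ (b + 3) u = if u ∈ I.target then 1 else 0)

open Classical in
/-- The initial memory on input `I`: the instance is stored in the arrays `0`, `1`, `2`, `3`, and
every other cell is `0`. -/
noncomputable def Instance.input (I : Instance) : Store
  | 0, i => if i = 0 then I.n else 0
  | 1, i => if ∃ u v : Fin I.n, i = u * I.n + v ∧ I.graph.Adj u v then 1 else 0
  | 2, i => if ∃ u ∈ I.source, i = (u : ℕ) then 1 else 0
  | 3, i => if ∃ u ∈ I.target, i = (u : ℕ) then 1 else 0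
  | _, _ => 0

theorem Instance.stored_input (I : Instance) : Stored I.input 0 I := by
  classical
  refine ⟨by simp [Instance.input], fun u v => ?_, fun u => ?_, fun u => ?_⟩
  · simp only [Instance.input]
    refine if_congr ⟨?_, fun h => ⟨u, v, by simp, h⟩⟩ rfl rfl
    rintro ⟨u', v', h, hadj⟩
    have hn : 0 < I.n := u.pos
    have h1 := congrArg (· / I.n) h
    have h2 := congrArg (· % I.n) h
    simp only [Nat.mul_comm _ I.n, Nat.mul_add_div hn, Nat.div_eq_of_lt v.2,
      Nat.div_eq_of_lt v'.2, Nat.mul_add_mod, Nat.mod_eq_of_lt v.2, Nat.mod_eq_of_lt v'.2] at h1 h2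
    obtain rfl : u = u' := Fin.ext (by simpa using h1)
    obtain rfl : v = v' := Fin.ext h2
    exact hadj
  · simp only [Instance.input]
    refine if_congr ⟨?_, fun h => ⟨u, h, rfl⟩⟩ rfl rfl
    rintro ⟨u', hu, h⟩
    obtain rfl : u = u' := Fin.ext h
    exact hu
  · simp only [Instance.input]
    refine if_congr ⟨?_, fun h => ⟨u, h, rfl⟩⟩ rfl rfl
    rintro ⟨u', hu, h⟩
    obtain rfl : u = u' := Fin.ext h
    exact hu

/-- `J` is, through the naming `φ` of its vertices by vertices of `I`, of the form
`(G', I_s, I_t)`, where `(G, I_s, I_t)` is `I` and `G'` is a subgraph of `G`. -/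
def IsSubinstance (J I : Instance) (φ : Fin J.n ↪ Fin I.n) : Prop :=
  (∀ u v, J.graph.Adj u v → I.graph.Adj (φ u) (φ v)) ∧
  J.source.map φ = I.source ∧ J.target.map φ = I.target

end TokenJumping

namespace TokenJumping

set_option linter.unusedSectionVars false

/-! ### Minors and connected branch sets -/

section Minors

/-! Sparsity does all the counting. A set whose average degree exceeds `8 * r` yields a `K_{3,r}`
minor by passing three times to the neighbourhood of a connected set (`degSum_le_of_not_isMinor`).
Hence there are independent sets of linear size. Moreover, for any vertex set `R`, only linearly
many vertices outside `R` have three neighbours in `R` (`card_le_of_three_nbrs`), and vertices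
outside `R` realise only linearly many pairs of neighbours in `R` (`card_pairs_le`). Applied to
minors, the first bound counts disjoint connected pieces that touch three disjoint bags
(`card_pieces_le`).

Call a vertex free if it is neither in the source or target nor adjacent to them. If there are at
least `(8 * r + 1) * k` free vertices, `k` independent ones serve as parking space and the instance
is a yes-instance, already inside a linear set. Otherwise the source, the target and all free
vertices form a dominating set `X` of linear size. The class of a vertex outside a set `K ⊇ X`
consists of the vertices outside `K` with the same neighbours in `K`. Starting from `X`, add in
rounds every vertex that has no neighbour `x ∈ X` with a neighbour in a large class. Two facts about
the resulting closure `K` carry the proof.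

It is linear in size (`card_closure_le`): when `x ∈ X` first acquires a neighbour in `K \ X`, its
outside neighbours lie in small classes, and this history is recorded (`ClosureRecord`). With the
record, each vertex of `K \ X` is charged either to a small class or to three contacts with a linear
base set.

A token that leaves `K` frees all tokens (`exists_reach_of_exit`). The first vertex `w` outside `K`
has a neighbour `x ∈ X` that sees a large class, and `x` carries no token other than the one that
moves. If other tokens block the class, there is only one such token, since three common neighbours
cannot have a large class. After a jump or two there are many vertices blocked by at most one token,
and from there all tokens can be transferred to a reservoir, an independent set outside `K` that
falls into groups with common neighbours in `K` (`exists_reach_of_room`, `exists_reach_reservoir`).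
As jumps are reversible, a reconfiguration either stays in `K` or can be replaced by one through the
reservoir (`reach_restrict`).

It therefore suffices to keep `K`, boundedly many vertices of every class, and linearly many further
vertices to supply the reservoir (`keepSet_spec`). These vertex sets are described by counting
terms, which compile to programs of polynomial running time (`Term.runs_compile`). -/

theorem IsMinor.trans {V W U : Type*} {L : SimpleGraph U} {H : SimpleGraph W} {G : SimpleGraph V}
    (hLH : IsMinor L H) (hHG : IsMinor H G) : IsMinor L G := by
  obtain ⟨B, hB, hBd, hBe⟩ := hLH
  obtain ⟨C, hC, hCd, hCe⟩ := hHG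
  refine ⟨fun u => ⋃ w ∈ B u, C w, fun u => ?_, fun u u' huu => ?_, fun u u' huu => ?_⟩
  · have key : ∀ {w w' : B u}, (H.induce (B u)).Reachable w w' →
        ∀ x (hx : x ∈ C w) y (hy : y ∈ C w'),
          (G.induce (⋃ w ∈ B u, C w)).Reachable
            ⟨x, Set.mem_biUnion w.2 hx⟩ ⟨y, Set.mem_biUnion w'.2 hy⟩ := by
      have inner : ∀ (w : B u) x (hx : x ∈ C w) y (hy : y ∈ C w),
          (G.induce (⋃ w ∈ B u, C w)).Reachable
            ⟨x, Set.mem_biUnion w.2 hx⟩ ⟨y, Set.mem_biUnion w.2 hy⟩ := by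
        intro w x hx y hy
        have h := (hC w).preconnected ⟨x, hx⟩ ⟨y, hy⟩
        exact h.map (SimpleGraph.induceHomOfLE G (Set.subset_biUnion_of_mem (u := C) w.2)).toHom
      rintro w w' ⟨p⟩
      induction p with
      | nil => exact inner _
      | @cons a b c hab _ ih =>
        intro x hx y hy
        obtain ⟨s, hs, t, ht, hst⟩ := hCe a b hab
        have h1 := inner a x hx s hs
        have h2 := ih t ht y hy
        refine h1.trans (SimpleGraph.Reachable.trans (SimpleGraph.Adj.reachable ?_) h2)
        exact hst
    obtain ⟨w⟩ := (hB u).nonempty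
    obtain ⟨x⟩ := (hC w).nonempty
    have : Nonempty ↥(⋃ w ∈ B u, C w) := ⟨⟨x, Set.mem_biUnion w.2 x.2⟩⟩
    refine ⟨?_⟩
    rintro ⟨x, hx⟩ ⟨y, hy⟩
    obtain ⟨w, hw, hxw⟩ := Set.mem_iUnion₂.1 hx
    obtain ⟨w', hw', hyw'⟩ := Set.mem_iUnion₂.1 hy
    exact key ((hB u).preconnected ⟨w, hw⟩ ⟨w', hw'⟩) x hxw y hyw'
  · rw [Set.disjoint_left]
    intro x hx hx'
    obtain ⟨w, hw, hxw⟩ := Set.mem_iUnion₂.1 hx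
    obtain ⟨w', hw', hxw'⟩ := Set.mem_iUnion₂.1 hx'
    by_cases h : w = w'
    · subst h
      exact Set.disjoint_left.1 (hBd u u' huu) hw hw'
    · exact Set.disjoint_left.1 (hCd w w' h) hxw hxw'
  · obtain ⟨w, hw, w', hw', h⟩ := hBe u u' huu
    obtain ⟨x, hx, y, hy, hxy⟩ := hCe w w' h
    exact ⟨x, Set.mem_biUnion hw hx, y, Set.mem_biUnion hw' hy, hxy⟩

theorem connected_induce_singleton {V : Type*} (G : SimpleGraph V) (v : V) :
    (G.induce ({v} : Set V)).Connected := by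
  have : Nonempty ({v} : Set V) := ⟨⟨v, rfl⟩⟩
  have : Subsingleton ({v} : Set V) := ⟨fun a b => Subtype.ext (a.2.trans b.2.symm)⟩
  exact ⟨fun a b => by rw [Subsingleton.elim a b]⟩

theorem connected_induce_star {V : Type*} (G : SimpleGraph V) (v : V) (S : Set V)
    (hv : v ∈ S) (h : ∀ w ∈ S, w ≠ v → G.Adj v w) : (G.induce S).Connected := by
  have : Nonempty S := ⟨⟨v, hv⟩⟩
  have key : ∀ a : S, (G.induce S).Reachable ⟨v, hv⟩ a := by
    rintro ⟨a, ha⟩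
    by_cases hav : a = v
    · subst hav; exact SimpleGraph.Reachable.refl _
    · exact SimpleGraph.Adj.reachable (h a ha hav)
  exact ⟨fun a b => (key a).symm.trans (key b)⟩

theorem connected_induce_insert {V : Type*} (G : SimpleGraph V) (v u : V) (S : Set V)
    (hS : (G.induce S).Connected) (hu : u ∈ S) (h : G.Adj u v) :
    (G.induce (insert v S)).Connected := by
  have : Nonempty ↥(insert v S) := ⟨⟨v, Set.mem_insert _ _⟩⟩
  have key : ∀ a : ↥(insert v S),
      (G.induce (insert v S)).Reachable ⟨u, Set.mem_insert_of_mem _ hu⟩ a := by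
    rintro ⟨a, ha⟩
    rcases ha with rfl | ha
    · exact SimpleGraph.Adj.reachable h
    · exact (hS.preconnected ⟨u, hu⟩ ⟨a, ha⟩).map
        (SimpleGraph.induceHomOfLE G (Set.subset_insert v S)).toHom
  exact ⟨fun a b => (key a).symm.trans (key b)⟩

end Minors

/-! ### Sparsity of graphs without a `K_{3,r}` minor -/

section Density

variable {V : Type*} [DecidableEq V] (G : SimpleGraph V) [DecidableRel G.Adj]

/-- The sum of the degrees in the subgraph induced by `A`. -/
def degSum (A : Finset V) : ℕ := ∑ v ∈ A, (A.filter (G.Adj v)).card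

theorem degSum_erase {A : Finset V} {v : V} (hv : v ∈ A) :
    degSum G A = degSum G (A.erase v) + 2 * (A.filter (G.Adj v)).card := by
  have h1 : ∀ u ∈ A.erase v, (A.filter (G.Adj u)).card =
      ((A.erase v).filter (G.Adj u)).card + if G.Adj u v then 1 else 0 := by
    intro u hu
    conv_lhs => rw [← Finset.insert_erase hv]
    rw [Finset.filter_insert]
    split_ifs with h
    · rw [Finset.card_insert_of_notMem (by simp)]
    · rfl
  have h2 : ∑ u ∈ A.erase v, (if G.Adj u v then 1 else 0) = (A.filter (G.Adj v)).card := by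
    rw [← Finset.card_filter]
    congr 1
    ext u
    simp only [Finset.mem_filter, Finset.mem_erase]
    constructor
    · rintro ⟨⟨_, h⟩, h'⟩; exact ⟨h, h'.symm⟩
    · rintro ⟨h, h'⟩; exact ⟨⟨h'.ne', h⟩, h'.symm⟩
  unfold degSum
  rw [← Finset.add_sum_erase A _ hv, Finset.sum_congr rfl h1, Finset.sum_add_distrib, h2]
  ring

/-- A contraction argument in the style of Mader. Take `U` maximal among the connected sets whose
contraction keeps the average degree at least `2 * c`. A neighbour of `U` with fewer than `c`
neighbours inside the neighbourhood could be contracted as well. -/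
theorem exists_connected_nbhd (c : ℕ) (hc : 0 < c) (A : Finset V) (hA : A.Nonempty)
    (h : 2 * c * A.card ≤ degSum G A) :
    ∃ U N : Finset V, U ⊆ A ∧ N ⊆ A ∧ Disjoint U N ∧ (G.induce (U : Set V)).Connected ∧
      N.Nonempty ∧ (∀ v ∈ N, ∃ u ∈ U, G.Adj u v) ∧ ∀ v ∈ N, c ≤ (N.filter (G.Adj v)).card := by
  classical
  induction hn : A.card using Nat.strong_induction_on generalizing A with
  | _ n ih =>
  subst hn
  let nb : Finset V → Finset V := fun U => (A \ U).filter (fun v => ∃ u ∈ U, G.Adj u v)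
  -- Contracting `U` leaves `A.card - U.card + 1` vertices and degree sum `degSum G (A \ U) + 2 *
  -- (nb U).card`; the last clause says that the average is still at least `2 * c`.
  let P : Finset V → Prop := fun U => U ⊆ A ∧ (G.induce (U : Set V)).Connected ∧
    2 * c * (A.card - U.card + 1) ≤ degSum G (A \ U) + 2 * (nb U).card
  obtain ⟨a, ha⟩ := hA
  have hPa : P {a} := by
    refine ⟨by simpa using ha, by
      rw [Finset.coe_singleton]; exact connected_induce_singleton G a, ?_⟩
    have h1 : A \ {a} = A.erase a := by simp [Finset.sdiff_singleton_eq_erase]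
    have h2 : nb {a} = A.filter (G.Adj a) := by
      ext v
      simp only [nb, Finset.mem_filter, Finset.mem_sdiff, Finset.mem_singleton, exists_eq_left]
      exact ⟨fun h => ⟨h.1.1, h.2⟩, fun h => ⟨⟨h.1, h.2.ne'⟩, h.2⟩⟩
    rw [h1, h2, ← degSum_erase G ha, Finset.card_singleton,
      Nat.sub_add_cancel (Finset.card_pos.2 ⟨a, ha⟩)]
    exact h
  obtain ⟨U, hU, hmax⟩ := Finset.exists_max_image (A.powerset.filter P) Finset.card
    ⟨{a}, by simpa [Finset.mem_filter, ha] using hPa⟩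
  obtain ⟨-, hUA, hUc, hUe⟩ := Finset.mem_filter.1 hU |>.imp id id
  have hcardU : U.card ≤ A.card := Finset.card_le_card hUA
  have hsd : (A \ U).card = A.card - U.card := Finset.card_sdiff_of_subset hUA
  by_cases hN : (nb U).Nonempty
  · refine ⟨U, nb U, hUA, (Finset.filter_subset _ _).trans Finset.sdiff_subset, ?_, hUc, hN,
      fun v hv => (Finset.mem_filter.1 hv).2, ?_⟩
    · rw [Finset.disjoint_left]
      intro x hx hx'
      exact (Finset.mem_sdiff.1 (Finset.mem_filter.1 hx').1).2 hx
    -- Merging `v` into `U` destroys the edge to `v` and one edge for each neighbour of `v` in `nb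
    -- U`. With fewer than `c` of those, the degree sum falls by at most `2 * c`, which the loss of
    -- one vertex pays for.
    · intro v hv
      obtain ⟨hvA, u, hu, huv⟩ := Finset.mem_filter.1 hv
      have hvU := (Finset.mem_sdiff.1 hvA).2
      have hvA' := (Finset.mem_sdiff.1 hvA).1
      by_contra hlt
      have hcard' : (insert v U).card = U.card + 1 := Finset.card_insert_of_notMem hvU
      have hle : (insert v U).card ≤ A.card :=
        Finset.card_le_card (Finset.insert_subset hvA' hUA)
      have hP' : P (insert v U) := by
        refine ⟨Finset.insert_subset hvA' hUA, ?_, ?_⟩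
        · rw [Finset.coe_insert]
          exact connected_induce_insert G v u _ hUc hu huv
        · have e1 : A \ insert v U = (A \ U).erase v := by
            ext x; simp only [Finset.mem_sdiff, Finset.mem_insert, Finset.mem_erase]; tauto
          have e2 := degSum_erase G hvA
          have e3 : nb (insert v U) =
              (nb U).erase v ∪ ((A \ U).filter (G.Adj v)).filter (fun x => x ∉ nb U) := by
            ext x
            simp only [nb, Finset.mem_filter, Finset.mem_sdiff, Finset.mem_insert, Finset.mem_union,
              Finset.mem_erase]
            constructor
            · rintro ⟨⟨hxA, hx⟩, y, hy, hyx⟩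
              push Not at hx
              by_cases hxN : ∃ u ∈ U, G.Adj u x
              · exact Or.inl ⟨hx.1, ⟨hxA, hx.2⟩, hxN⟩
              · rcases hy with rfl | hy
                · exact Or.inr ⟨⟨⟨hxA, hx.2⟩, hyx⟩, fun h => hxN h.2⟩
                · exact absurd ⟨y, hy, hyx⟩ hxN
            · rintro (⟨hxv, ⟨hxA, hxU⟩, y, hy, hyx⟩ | ⟨⟨⟨hxA, hxU⟩, hvx⟩, _⟩)
              · exact ⟨⟨hxA, by tauto⟩, y, Or.inr hy, hyx⟩
              · exact ⟨⟨hxA, by rintro (h | h); exact hvx.ne' h; exact hxU h⟩, v, Or.inl rfl, hvx⟩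
          have e4 : (nb (insert v U)).card = ((nb U).card - 1) +
              (((A \ U).filter (G.Adj v)).filter (fun x => x ∉ nb U)).card := by
            rw [e3, Finset.card_union_of_disjoint, Finset.card_erase_of_mem hv]
            rw [Finset.disjoint_left]
            intro x hx hx'
            exact (Finset.mem_filter.1 hx').2 (Finset.mem_of_mem_erase hx)
          have e5 : ((A \ U).filter (G.Adj v)).card = ((nb U).filter (G.Adj v)).card +
              (((A \ U).filter (G.Adj v)).filter (fun x => x ∉ nb U)).card := by
            rw [← Finset.card_filter_add_card_filter_not (s := (A \ U).filter (G.Adj v))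
              (fun x => x ∈ nb U)]
            congr 2
            ext x
            simp only [Finset.mem_filter]
            constructor
            · rintro ⟨⟨_, h⟩, h'⟩; exact ⟨h', h⟩
            · rintro ⟨h, h'⟩; exact ⟨⟨(Finset.mem_filter.1 h).1, h'⟩, h⟩
          have hpos : 0 < (nb U).card := Finset.card_pos.2 ⟨v, hv⟩
          rw [e1, e4, hcard']
          have : A.card - U.card = (A.card - (U.card + 1)) + 1 := by omega
          rw [this] at hUe
          have hx : 2 * c * (A.card - (U.card + 1) + 1 + 1) =
            2 * c * (A.card - (U.card + 1) + 1) + 2 * c := by ring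
          omega
      have := hmax (insert v U) (Finset.mem_filter.2
        ⟨Finset.mem_powerset.2 (Finset.insert_subset hvA' hUA), hP'⟩)
      omega
  -- The contracted `U` is now an isolated vertex, so `A \ U` is smaller and still dense enough.
  · rw [Finset.not_nonempty_iff_eq_empty] at hN
    rw [hN, Finset.card_empty, mul_zero, add_zero, ← hsd] at hUe
    have hne : (A \ U).Nonempty := by
      rw [Finset.nonempty_iff_ne_empty]
      intro h0
      rw [h0] at hUe
      simp [degSum] at hUe
      omega
    have hUne : U.Nonempty := by
      obtain ⟨x⟩ := hUc.nonempty
      exact ⟨x, x.2⟩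
    have hlt : (A \ U).card < A.card := by
      have := Finset.card_pos.2 hUne
      have := Finset.card_pos.2 hne
      omega
    obtain ⟨U', N, h1, h2, h3⟩ := ih _ hlt (A \ U) hne
      (le_trans (Nat.mul_le_mul_left _ (Nat.le_succ _)) hUe) rfl
    exact ⟨U', N, h1.trans Finset.sdiff_subset, h2.trans Finset.sdiff_subset, h3⟩

theorem degSum_of_minDeg {c : ℕ} {N : Finset V} (h : ∀ v ∈ N, c ≤ (N.filter (G.Adj v)).card) :
    c * N.card ≤ degSum G N := by
  rw [degSum, mul_comm, ← smul_eq_mul]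
  exact Finset.card_nsmul_le_sum _ _ _ h

/-- Three nested applications of `exists_connected_nbhd` halve the bound from `8 * r` to `4 * r`, `2
* r` and `r`. The three connected sets form one side of the minor. The last neighbourhood has inner
degree at least `r`, so it contains `r` vertices for the other side. -/
theorem degSum_le_of_not_isMinor {r : ℕ} (hr : 0 < r)
    (hG : ¬ IsMinor (completeBipartiteGraph (Fin 3) (Fin r)) G) (A : Finset V) :
    degSum G A ≤ 8 * r * A.card := by
  by_contra hlt
  push Not at hlt
  have hA : A.Nonempty := by
    rw [Finset.nonempty_iff_ne_empty]
    rintro rfl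
    simp [degSum] at hlt
  obtain ⟨U₁, N₁, hU₁, hN₁, hd₁, hc₁, hn₁, ha₁, hm₁⟩ :=
    exists_connected_nbhd G (4 * r) (by omega) A hA (by linarith)
  obtain ⟨U₂, N₂, hU₂, hN₂, hd₂, hc₂, hn₂, ha₂, hm₂⟩ :=
    exists_connected_nbhd G (2 * r) (by omega) N₁ hn₁
      (le_trans (by linarith) (degSum_of_minDeg G hm₁))
  obtain ⟨U₃, N₃, hU₃, hN₃, hd₃, hc₃, hn₃, ha₃, hm₃⟩ :=
    exists_connected_nbhd G r hr N₂ hn₂ (degSum_of_minDeg G hm₂)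
  obtain ⟨v, hv⟩ := hn₃
  have hcard : r ≤ N₃.card := (hm₃ v hv).trans (Finset.card_filter_le _ _)
  obtain ⟨S, hS, hSr⟩ := Finset.exists_subset_card_eq hcard
  let e := S.equivFinOfCardEq hSr
  have heS : ∀ j, (e.symm j : V) ∈ N₃ := fun j => hS (e.symm j).2
  rw [Finset.disjoint_left] at hd₁ hd₂ hd₃
  have hadj : ∀ (i : Fin 3) (j : Fin r), ∃ u ∈ (![U₁, U₂, U₃] i), G.Adj u (e.symm j) := by
    intro i j
    fin_cases i
    · exact ha₁ _ (hN₂ (hN₃ (heS j)))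
    · exact ha₂ _ (hN₃ (heS j))
    · exact ha₃ _ (heS j)
  have hUS : ∀ (i : Fin 3), ∀ u ∈ (![U₁, U₂, U₃] i), u ∉ N₃ := by
    intro i u hu hu'
    fin_cases i
    · exact hd₁ hu (hN₂ (hN₃ hu'))
    · exact hd₂ hu (hN₃ hu')
    · exact hd₃ hu hu'
  have hUU : ∀ (i i' : Fin 3), i ≠ i' → ∀ u ∈ (![U₁, U₂, U₃] i), u ∉ (![U₁, U₂, U₃] i') := by
    have h12 : ∀ u ∈ U₁, u ∉ U₂ := fun u h h' => hd₁ h (hU₂ h')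
    have h13 : ∀ u ∈ U₁, u ∉ U₃ := fun u h h' => hd₁ h (hN₂ (hU₃ h'))
    have h23 : ∀ u ∈ U₂, u ∉ U₃ := fun u h h' => hd₂ h (hU₃ h')
    intro i i' hii u hu hu'
    fin_cases i <;> fin_cases i' <;> simp at hii hu hu'
    exacts [h12 u hu hu', h13 u hu hu', h12 u hu' hu, h23 u hu hu', h13 u hu' hu, h23 u hu' hu]
  apply hG
  refine ⟨Sum.elim (fun i => ((![U₁, U₂, U₃] i : Finset V) : Set V)) (fun j => {(e.symm j : V)}),
    ?_, ?_, ?_⟩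
  · rintro (i | j)
    · fin_cases i
      exacts [hc₁, hc₂, hc₃]
    · exact connected_induce_singleton G _
  · rintro (i | j) (i' | j') hne
    · rw [Set.disjoint_left]
      exact fun u hu hu' => hUU i i' (fun h => hne (by rw [h])) u hu hu'
    · rw [Set.disjoint_left]
      rintro u hu rfl
      exact hUS i _ hu (heS j')
    · rw [Set.disjoint_left]
      rintro u rfl hu
      exact hUS i' _ hu (heS j)
    · rw [Set.disjoint_left]
      rintro u rfl hu
      exact hne (by rw [e.symm.injective (Subtype.ext hu)])
  · rintro (i | j) (i' | j') h
    · simp at h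
    · obtain ⟨u, hu, h'⟩ := hadj i j'
      exact ⟨u, hu, _, rfl, h'⟩
    · obtain ⟨u, hu, h'⟩ := hadj i' j
      exact ⟨_, rfl, u, hu, h'.symm⟩
    · simp at h

/-- Greedy choice: some vertex of `A` has at most `2 * q` neighbours in `A`, so putting it into `I`
costs at most `2 * q + 1` vertices. -/
theorem exists_indep_subset {q : ℕ} (h : ∀ A : Finset V, degSum G A ≤ 2 * q * A.card)
    (A : Finset V) :
    ∃ I ⊆ A, (∀ u ∈ I, ∀ v ∈ I, ¬ G.Adj u v) ∧ A.card ≤ (2 * q + 1) * I.card := by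
  induction hn : A.card using Nat.strong_induction_on generalizing A with
  | _ n ih =>
  subst hn
  rcases A.eq_empty_or_nonempty with rfl | hA
  · exact ⟨∅, by simp⟩
  obtain ⟨v, hv, hdeg⟩ : ∃ v ∈ A, (A.filter (G.Adj v)).card ≤ 2 * q := by
    by_contra hcon
    push Not at hcon
    have h1 := degSum_of_minDeg G (c := 2 * q + 1) hcon
    have h2 := h A
    have := Finset.card_pos.2 hA
    nlinarith
  have hss : (A.filter (fun u => u ≠ v ∧ ¬ G.Adj v u)) ⊂ A :=
    Finset.filter_ssubset.2 ⟨v, hv, by simp⟩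
  obtain ⟨I, hI, hind, hcard⟩ := ih _ (Finset.card_lt_card hss) _ rfl
  have hvI : v ∉ I := fun h => by simpa using (Finset.mem_filter.1 (hI h)).2.1
  refine ⟨insert v I, Finset.insert_subset hv (hI.trans hss.1), ?_, ?_⟩
  · intro a ha b hb
    rcases Finset.mem_insert.1 ha with ha' | ha' <;> rcases Finset.mem_insert.1 hb with hb' | hb'
    · rw [ha', hb']; exact G.irrefl
    · rw [ha']; exact (Finset.mem_filter.1 (hI hb')).2.2
    · rw [hb']; exact fun h => (Finset.mem_filter.1 (hI ha')).2.2 h.symm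
    · exact hind a ha' b hb'
  · rw [Finset.card_insert_of_notMem hvI]
    have hsub : A ⊆ insert v (A.filter (G.Adj v)) ∪ A.filter (fun u => u ≠ v ∧ ¬ G.Adj v u) := by
      intro u hu
      simp only [Finset.mem_union, Finset.mem_insert, Finset.mem_filter]
      tauto
    have h1 := (Finset.card_le_card hsub).trans (Finset.card_union_le _ _)
    have h2 := Finset.card_insert_le v (A.filter (G.Adj v))
    nlinarith

/-- A relation in which every element forbids at most `q` others has a large conflict-free
subset. -/
theorem exists_conflictFree_subset {α : Type*} [DecidableEq α] {q : ℕ} (A : Finset α)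
    (forb : α → Finset α) (hq : ∀ a, (forb a).card ≤ q) :
    ∃ I ⊆ A, (∀ a ∈ I, ∀ b ∈ I, a ≠ b → b ∉ forb a) ∧ A.card ≤ (2 * q + 1) * I.card := by
  classical
  let H : SimpleGraph α := SimpleGraph.fromRel (fun a b => b ∈ forb a)
  -- Conflicts are arcs; at most `q * A.card` of them lie inside `A`, and each contributes at most
  -- two to the degree sum.
  have hdeg : ∀ A : Finset α, degSum H A ≤ 2 * q * A.card := by
    intro A
    have h1 : ∀ a ∈ A, (A.filter (H.Adj a)).card ≤
        (A.filter (fun b => b ∈ forb a)).card + (A.filter (fun b => a ∈ forb b)).card := by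
      intro a _
      refine le_trans (Finset.card_le_card ?_) (Finset.card_union_le _ _)
      intro b hb
      simp only [Finset.mem_union, Finset.mem_filter, H, SimpleGraph.fromRel_adj] at hb ⊢
      tauto
    have h2 : ∑ a ∈ A, (A.filter (fun b => b ∈ forb a)).card ≤ q * A.card := by
      rw [mul_comm, ← smul_eq_mul]
      refine Finset.sum_le_card_nsmul _ _ _ fun a _ => le_trans (Finset.card_le_card ?_) (hq a)
      intro b hb
      exact (Finset.mem_filter.1 hb).2
    have h3 : ∑ a ∈ A, (A.filter (fun b => a ∈ forb b)).card =
        ∑ a ∈ A, (A.filter (fun b => b ∈ forb a)).card := by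
      simp only [Finset.card_filter]
      exact Finset.sum_comm
    have := Finset.sum_le_sum h1
    rw [Finset.sum_add_distrib, h3] at this
    unfold degSum
    linarith
  obtain ⟨I, hI, hind, hcard⟩ := exists_indep_subset H hdeg A
  refine ⟨I, hI, fun a ha b hb hab h => hind a ha b hb ?_, hcard⟩
  rw [SimpleGraph.fromRel_adj]
  exact ⟨hab, Or.inl h⟩

end Density

/-! ### Linear bounds for neighbour pairs, neighbour triples and pieces -/

section Counting

variable {V : Type*} [DecidableEq V] (G : SimpleGraph V)

theorem card_lt_of_common_nbrs {r : ℕ}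
    (hG : ¬ IsMinor (completeBipartiteGraph (Fin 3) (Fin r)) G)
    {T S : Finset V} (hT : 3 ≤ T.card) (h : ∀ s ∈ S, ∀ t ∈ T, G.Adj s t) : S.card < r := by
  by_contra hlt
  push Not at hlt
  obtain ⟨T', hT', hT3⟩ := Finset.exists_subset_card_eq hT
  obtain ⟨S', hS', hSr⟩ := Finset.exists_subset_card_eq hlt
  let e := S'.equivFinOfCardEq hSr
  let g := T'.equivFinOfCardEq hT3
  have hadj : ∀ i j, G.Adj (g.symm i : V) (e.symm j : V) :=
    fun i j => (h _ (hS' (e.symm j).2) _ (hT' (g.symm i).2)).symm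
  apply hG
  refine ⟨Sum.elim (fun i => {(g.symm i : V)}) (fun j => {(e.symm j : V)}), ?_, ?_, ?_⟩
  · rintro (i | j) <;> exact connected_induce_singleton G _
  · rintro (i | j) (i' | j') hne <;> simp only [Sum.elim_inl, Sum.elim_inr] <;>
      rw [Set.disjoint_singleton]
    · exact fun hh => hne (by rw [g.symm.injective (Subtype.ext hh)])
    · exact (hadj i j').ne
    · exact (hadj i' j).ne'
    · exact fun hh => hne (by rw [e.symm.injective (Subtype.ext hh)])
  · rintro (i | j) (i' | j') hh
    · simp at hh
    · exact ⟨_, rfl, _, rfl, hadj i j'⟩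
    · exact ⟨_, rfl, _, rfl, (hadj i' j).symm⟩
    · simp at hh

/-- The graph on `R` that joins the two vertices `u z` and `v z` for every `z ∈ Z`. -/
def pairGraph (R Z : Finset V) (u v : V → V) : SimpleGraph {y // y ∈ R} :=
  SimpleGraph.fromRel (fun a b => ∃ z ∈ Z, u z = a ∧ v z = b)

/-- Contract each `z` into `u z`; its edge to `v z` then joins `u z` to `v z`. -/
theorem isMinor_pairGraph {R Z : Finset V} {u v : V → V} (hd : Disjoint R Z)
    (hu : ∀ z ∈ Z, G.Adj z (u z)) (hv : ∀ z ∈ Z, G.Adj z (v z)) :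
    IsMinor (pairGraph R Z u v) G := by
  rw [Finset.disjoint_left] at hd
  refine ⟨fun y => insert (y : V) {z | z ∈ Z ∧ u z = y}, fun y => ?_, fun y y' hne => ?_, ?_⟩
  · refine connected_induce_star G y _ (Set.mem_insert _ _) ?_
    rintro w (rfl | ⟨hw, hwy⟩) hne
    · exact absurd rfl hne
    · rw [← hwy]; exact (hu w hw).symm
  · rw [Set.disjoint_left]
    rintro w (rfl | ⟨hw, hwy⟩) (h | ⟨hw', hwy'⟩)
    · exact hne (Subtype.ext h)
    · exact hd y.2 hw'
    · exact hd y'.2 (h ▸ hw)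
    · exact hne (Subtype.ext (hwy.symm.trans hwy'))
  · intro a b hab
    rw [pairGraph, SimpleGraph.fromRel_adj] at hab
    obtain ⟨_, ⟨z, hz, hza, hzb⟩ | ⟨z, hz, hza, hzb⟩⟩ := hab
    · exact ⟨z, Or.inr ⟨hz, hza⟩, b, Or.inl rfl, hzb ▸ hv z hz⟩
    · exact ⟨a, Or.inl rfl, z, Or.inr ⟨hz, hza⟩, hzb ▸ (hv z hz).symm⟩

/-- Distinct pairs are distinct edges of `pairGraph`, a minor of `G` on `R`, to which the density
bound applies. -/
theorem card_pairs_le {r : ℕ} (hr : 0 < r)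
    (hG : ¬ IsMinor (completeBipartiteGraph (Fin 3) (Fin r)) G) {R Z : Finset V} {u v : V → V}
    (hd : Disjoint R Z) (hu : ∀ z ∈ Z, G.Adj z (u z)) (hv : ∀ z ∈ Z, G.Adj z (v z))
    (huR : ∀ z ∈ Z, u z ∈ R) (hvR : ∀ z ∈ Z, v z ∈ R) (huv : ∀ z ∈ Z, u z ≠ v z) :
    (Z.image (fun z => s(u z, v z))).card ≤ 4 * r * R.card := by
  classical
  let M := pairGraph R Z u v
  have hM : ¬ IsMinor (completeBipartiteGraph (Fin 3) (Fin r)) M :=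
    fun h => hG (h.trans (isMinor_pairGraph G hd hu hv))
  have h1 := degSum_le_of_not_isMinor M hr hM Finset.univ
  have h2 : degSum M Finset.univ = 2 * M.edgeFinset.card := by
    rw [← M.sum_degrees_eq_twice_card_edges]
    refine Finset.sum_congr rfl fun a _ => ?_
    rw [← M.card_neighborFinset_eq_degree, M.neighborFinset_eq_filter]
  have h3 : Z.image (fun z => s(u z, v z)) ⊆ M.edgeFinset.image (Sym2.map Subtype.val) := by
    intro e he
    obtain ⟨z, hz, rfl⟩ := Finset.mem_image.1 he
    refine Finset.mem_image.2 ⟨s(⟨u z, huR z hz⟩, ⟨v z, hvR z hz⟩), ?_, rfl⟩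
    rw [SimpleGraph.mem_edgeFinset, SimpleGraph.mem_edgeSet]
    rw [show M = pairGraph R Z u v from rfl, pairGraph, SimpleGraph.fromRel_adj]
    exact ⟨fun h => huv z hz (congrArg Subtype.val h), Or.inl ⟨z, hz, rfl, rfl⟩⟩
  have h4 := (Finset.card_le_card h3).trans Finset.card_image_le
  have h5 : (Finset.univ : Finset {y // y ∈ R}).card = R.card := by simp
  rw [h2, h5] at h1
  linarith

/-- The constant in the linear bound on the number of vertices with three neighbours in a set. -/
def tripleConst (r : ℕ) : ℕ := 4 * r + r * (8 * r) ^ 2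

/-- Peel off a vertex `a` of degree at most `q`. A triple through `a` is given by two of its
neighbours, so at most `q ^ 2` triples disappear, each belonging to at most `r` elements of `W`. -/
theorem card_triangles_le {α ι : Type*} [DecidableEq α] [DecidableEq ι] (M : SimpleGraph ι)
    [DecidableRel M.Adj] {q r : ℕ} (hq : ∀ A : Finset ι, degSum M A ≤ q * A.card)
    (W : Finset α) (T : α → Finset ι) (hT : ∀ w ∈ W, (T w).card = 3)
    (hadj : ∀ w ∈ W, ∀ a ∈ T w, ∀ b ∈ T w, a ≠ b → M.Adj a b)
    (hr : ∀ S : Finset ι, (W.filter (fun w => T w = S)).card ≤ r) (A : Finset ι) :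
    (W.filter (fun w => T w ⊆ A)).card ≤ r * q ^ 2 * A.card := by
  induction hn : A.card using Nat.strong_induction_on generalizing A with
  | _ n ih =>
  subst hn
  rcases A.eq_empty_or_nonempty with rfl | hA
  · have : W.filter (fun w => T w ⊆ ∅) = ∅ := by
      refine Finset.filter_eq_empty_iff.2 fun w hw h => ?_
      have := hT w hw
      rw [Finset.subset_empty.1 h] at this
      simp at this
    rw [this]
    simp
  obtain ⟨a, ha, hdeg⟩ : ∃ a ∈ A, (A.filter (M.Adj a)).card ≤ q := by
    by_contra hcon
    push Not at hcon
    have h1 := degSum_of_minDeg M (c := q + 1) hcon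
    have h2 := hq A
    have := Finset.card_pos.2 hA
    nlinarith
  have h1 := ih _ (Finset.card_lt_card (Finset.erase_ssubset ha)) (A.erase a) rfl
  have h2 : (W.filter (fun w => T w ⊆ A ∧ a ∈ T w)).card ≤ r * q ^ 2 := by
    have himg : (W.filter (fun w => T w ⊆ A ∧ a ∈ T w)).image (fun w => (T w).erase a) ⊆
        (A.filter (M.Adj a)).powersetCard 2 := by
      intro S hS
      obtain ⟨w, hw, rfl⟩ := Finset.mem_image.1 hS
      obtain ⟨hw, hwA, haw⟩ := Finset.mem_filter.1 hw
      rw [Finset.mem_powersetCard]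
      refine ⟨fun b hb => ?_, by rw [Finset.card_erase_of_mem haw, hT w hw]⟩
      have hb' := Finset.mem_of_mem_erase hb
      exact Finset.mem_filter.2 ⟨hwA hb', hadj w hw a haw b hb' (Finset.ne_of_mem_erase hb).symm⟩
    have hfib : ∀ S ∈ (W.filter (fun w => T w ⊆ A ∧ a ∈ T w)).image (fun w => (T w).erase a),
        ((W.filter (fun w => T w ⊆ A ∧ a ∈ T w)).filter (fun w => (T w).erase a = S)).card ≤ r := by
      intro S _
      refine le_trans (Finset.card_le_card ?_) (hr (insert a S))
      intro w hw
      simp only [Finset.mem_filter] at hw ⊢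
      exact ⟨hw.1.1, by rw [← hw.2, Finset.insert_erase hw.1.2.2]⟩
    refine (Finset.card_le_mul_card_image _ r hfib).trans (Nat.mul_le_mul_left _ ?_)
    refine (Finset.card_le_card himg).trans ?_
    rw [Finset.card_powersetCard]
    exact (Nat.choose_le_pow _ _).trans (Nat.pow_le_pow_left hdeg 2)
  have h3 : W.filter (fun w => T w ⊆ A) ⊆ W.filter (fun w => T w ⊆ A.erase a) ∪
      W.filter (fun w => T w ⊆ A ∧ a ∈ T w) := by
    intro w hw
    simp only [Finset.mem_union, Finset.mem_filter] at hw ⊢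
    by_cases haw : a ∈ T w
    · exact Or.inr ⟨hw.1, hw.2, haw⟩
    · exact Or.inl ⟨hw.1, Finset.subset_erase.2 ⟨hw.2, haw⟩⟩
  have h4 := (Finset.card_le_card h3).trans (Finset.card_union_le _ _)
  have h5 := Finset.card_erase_add_one ha
  nlinarith

/-- Take a maximal `J ⊆ W` whose members can be given distinct pairs of neighbours in `R`; it is
small by `card_pairs_le`. By maximality, any three neighbours of a vertex outside `J` form a
triangle in `pairGraph`. Triangles are few in a sparse graph, and fewer than `r` vertices share one.
-/
theorem card_le_of_three_nbrs [DecidableRel G.Adj] {r : ℕ} (hr : 0 < r)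
    (hG : ¬ IsMinor (completeBipartiteGraph (Fin 3) (Fin r)) G) {R W : Finset V}
    (hd : Disjoint R W) (h3 : ∀ w ∈ W, 3 ≤ (R.filter (G.Adj w)).card) :
    W.card ≤ tripleConst r * R.card := by
  classical
  let P : Finset V → Prop := fun J => ∃ u v : V → V, (∀ z ∈ J, G.Adj z (u z) ∧ G.Adj z (v z) ∧
    u z ∈ R ∧ v z ∈ R ∧ u z ≠ v z) ∧ Set.InjOn (fun z => s(u z, v z)) J
  obtain ⟨J, hJ, hmax⟩ := Finset.exists_max_image (W.powerset.filter P) Finset.card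
    ⟨∅, Finset.mem_filter.2 ⟨Finset.empty_mem_powerset _, id, id, by simp, by simp⟩⟩
  obtain ⟨hJW, u, v, huv, hinj⟩ := Finset.mem_filter.1 hJ
  rw [Finset.mem_powerset] at hJW
  have hdJ : Disjoint R J := hd.mono_right hJW
  have hJcard : J.card ≤ 4 * r * R.card := by
    rw [← Finset.card_image_of_injOn hinj]
    exact card_pairs_le G hr hG hdJ (fun z hz => (huv z hz).1) (fun z hz => (huv z hz).2.1)
      (fun z hz => (huv z hz).2.2.1) (fun z hz => (huv z hz).2.2.2.1)
      (fun z hz => (huv z hz).2.2.2.2)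
  let M := pairGraph R J u v
  have hM : ¬ IsMinor (completeBipartiteGraph (Fin 3) (Fin r)) M :=
    fun h => hG (h.trans (isMinor_pairGraph G hdJ (fun z hz => (huv z hz).1)
      (fun z hz => (huv z hz).2.1)))
  have hT : ∀ w : V, ∃ T : Finset {y // y ∈ R}, w ∈ W → T.card = 3 ∧ ∀ a ∈ T, G.Adj w a := by
    intro w
    by_cases hw : w ∈ W
    · obtain ⟨T, hT, hTc⟩ := Finset.exists_subset_card_eq (h3 w hw)
      have hTR : ∀ a ∈ T, a ∈ R := fun a ha => (Finset.mem_filter.1 (hT ha)).1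
      refine ⟨T.subtype (· ∈ R), fun _ => ⟨?_, ?_⟩⟩
      · rw [Finset.card_subtype, Finset.filter_true_of_mem hTR, hTc]
      · intro a ha
        exact (Finset.mem_filter.1 (hT (Finset.mem_subtype.1 ha))).2
    · exact ⟨∅, fun h => absurd h hw⟩
  choose T hT using hT
  have htri := card_triangles_le M (fun A => degSum_le_of_not_isMinor M hr hM A) (W \ J) T
    (r := r) (fun w hw => (hT w (Finset.mem_sdiff.1 hw).1).1) ?_ ?_ Finset.univ
  · have h1 : (W \ J).filter (fun w => T w ⊆ Finset.univ) = W \ J :=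
      Finset.filter_true_of_mem fun w _ => Finset.subset_univ _
    have h2 : (Finset.univ : Finset {y // y ∈ R}).card = R.card := by simp
    rw [h1, h2] at htri
    have h4 := Finset.card_sdiff_add_card_eq_card hJW
    unfold tripleConst
    nlinarith
  · intro w hw a ha b hb hab
    obtain ⟨hwW, hwJ⟩ := Finset.mem_sdiff.1 hw
    have hwa := (hT w hwW).2 a ha
    have hwb := (hT w hwW).2 b hb
    by_contra hnadj
    -- A nonadjacent pair is not yet in use, so `w` could join `J` with it.
    have hnew : ∀ z ∈ J, s(u z, v z) ≠ s((a : V), (b : V)) := by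
      intro z hz heq
      apply hnadj
      rw [show M = pairGraph R J u v from rfl, pairGraph, SimpleGraph.fromRel_adj]
      refine ⟨hab, ?_⟩
      rcases Sym2.eq_iff.1 heq with h | h
      · exact Or.inl ⟨z, hz, h⟩
      · exact Or.inr ⟨z, hz, h⟩
    have hP : P (insert w J) := by
      have hne : ∀ z ∈ J, z ≠ w := fun z hz h => hwJ (h ▸ hz)
      refine ⟨Function.update u w a, Function.update v w b, ?_, ?_⟩
      · intro z hz
        rcases Finset.mem_insert.1 hz with rfl | hz
        · simp only [Function.update_self]
          exact ⟨hwa, hwb, a.2, b.2, fun h => hab (Subtype.ext h)⟩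
        · simp only [Function.update_of_ne (hne z hz)]
          exact huv z hz
      · rw [Finset.coe_insert, Set.injOn_insert (by simpa using hwJ)]
        refine ⟨fun x hx y hy hxy => ?_, ?_⟩
        · simp only [Function.update_of_ne (hne x hx), Function.update_of_ne (hne y hy)] at hxy
          exact hinj hx hy hxy
        · rintro ⟨z, hz, hzw⟩
          simp only [Function.update_of_ne (hne z hz), Function.update_self] at hzw
          exact hnew z hz hzw
    have := hmax (insert w J) (Finset.mem_filter.2
      ⟨Finset.mem_powerset.2 (Finset.insert_subset hwW hJW), hP⟩)
    rw [Finset.card_insert_of_notMem hwJ] at this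
    omega
  · intro S
    rcases Finset.eq_empty_or_nonempty ((W \ J).filter (fun w => T w = S)) with h0 | ⟨w, hw⟩
    · simp [h0]
    · obtain ⟨hwJ, rfl⟩ := Finset.mem_filter.1 hw
      have hwW : w ∈ W := (Finset.mem_sdiff.1 hwJ).1
      refine (card_lt_of_common_nbrs G hG (T := (T w).image Subtype.val) ?_ ?_).le
      · rw [Finset.card_image_of_injective _ Subtype.val_injective, (hT w hwW).1]
      · intro s hs t ht
        obtain ⟨hs, hsT⟩ := Finset.mem_filter.1 hs
        obtain ⟨b, hb, rfl⟩ := Finset.mem_image.1 ht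
        exact (hT s (Finset.mem_sdiff.1 hs).1).2 b (hsT ▸ hb)

/-- A linear bound on the number of pairwise disjoint connected pieces that touch three out of a
family of pairwise disjoint connected bags. -/
theorem card_pieces_le {α : Type*} [DecidableEq α] {r : ℕ} (hr : 0 < r)
    (hG : ¬ IsMinor (completeBipartiteGraph (Fin 3) (Fin r)) G) (R : Finset V) (I : Finset α)
    (T : V → Set V) (P : α → Set V)
    (hT : ∀ y ∈ R, (G.induce (T y)).Connected) (hP : ∀ i ∈ I, (G.induce (P i)).Connected)
    (hTd : ∀ y ∈ R, ∀ y' ∈ R, y ≠ y' → Disjoint (T y) (T y'))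
    (hPd : ∀ i ∈ I, ∀ j ∈ I, i ≠ j → Disjoint (P i) (P j))
    (hTP : ∀ y ∈ R, ∀ i ∈ I, Disjoint (T y) (P i))
    (h3 : ∀ i ∈ I, ∃ a ∈ R, ∃ b ∈ R, ∃ c ∈ R, a ≠ b ∧ a ≠ c ∧ b ≠ c ∧
      (∃ x ∈ T a, ∃ y ∈ P i, G.Adj x y) ∧ (∃ x ∈ T b, ∃ y ∈ P i, G.Adj x y) ∧
      (∃ x ∈ T c, ∃ y ∈ P i, G.Adj x y)) :
    I.card ≤ tripleConst r * R.card := by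
  classical
  -- Only edges between bags and pieces are retained, so the claim becomes `card_le_of_three_nbrs`
  -- in a bipartite minor.
  let M : SimpleGraph ({y // y ∈ R} ⊕ {i // i ∈ I}) := SimpleGraph.fromRel (fun s t =>
    ∃ a i, s = Sum.inl a ∧ t = Sum.inr i ∧ ∃ x ∈ T a.1, ∃ y ∈ P i.1, G.Adj x y)
  have hMG : IsMinor M G := by
    refine ⟨Sum.elim (fun a => T a.1) (fun i => P i.1), ?_, ?_, ?_⟩
    · rintro (a | i)
      · exact hT a a.2
      · exact hP i i.2
    · rintro (a | i) (a' | i') hne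
      · exact hTd a a.2 a' a'.2 fun h => hne (by rw [Subtype.ext h])
      · exact hTP a a.2 i' i'.2
      · exact (hTP a' a'.2 i i.2).symm
      · exact hPd i i.2 i' i'.2 fun h => hne (by rw [Subtype.ext h])
    · intro s t hst
      rw [SimpleGraph.fromRel_adj] at hst
      obtain ⟨_, ⟨a, i, rfl, rfl, x, hx, y, hy, hxy⟩ | ⟨a, i, rfl, rfl, x, hx, y, hy, hxy⟩⟩ := hst
      · exact ⟨x, hx, y, hy, hxy⟩
      · exact ⟨y, hy, x, hx, hxy.symm⟩
  have hM : ¬ IsMinor (completeBipartiteGraph (Fin 3) (Fin r)) M := fun h => hG (h.trans hMG)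
  have := card_le_of_three_nbrs M hr hM
    (R := Finset.univ.image Sum.inl) (W := Finset.univ.image Sum.inr) ?_ ?_
  · rw [Finset.card_image_of_injective _ Sum.inl_injective,
      Finset.card_image_of_injective _ Sum.inr_injective] at this
    simpa using this
  · rw [Finset.disjoint_left]
    intro x hx hx'
    obtain ⟨a, _, rfl⟩ := Finset.mem_image.1 hx
    obtain ⟨b, _, hb⟩ := Finset.mem_image.1 hx'
    exact Sum.inr_ne_inl hb
  · intro w hw
    obtain ⟨i, _, rfl⟩ := Finset.mem_image.1 hw
    obtain ⟨a, ha, b, hb, c, hc, hab, hac, hbc, h1, h2, h3⟩ := h3 i i.2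
    have hadj : ∀ y (hy : y ∈ R), (∃ x ∈ T y, ∃ z ∈ P i, G.Adj x z) →
        (Sum.inl ⟨y, hy⟩ : {y // y ∈ R} ⊕ {i // i ∈ I}) ∈
          (Finset.univ.image Sum.inl).filter (M.Adj (Sum.inr i)) := by
      intro y hy h
      refine Finset.mem_filter.2 ⟨Finset.mem_image_of_mem _ (Finset.mem_univ _), ?_⟩
      rw [SimpleGraph.fromRel_adj]
      exact ⟨Sum.inr_ne_inl, Or.inr ⟨_, _, rfl, rfl, h⟩⟩
    have hsub : ({Sum.inl ⟨a, ha⟩, Sum.inl ⟨b, hb⟩, Sum.inl ⟨c, hc⟩} :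
        Finset ({y // y ∈ R} ⊕ {i // i ∈ I})) ⊆
          (Finset.univ.image Sum.inl).filter (M.Adj (Sum.inr i)) := by
      intro x hx
      simp only [Finset.mem_insert, Finset.mem_singleton] at hx
      rcases hx with rfl | rfl | rfl
      exacts [hadj a ha h1, hadj b hb h2, hadj c hc h3]
    refine le_trans ?_ (Finset.card_le_card hsub)
    rw [Finset.card_eq_three.2 ⟨_, _, _, ?_, ?_, ?_, rfl⟩]
    · simpa using hab
    · simpa using hac
    · simpa using hbc

end Counting

/-! ### The closure and its linear size -/

section Closure

variable {V : Type*} [Fintype V] [DecidableEq V] (G : SimpleGraph V) [DecidableRel G.Adj]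

/-- The vertices outside `K` that have the same neighbours in `K` as `z`. -/
def nbrClass (K : Finset V) (z : V) : Finset V :=
  Finset.univ.filter (fun z' => z' ∉ K ∧ K.filter (G.Adj z') = K.filter (G.Adj z))

/-- Some neighbour of `w` in `X` has a neighbour outside `K` with a class of size at least `B`. -/
def Supported (X : Finset V) (B : ℕ) (K : Finset V) (w : V) : Prop :=
  ∃ x ∈ X, G.Adj x w ∧ ∃ z, z ∉ K ∧ G.Adj x z ∧ B ≤ (nbrClass G K z).card

open Classical in
/-- One round of the closure: all unsupported vertices are added. -/
noncomputable def closureStep (X : Finset V) (B : ℕ) (K : Finset V) : Finset V :=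
  K ∪ Finset.univ.filter (fun w => ¬ Supported G X B K w)

/-- A record of how `K` arose from `X`: `KK x` is the set at the moment when `x` ceased to have
neighbours in large classes. -/
def ClosureRecord (X : Finset V) (B : ℕ) (K : Finset V) (KK : V → Finset V) : Prop :=
  ∀ x ∈ X, (∃ h ∈ K, h ∉ X ∧ G.Adj x h) → X ⊆ KK x ∧ KK x ⊆ K ∧
    (∀ h ∈ KK x, h ∉ X → ¬ G.Adj x h) ∧
    (∀ z, z ∉ KK x → G.Adj x z → (nbrClass G (KK x) z).card < B) ∧
    (∀ h ∈ KK x, h ∉ X → ∀ y ∈ X, G.Adj y h → KK y ⊆ KK x)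

theorem exists_closureRecord_self (X : Finset V) (B : ℕ) :
    ∃ KK, ClosureRecord G X B X KK :=
  ⟨fun _ => X, fun _ _ ⟨_, h, h', _⟩ => absurd h h'⟩

/-- For every `x` without neighbours in `K \ X`, the record is set to the current `K`. If such an
`x` gains a neighbour in this round, that neighbour was unsupported, so no neighbour of `x` outside
`K` lies in a class of size at least `B`. Older entries stay as they are and lie inside `K`, which
gives the monotonicity clause. -/
theorem exists_closureRecord_step {X : Finset V} {B : ℕ} {K : Finset V} (hXK : X ⊆ K)
    (h : ∃ KK, ClosureRecord G X B K KK) :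
    ∃ KK, ClosureRecord G X B (closureStep G X B K) KK := by
  classical
  obtain ⟨KK, hKK⟩ := h
  have hsub : K ⊆ closureStep G X B K := Finset.subset_union_left
  refine ⟨fun x => if ∃ h ∈ K, h ∉ X ∧ G.Adj x h then KK x else K, fun x hx hex => ?_⟩
  have hold : ∀ h ∈ K, h ∉ X → ∀ y, G.Adj y h →
      (if ∃ h ∈ K, h ∉ X ∧ G.Adj y h then KK y else K) = KK y :=
    fun h hh hX y hy => if_pos ⟨h, hh, hX, hy⟩
  by_cases hc : ∃ h ∈ K, h ∉ X ∧ G.Adj x h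
  · simp only [if_pos hc]
    obtain ⟨h1, h2, h3, h4, h5⟩ := hKK x hx hc
    refine ⟨h1, h2.trans hsub, h3, h4, fun h hh hX y hy hyh => ?_⟩
    rw [hold h (h2 hh) hX y hyh]
    exact h5 h hh hX y hy hyh
  · simp only [if_neg hc]
    refine ⟨hXK, hsub, fun h hh hX hxh => hc ⟨h, hh, hX, hxh⟩, fun z hz hxz => ?_,
      fun h hh hX y hy hyh => ?_⟩
    · obtain ⟨w, hw, hwX, hxw⟩ := hex
      rcases Finset.mem_union.1 hw with hw | hw
      · exact absurd ⟨w, hw, hwX, hxw⟩ hc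
      · by_contra hlt
        exact (Finset.mem_filter.1 hw).2 ⟨x, hx, hxw, z, hz, hxz, not_lt.1 hlt⟩
    · rw [hold h hh hX y hyh]
      exact (hKK y hy ⟨h, hh, hX, hyh⟩).2.1

/-- Each `z` touches `a z`, `b z` and, through its helper `h z`, a third vertex of `R`. A third of
`A` can be selected so that no selected vertex is a helper of a selected one; then the helpers are
contracted into `R` and the selected vertices are singleton pieces. -/
theorem card_le_of_helper {r : ℕ} (hr : 0 < r)
    (hG : ¬ IsMinor (completeBipartiteGraph (Fin 3) (Fin r)) G) (R A : Finset V)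
    (a b h ρ : V → V) (hA : ∀ z ∈ A, z ∉ R) (ha : ∀ z ∈ A, a z ∈ R ∧ G.Adj z (a z))
    (hb : ∀ z ∈ A, b z ∈ R ∧ G.Adj z (b z)) (hab : ∀ z ∈ A, a z ≠ b z)
    (hh : ∀ z ∈ A, h z ∉ R ∧ G.Adj z (h z))
    (hρ : ∀ z ∈ A, ρ (h z) ∈ R ∧ G.Adj (ρ (h z)) (h z) ∧ a z ≠ ρ (h z) ∧ b z ≠ ρ (h z)) :
    A.card ≤ 3 * tripleConst r * R.card := by
  obtain ⟨I, hIA, hI, hcard⟩ := exists_conflictFree_subset (q := 1) A (fun z => {h z})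
    (fun z => by simp)
  have hI' : ∀ z ∈ I, ∀ z' ∈ I, z' ≠ h z := by
    intro z hz z' hz' heq
    by_cases hzz : z = z'
    · exact (hh z (hIA hz)).2.ne (hzz.trans heq)
    · exact hI z hz z' hz' hzz (by simp [heq])
  have := card_pieces_le G hr hG R I
    (fun y => insert y {g | ∃ z ∈ I, g = h z ∧ ρ g = y}) (fun z => {z}) ?_
    (fun z _ => connected_induce_singleton G z) ?_ ?_ ?_ ?_
  · calc A.card ≤ (2 * 1 + 1) * I.card := hcard
      _ ≤ 3 * (tripleConst r * R.card) := Nat.mul_le_mul_left _ this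
      _ = _ := by ring
  · intro y _
    refine connected_induce_star G y _ (Set.mem_insert _ _) ?_
    rintro g (rfl | ⟨z, hz, rfl, rfl⟩) hne
    · exact absurd rfl hne
    · exact (hρ z (hIA hz)).2.1
  · intro y hy y' hy' hne
    rw [Set.disjoint_left]
    rintro g (rfl | ⟨z, hz, rfl, rfl⟩) (h' | ⟨z', hz', hz1, hz2⟩)
    · exact hne h'
    · exact (hh z' (hIA hz')).1 (hz1 ▸ hy)
    · exact (hh z (hIA hz)).1 (h' ▸ hy')
    · exact hne hz2
  · intro z _ z' _ hne
    exact Set.disjoint_singleton.2 hne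
  · intro y hy z hz
    rw [Set.disjoint_singleton_right]
    rintro (h' | ⟨z', hz', h', _⟩)
    · exact hA z (hIA hz) (h' ▸ hy)
    · exact hI' z' hz' z hz h'
  · intro z hz
    have hz' := hIA hz
    refine ⟨a z, (ha z hz').1, b z, (hb z hz').1, ρ (h z), (hρ z hz').1, hab z hz',
      (hρ z hz').2.2.1, (hρ z hz').2.2.2, ⟨a z, Or.inl rfl, z, rfl, (ha z hz').2.symm⟩,
      ⟨b z, Or.inl rfl, z, rfl, (hb z hz').2.symm⟩,
      ⟨h z, Or.inr ⟨z, hz, rfl, rfl⟩, z, rfl, (hh z hz').2.symm⟩⟩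

/-- The constant in the linear bound on the size of the closure. -/
def closureConst (r B : ℕ) : ℕ :=
  (1 + 7 * tripleConst r + 8 * B * r) * ((1 + 9 * tripleConst r) * (1 + B))

/-- Each `z` in `K \ X` picks a neighbour `f z` in `X`. No vertex of `KK (f z)` outside `X` is
adjacent to `f z`, so a second neighbour `p z` in that set leads to a contact other than `f z`.
Vertices without a `p z` are few because classes were small. Adding them and all second neighbours
to `X` keeps the base linear; each remaining vertex then has two base neighbours and is counted by a
third contact or by its pair. -/
theorem card_closure_le {r : ℕ} (hr : 0 < r)
    (hG : ¬ IsMinor (completeBipartiteGraph (Fin 3) (Fin r)) G) {X K : Finset V} {B : ℕ}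
    (hdom : ∀ z ∈ K, z ∉ X → ∃ x ∈ X, G.Adj x z)
    (hrec : ∃ KK, ClosureRecord G X B K KK) :
    K.card ≤ closureConst r B * X.card := by
  classical
  obtain ⟨KK, hKK⟩ := hrec
  set H := K \ X with hH
  have memH : ∀ z, z ∈ H ↔ z ∈ K ∧ z ∉ X := fun z => Finset.mem_sdiff
  have hf : ∀ z, ∃ x, z ∈ H → x ∈ X ∧ G.Adj x z := by
    intro z
    by_cases hz : z ∈ H
    · obtain ⟨x, hx, h⟩ := hdom z ((memH z).1 hz).1 ((memH z).1 hz).2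
      exact ⟨x, fun _ => ⟨hx, h⟩⟩
    · exact ⟨z, fun h => absurd h hz⟩
  choose f hf using hf
  have hrec : ∀ z ∈ H, _ := fun z hz => hKK (f z) (hf z hz).1
    ⟨z, ((memH z).1 hz).1, ((memH z).1 hz).2, (hf z hz).2⟩
  have hKsub : ∀ z ∈ H, X ⊆ KK (f z) := fun z hz => (hrec z hz).1
  have hKK' : ∀ z ∈ H, KK (f z) ⊆ K := fun z hz => (hrec z hz).2.1
  have hnadj : ∀ z ∈ H, ∀ h ∈ KK (f z), h ∈ H → ¬ G.Adj (f z) h :=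
    fun z hz h hh hhH => (hrec z hz).2.2.1 h hh ((memH h).1 hhH).2
  have hmono : ∀ z ∈ H, ∀ h ∈ KK (f z), h ∈ H → KK (f h) ⊆ KK (f z) :=
    fun z hz h hh hhH => (hrec z hz).2.2.2.2 h hh ((memH h).1 hhH).2 (f h) (hf h hhH).1 (hf h hhH).2
  have hself : ∀ z ∈ H, z ∉ KK (f z) := fun z hz hz' => hnadj z hz z hz' hz (hf z hz).2
  -- The trace of `z` on the recorded set. Vertices with the same `f` and the same trace lie in one
  -- class, which had fewer than `B` elements.
  let c : V → Finset V := fun z => (KK (f z)).filter (G.Adj z)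
  have hcf : ∀ z ∈ H, f z ∈ c z := fun z hz =>
    Finset.mem_filter.2 ⟨hKsub z hz (hf z hz).1, (hf z hz).2.symm⟩
  have hfib : ∀ x S, (H.filter (fun z => f z = x ∧ c z = S)).card ≤ B := by
    intro x S
    rcases Finset.eq_empty_or_nonempty (H.filter (fun z => f z = x ∧ c z = S)) with h0 | ⟨z₀, hz₀⟩
    · simp [h0]
    · obtain ⟨hz₁, rfl, rfl⟩ := Finset.mem_filter.1 hz₀
      refine le_trans (Finset.card_le_card ?_)
        ((hrec z₀ hz₁).2.2.2.1 z₀ (hself z₀ hz₁) (hf z₀ hz₁).2).le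
      intro z hz
      obtain ⟨hz, hz1, hz2⟩ := Finset.mem_filter.1 hz
      refine Finset.mem_filter.2 ⟨Finset.mem_univ _, hz1 ▸ hself z hz, ?_⟩
      have : c z = (KK (f z₀)).filter (G.Adj z) := by simp only [c, hz1]
      rw [← this, hz2]
  set Q₀ := H.filter (fun z => c z = {f z}) with hQ₀
  have hQ₀card : Q₀.card ≤ B * X.card := by
    refine Finset.card_le_mul_card_image_of_maps_to (f := f)
      (fun z hz => (hf z (Finset.mem_filter.1 hz).1).1) B fun x _ => ?_
    refine le_trans (Finset.card_le_card ?_) (hfib x {x})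
    intro z hz
    obtain ⟨hzQ, rfl⟩ := Finset.mem_filter.1 hz
    exact Finset.mem_filter.2 ⟨(Finset.mem_filter.1 hzQ).1, rfl, (Finset.mem_filter.1 hzQ).2⟩
  have hp : ∀ z, ∃ p, z ∈ H → z ∉ Q₀ → p ∈ c z ∧ p ≠ f z := by
    intro z
    by_contra hcon
    push Not at hcon
    obtain ⟨hz, hzQ, -⟩ := hcon z
    refine hzQ (Finset.mem_filter.2 ⟨hz, ?_⟩)
    refine Finset.eq_singleton_iff_unique_mem.2 ⟨hcf z hz, fun y hy => (hcon y).2.2 hy⟩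
  choose p hp using hp
  set X₁ := X ∪ Q₀ with hX₁
  have hX₁card : X₁.card ≤ (1 + B) * X.card := by
    refine (Finset.card_union_le _ _).trans ?_
    linarith
  have hnX₁ : ∀ z, z ∈ K → z ∉ X₁ → z ∈ H ∧ z ∉ Q₀ := by
    intro z hz hz1
    rw [hX₁, Finset.mem_union, not_or] at hz1
    exact ⟨(memH z).2 ⟨hz, hz1.1⟩, hz1.2⟩
  have hHX₁ : ∀ z ∈ H, z ∉ Q₀ → z ∉ X₁ := by
    intro z hz hzQ hz1
    rcases Finset.mem_union.1 hz1 with h | h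
    · exact ((memH z).1 hz).2 h
    · exact hzQ h
  have hpadj : ∀ z ∈ H, z ∉ Q₀ → G.Adj z (p z) := fun z hz hzQ =>
    (Finset.mem_filter.1 (hp z hz hzQ).1).2
  have hpKK : ∀ z ∈ H, z ∉ Q₀ → p z ∈ KK (f z) := fun z hz hzQ =>
    (Finset.mem_filter.1 (hp z hz hzQ).1).1
  -- The second neighbours outside `X₁`; adding them puts both `f z` and `p z` into `X₂` for every
  -- remaining `z`.
  set Q₁ := (H \ Q₀).filter (fun h => ∃ z ∈ H, z ∉ Q₀ ∧ p z = h) with hQ₁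
  have hζ : ∀ h, ∃ z, h ∈ Q₁ → z ∈ H ∧ z ∉ Q₀ ∧ p z = h := by
    intro h
    by_cases hh : h ∈ Q₁
    · obtain ⟨z, hz⟩ := (Finset.mem_filter.1 hh).2
      exact ⟨z, fun _ => hz⟩
    · exact ⟨h, fun h' => absurd h' hh⟩
  choose ζ hζ using hζ
  have hQ₁H : ∀ h ∈ Q₁, h ∈ H ∧ h ∉ Q₀ := fun h hh => Finset.mem_sdiff.1 (Finset.mem_filter.1 hh).1
  have hQ₁card : Q₁.card ≤ 9 * tripleConst r * X₁.card := by
    -- Avoiding these conflicts makes the edges `{ζ h, h}` disjoint and keeps each `p h` off all of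
    -- them. As `p (ζ h) = h`, the map `ζ` is injective on `Q₁`, hence at most `2 + 2` conflicts.
    have hforb : ∀ h, (({ζ h, p h} : Finset V) ∪
        Q₁.filter (fun h' => ζ h' ∈ ({h, p h} : Finset V))).card ≤ 4 := by
      intro h
      have h1 : (Q₁.filter (fun h' => ζ h' ∈ ({h, p h} : Finset V))).card ≤ 2 := by
        refine le_trans (Finset.card_le_card_of_injOn ζ (t := {h, p h}) ?_ ?_) Finset.card_le_two
        · intro h' hh'
          exact (Finset.mem_filter.1 hh').2
        · intro a ha b hb hab
          rw [← (hζ a (Finset.mem_filter.1 ha).1).2.2, ← (hζ b (Finset.mem_filter.1 hb).1).2.2, hab]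
      have h2 : ({ζ h, p h} : Finset V).card ≤ 2 := Finset.card_le_two
      exact (Finset.card_union_le _ _).trans (by omega)
    obtain ⟨I, hIQ, hI, hcard⟩ := exists_conflictFree_subset (q := 4) Q₁ _ hforb
    have hdis : ∀ h ∈ I, ∀ h' ∈ I, h ≠ h' → h' ≠ ζ h ∧ h' ≠ p h ∧ ζ h' ≠ h ∧ ζ h' ≠ p h := by
      intro h hh h' hh' hne
      have := hI h hh h' hh' hne
      have hh'' := hIQ hh'
      simp only [Finset.mem_union, Finset.mem_insert, Finset.mem_singleton, Finset.mem_filter,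
        hh'', true_and, not_or] at this
      exact ⟨this.1.1, this.1.2, this.2.1, this.2.2⟩
    have hxh : ∀ h ∈ I, h ∈ KK (f (ζ h)) := by
      intro h hh
      obtain ⟨h1, h2, h3⟩ := hζ h (hIQ hh)
      have := hpKK _ h1 h2
      rwa [h3] at this
    have hpp : ∀ h ∈ I, p h ∈ KK (f (ζ h)) := by
      intro h hh
      have h1 := hQ₁H h (hIQ hh)
      exact hmono _ (hζ h (hIQ hh)).1 h (hxh h hh) h1.1 (hpKK h h1.1 h1.2)
    have hself' : ∀ h ∈ I, h ≠ ζ h ∧ p h ≠ h ∧ p h ≠ ζ h := by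
      intro h hh
      obtain ⟨h1, h2, h3⟩ := hζ h (hIQ hh)
      have h4 := hQ₁H h (hIQ hh)
      refine ⟨fun h' => ?_, (hpadj h h4.1 h4.2).ne', fun h' => ?_⟩
      · exact hself _ h1 (h' ▸ hxh h hh)
      · exact hself _ h1 (h' ▸ hpp h hh)
    have hpH : ∀ h ∈ I, p h ∉ X₁ → p h ∈ H ∧ p h ∉ Q₀ := by
      intro h hh hX
      have h4 := hQ₁H h (hIQ hh)
      exact hnX₁ _ (hKK' h h4.1 (hpKK h h4.1 h4.2)) hX
    -- The pieces are the edges `{ζ h, h}`. Each `p h` outside `X₁` is contracted into `f (p h)`, so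
    -- the third contact is `p h` or `f (p h)`.
    have := card_pieces_le G hr hG X₁ I
      (fun y => insert y {g | g ∉ X₁ ∧ ∃ h ∈ I, g = p h ∧ f g = y}) (fun h => {ζ h, h})
      ?_ ?_ ?_ ?_ ?_ ?_
    · calc Q₁.card ≤ (2 * 4 + 1) * I.card := hcard
        _ ≤ 9 * (tripleConst r * X₁.card) := Nat.mul_le_mul_left _ this
        _ = _ := by ring
    · intro y _
      refine connected_induce_star G y _ (Set.mem_insert _ _) ?_
      rintro g (rfl | ⟨hg, h, hh, rfl, rfl⟩) hne
      · exact absurd rfl hne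
      · exact (hf _ (hpH h hh hg).1).2
    · intro h hh
      obtain ⟨h1, h2, h3⟩ := hζ h (hIQ hh)
      refine connected_induce_star G h _ (by simp) ?_
      rintro w (rfl | rfl) hne
      · have := hpadj _ h1 h2
        rw [h3] at this
        exact this.symm
      · exact absurd rfl hne
    · intro y hy y' hy' hne
      rw [Set.disjoint_left]
      rintro g (rfl | ⟨hg, h, hh, rfl, rfl⟩) (h' | ⟨hg', z', hz', hz1, hz2⟩)
      · exact hne h'
      · exact hg' hy
      · exact hg (h' ▸ hy')
      · exact hne hz2
    · intro h hh h' hh' hne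
      rw [Set.disjoint_left]
      have d := hdis h hh h' hh' hne
      have d' := hdis h' hh' h hh hne.symm
      rintro g (rfl | rfl) (h1 | h1)
      · have e1 := (hζ h (hIQ hh)).2.2
        have e2 := (hζ h' (hIQ hh')).2.2
        rw [← h1, e1] at e2
        exact hne e2
      · exact d.1 h1.symm
      · exact d'.1 h1
      · exact hne h1
    · intro y hy h hh
      rw [Set.disjoint_left]
      have hsf := hself' h hh
      obtain ⟨h1, h2, h3⟩ := hζ h (hIQ hh)
      have h4 := hQ₁H h (hIQ hh)
      rintro g (rfl | ⟨hg, h', hh', rfl, rfl⟩) (h5 | h5)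
      · exact hHX₁ _ h1 h2 (h5 ▸ hy)
      · exact hHX₁ _ h4.1 h4.2 (h5 ▸ hy)
      · by_cases hhh : h' = h
        · subst hhh; exact hsf.2.2 h5
        · exact (hdis h' hh' h hh hhh).2.2.2 h5.symm
      · by_cases hhh : h' = h
        · subst hhh; exact hsf.2.1 h5
        · exact (hdis h' hh' h hh hhh).2.1 h5.symm
    · intro h hh
      obtain ⟨h1, h2, h3⟩ := hζ h (hIQ hh)
      have h4 := hQ₁H h (hIQ hh)
      have hfX : ∀ z ∈ H, f z ∈ X₁ := fun z hz => Finset.mem_union_left _ (hf z hz).1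
      -- The contacts differ: `f (ζ h)` is not adjacent to `h`, and if `p h` lies outside `X₁`,
      -- neither `f (ζ h)` (by monotonicity of the record) nor `f h` is adjacent to `p h`.
      have hxh' : ¬ G.Adj (f (ζ h)) h := hnadj _ h1 h (hxh h hh) h4.1
      have e1 : f (ζ h) ≠ f h := fun e => hxh' (e ▸ (hf h h4.1).2)
      have hadjp := hpadj h h4.1 h4.2
      by_cases hpX : p h ∈ X₁
      · refine ⟨f (ζ h), hfX _ h1, f h, hfX _ h4.1, p h, hpX, e1, ?_, (hp h h4.1 h4.2).2.symm,
          ⟨_, Or.inl rfl, ζ h, Or.inl rfl, (hf _ h1).2⟩, ⟨_, Or.inl rfl, h, Or.inr rfl, (hf _ h4.1).2⟩,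
          ⟨_, Or.inl rfl, h, Or.inr rfl, hadjp.symm⟩⟩
        intro e
        exact hxh' (e ▸ hadjp.symm)
      · have h5 := hpH h hh hpX
        refine ⟨f (ζ h), hfX _ h1, f h, hfX _ h4.1, f (p h), hfX _ h5.1, e1, ?_, ?_,
          ⟨_, Or.inl rfl, ζ h, Or.inl rfl, (hf _ h1).2⟩, ⟨_, Or.inl rfl, h, Or.inr rfl, (hf _ h4.1).2⟩,
          ⟨p h, Or.inr ⟨hpX, h, hh, rfl, rfl⟩, h, Or.inr rfl, hadjp.symm⟩⟩
        · intro e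
          exact hnadj _ h1 (p h) (hpp h hh) h5.1 (e ▸ (hf _ h5.1).2)
        · intro e
          exact hnadj _ h4.1 (p h) (hpKK h h4.1 h4.2) h5.1 (e ▸ (hf _ h5.1).2)
  set X₂ := X₁ ∪ Q₁ with hX₂
  have hX₂card : X₂.card ≤ (1 + 9 * tripleConst r) * X₁.card := by
    refine (Finset.card_union_le _ _).trans ?_
    linarith
  have hX₂H : ∀ z ∈ H, z ∉ X₂ → z ∉ Q₀ := fun z _ hz hzQ =>
    hz (Finset.mem_union_left _ (Finset.mem_union_right _ hzQ))
  have hfX₂ : ∀ z ∈ H, f z ∈ X₂ := fun z hz =>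
    Finset.mem_union_left _ (Finset.mem_union_left _ (hf z hz).1)
  have hpX₂ : ∀ z ∈ H, z ∉ Q₀ → p z ∈ X₂ := by
    intro z hz hzQ
    by_cases h1 : p z ∈ X₁
    · exact Finset.mem_union_left _ h1
    · refine Finset.mem_union_right _ (Finset.mem_filter.2 ⟨?_, z, hz, hzQ, rfl⟩)
      exact Finset.mem_sdiff.2 (hnX₁ _ (hKK' z hz (hpKK z hz hzQ)) h1)
  set D := H \ X₂ with hD
  have memD : ∀ z ∈ D, z ∈ H ∧ z ∉ X₂ ∧ z ∉ Q₀ := fun z hz =>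
    ⟨(Finset.mem_sdiff.1 hz).1, (Finset.mem_sdiff.1 hz).2,
      hX₂H z (Finset.mem_sdiff.1 hz).1 (Finset.mem_sdiff.1 hz).2⟩
  have hg : ∀ z, ∃ g, z ∈ D → ¬ c z ⊆ X₂ → g ∈ c z ∧ g ∉ X₂ := by
    intro z
    by_cases hz : c z ⊆ X₂
    · exact ⟨z, fun _ h => absurd hz h⟩
    · obtain ⟨g, hg⟩ := Finset.not_subset.1 hz
      exact ⟨g, fun _ _ => hg⟩
  choose g hg using hg
  have hgH : ∀ z ∈ D, ¬ c z ⊆ X₂ → g z ∈ H ∧ g z ∉ Q₀ ∧ g z ∈ KK (f z) ∧ G.Adj z (g z) := by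
    intro z hz hcz
    obtain ⟨h1, h2⟩ := hg z hz hcz
    obtain ⟨h3, h4⟩ := Finset.mem_filter.1 h1
    have h5 := hnX₁ _ (hKK' z (memD z hz).1 h3) fun h => h2 (Finset.mem_union_left _ h)
    exact ⟨h5.1, h5.2, h3, h4⟩
  -- A neighbour `g z` outside `X₂` has the distinct neighbours `f (g z)` and `p (g z)` in `X₂`.
  -- Neither is `f z`, which is not adjacent to `g z`, and at least one differs from `p z`. So each
  -- such `z` is counted with `ρ = f` or with `ρ = p`.
  have hside : ∀ ρ : V → V, (∀ h ∈ H, h ∉ Q₀ → ρ h ∈ X₂ ∧ G.Adj (ρ h) h) →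
      (D.filter (fun z => ¬ c z ⊆ X₂ ∧ p z ≠ ρ (g z))).card ≤ 3 * tripleConst r * X₂.card := by
    intro ρ hρ
    have mem : ∀ z ∈ D.filter (fun z => ¬ c z ⊆ X₂ ∧ p z ≠ ρ (g z)),
        z ∈ D ∧ ¬ c z ⊆ X₂ ∧ p z ≠ ρ (g z) := fun z hz => Finset.mem_filter.1 hz
    refine card_le_of_helper G hr hG X₂ _ f p g ρ ?_ ?_ ?_ ?_ ?_ ?_
    · exact fun z hz => (memD z (mem z hz).1).2.1
    · exact fun z hz => ⟨hfX₂ z (memD z (mem z hz).1).1, (hf z (memD z (mem z hz).1).1).2.symm⟩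
    · intro z hz
      have h := memD z (mem z hz).1
      exact ⟨hpX₂ z h.1 h.2.2, hpadj z h.1 h.2.2⟩
    · intro z hz
      have h := memD z (mem z hz).1
      exact (hp z h.1 h.2.2).2.symm
    · intro z hz
      obtain ⟨h1, h2, h3⟩ := mem z hz
      exact ⟨(hg z h1 h2).2, (hgH z h1 h2).2.2.2⟩
    · intro z hz
      obtain ⟨h1, h2, h3⟩ := mem z hz
      obtain ⟨g1, g2, g3, g4⟩ := hgH z h1 h2
      refine ⟨(hρ _ g1 g2).1, (hρ _ g1 g2).2, fun e => ?_, h3⟩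
      exact hnadj z (memD z h1).1 _ g3 g1 (e ▸ (hρ _ g1 g2).2)
  have hDa := hside f (fun h hh _ => ⟨hfX₂ h hh, (hf h hh).2⟩)
  have hDb := hside p (fun h hh hQ => ⟨hpX₂ h hh hQ, (hpadj h hh hQ).symm⟩)
  have hDc : (D.filter (fun z => 3 ≤ (X₂.filter (G.Adj z)).card)).card ≤
      tripleConst r * X₂.card := by
    refine card_le_of_three_nbrs G hr hG ?_ fun w hw => (Finset.mem_filter.1 hw).2
    rw [Finset.disjoint_left]
    exact fun z hz hz' => (memD z (Finset.mem_filter.1 hz').1).2.1 hz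
  set D₂ := D.filter (fun z => c z = {f z, p z}) with hD₂
  have hDd : D₂.card ≤ 8 * B * r * X₂.card := by
    have memD₂ : ∀ z ∈ D₂, z ∈ H ∧ z ∉ X₂ ∧ z ∉ Q₀ := fun z hz =>
      memD z (Finset.mem_filter.1 hz).1
    have himg : (D₂.image (fun z => s(f z, p z))).card ≤ 4 * r * X₂.card := by
      refine card_pairs_le G hr hG ?_ ?_ ?_ ?_ ?_ ?_
      · rw [Finset.disjoint_left]
        exact fun z hz hz' => (memD₂ z hz').2.1 hz
      · exact fun z hz => (hf z (memD₂ z hz).1).2.symm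
      · exact fun z hz => hpadj z (memD₂ z hz).1 (memD₂ z hz).2.2
      · exact fun z hz => hfX₂ z (memD₂ z hz).1
      · exact fun z hz => hpX₂ z (memD₂ z hz).1 (memD₂ z hz).2.2
      · exact fun z hz => (hp z (memD₂ z hz).1 (memD₂ z hz).2.2).2.symm
    -- An unordered pair does not tell which end is `f z`, hence the factor `2`.
    have hfibre : ∀ e ∈ D₂.image (fun z => s(f z, p z)),
        (D₂.filter (fun z => s(f z, p z) = e)).card ≤ 2 * B := by
      intro e _
      induction e using Sym2.ind with
      | _ a b =>
      have hsub : D₂.filter (fun z => s(f z, p z) = s(a, b)) ⊆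
          H.filter (fun z => f z = a ∧ c z = {a, b}) ∪
            H.filter (fun z => f z = b ∧ c z = {a, b}) := by
        intro z hz
        obtain ⟨hz, he⟩ := Finset.mem_filter.1 hz
        have hzc := (Finset.mem_filter.1 hz).2
        rw [Finset.mem_union, Finset.mem_filter, Finset.mem_filter]
        rcases Sym2.eq_iff.1 he with ⟨h1, h2⟩ | ⟨h1, h2⟩
        · exact Or.inl ⟨(memD₂ z hz).1, h1, by rw [hzc, h1, h2]⟩
        · exact Or.inr ⟨(memD₂ z hz).1, h1, by rw [hzc, h1, h2, Finset.pair_comm]⟩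
      refine ((Finset.card_le_card hsub).trans (Finset.card_union_le _ _)).trans ?_
      have := hfib a {a, b}
      have := hfib b {a, b}
      omega
    refine (Finset.card_le_mul_card_image _ _ hfibre).trans ?_
    calc 2 * B * (D₂.image (fun z => s(f z, p z))).card ≤ 2 * B * (4 * r * X₂.card) :=
          Nat.mul_le_mul_left _ himg
      _ = _ := by ring
  -- The four parts besides `X₂` contribute `3 + 3 + 1` times `tripleConst r` and the pair bound,
  -- which is the first factor of `closureConst`.
  have hcover : K ⊆ X₂ ∪ (D.filter (fun z => ¬ c z ⊆ X₂ ∧ p z ≠ f (g z)) ∪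
      (D.filter (fun z => ¬ c z ⊆ X₂ ∧ p z ≠ p (g z)) ∪
      (D.filter (fun z => 3 ≤ (X₂.filter (G.Adj z)).card) ∪ D₂))) := by
    intro z hz
    by_cases hzX : z ∈ X₂
    · exact Finset.mem_union_left _ hzX
    refine Finset.mem_union_right _ ?_
    have hzH : z ∈ H := (memH z).2 ⟨hz, fun h => hzX
      (Finset.mem_union_left _ (Finset.mem_union_left _ h))⟩
    have hzD : z ∈ D := Finset.mem_sdiff.2 ⟨hzH, hzX⟩
    have hzQ := (memD z hzD).2.2
    simp only [Finset.mem_union, Finset.mem_filter, hzD, true_and, hD₂]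
    by_cases hcz : c z ⊆ X₂
    · by_cases h3 : 3 ≤ (X₂.filter (G.Adj z)).card
      · exact Or.inr (Or.inr (Or.inl h3))
      · refine Or.inr (Or.inr (Or.inr ?_))
        have h4 : c z ⊆ X₂.filter (G.Adj z) := fun y hy =>
          Finset.mem_filter.2 ⟨hcz hy, (Finset.mem_filter.1 hy).2⟩
        have h5 : (c z).card ≤ 2 := by
          have := Finset.card_le_card h4
          omega
        symm
        apply Finset.eq_of_subset_of_card_le
        · intro y hy
          rcases Finset.mem_insert.1 hy with rfl | hy
          · exact hcf z hzH
          · rw [Finset.mem_singleton.1 hy]; exact (hp z hzH hzQ).1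
        · rw [Finset.card_pair (hp z hzH hzQ).2.symm]; exact h5
    · obtain ⟨g1, g2, g3, g4⟩ := hgH z hzD hcz
      by_cases hpf : p z = f (g z)
      · refine Or.inr (Or.inl ⟨hcz, fun e => ?_⟩)
        exact (hp _ g1 g2).2 (e.symm.trans hpf)
      · exact Or.inl ⟨hcz, hpf⟩
  have h0 := Finset.card_le_card hcover
  have h1 := Finset.card_union_le X₂ (D.filter (fun z => ¬ c z ⊆ X₂ ∧ p z ≠ f (g z)) ∪
      (D.filter (fun z => ¬ c z ⊆ X₂ ∧ p z ≠ p (g z)) ∪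
      (D.filter (fun z => 3 ≤ (X₂.filter (G.Adj z)).card) ∪ D₂)))
  have h2 := Finset.card_union_le (D.filter (fun z => ¬ c z ⊆ X₂ ∧ p z ≠ f (g z)))
      (D.filter (fun z => ¬ c z ⊆ X₂ ∧ p z ≠ p (g z)) ∪
      (D.filter (fun z => 3 ≤ (X₂.filter (G.Adj z)).card) ∪ D₂))
  have h3 := Finset.card_union_le (D.filter (fun z => ¬ c z ⊆ X₂ ∧ p z ≠ p (g z)))
      (D.filter (fun z => 3 ≤ (X₂.filter (G.Adj z)).card) ∪ D₂)
  have h4 := Finset.card_union_le (D.filter (fun z => 3 ≤ (X₂.filter (G.Adj z)).card)) D₂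
  have h5 : K.card ≤ (1 + 7 * tripleConst r + 8 * B * r) * X₂.card := by linarith
  calc K.card ≤ (1 + 7 * tripleConst r + 8 * B * r) * X₂.card := h5
    _ ≤ (1 + 7 * tripleConst r + 8 * B * r) *
        ((1 + 9 * tripleConst r) * ((1 + B) * X.card)) :=
      Nat.mul_le_mul_left _ (hX₂card.trans (Nat.mul_le_mul_left _ hX₁card))
    _ = closureConst r B * X.card := by unfold closureConst; ring

end Closure

/-! ### Moving all tokens to a reservoir -/

section Reconfiguration

variable {V : Type*} [DecidableEq V] (G : SimpleGraph V)

/-- No two vertices of `S` are adjacent. -/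
def Indep (S : Finset V) : Prop := ∀ u ∈ S, ∀ v ∈ S, ¬ G.Adj u v

theorem indep_iff {S : Finset V} : Indep G S ↔ G.IsIndepSet (S : Set V) :=
  ⟨fun h _ hu _ hv _ => h _ hu _ hv, fun h _ hu _ hv huv => h hu hv huv.ne huv⟩

theorem Indep.mono {S T : Finset V} (h : Indep G T) (hST : S ⊆ T) : Indep G S :=
  fun u hu v hv => h u (hST hu) v (hST hv)

theorem Indep.union {S T : Finset V} (hS : Indep G S) (hT : Indep G T)
    (h : ∀ u ∈ S, ∀ v ∈ T, ¬ G.Adj u v) : Indep G (S ∪ T) := by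
  intro u hu v hv
  rcases Finset.mem_union.1 hu with hu | hu <;> rcases Finset.mem_union.1 hv with hv | hv
  · exact hS u hu v hv
  · exact h u hu v hv
  · exact fun h' => h v hv u hu h'.symm
  · exact hT u hu v hv

/-- A token jump between independent sets inside `M`. -/
def JumpIn (M : Finset V) (A B : Finset V) : Prop :=
  A ⊆ M ∧ B ⊆ M ∧ Indep G A ∧ Indep G B ∧ ∃ v ∈ A, ∃ w, w ∉ A ∧ B = insert w (A.erase v)

/-- Reconfigurability by token jumps inside `M`. -/
def Reach (M : Finset V) : Finset V → Finset V → Prop := Relation.ReflTransGen (JumpIn G M)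

theorem JumpIn.symm {M A B : Finset V} (h : JumpIn G M A B) : JumpIn G M B A := by
  obtain ⟨hA, hB, hiA, hiB, v, hv, w, hw, rfl⟩ := h
  have hvw : v ≠ w := fun h => hw (h ▸ hv)
  refine ⟨hB, hA, hiB, hiA, w, Finset.mem_insert_self _ _, v, ?_, ?_⟩
  · simp [hvw]
  · rw [Finset.erase_insert (fun h => hw (Finset.mem_of_mem_erase h)), Finset.insert_erase hv]

theorem Reach.symm {M A B : Finset V} (h : Reach G M A B) : Reach G M B A := by
  induction h with
  | refl => exact Relation.ReflTransGen.refl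
  | tail _ h ih => exact Relation.ReflTransGen.head (JumpIn.symm G h) ih

theorem Reach.mono {M M' A B : Finset V} (hM : M ⊆ M') (h : Reach G M A B) : Reach G M' A B := by
  induction h with
  | refl => exact Relation.ReflTransGen.refl
  | tail _ h ih => exact ih.tail ⟨h.1.trans hM, h.2.1.trans hM, h.2.2⟩

theorem Reach.card_eq {M A B : Finset V} (h : Reach G M A B) : B.card = A.card := by
  induction h with
  | refl => rfl
  | tail _ h ih =>
    obtain ⟨-, -, -, -, v, hv, w, hw, rfl⟩ := h
    rw [Finset.card_insert_of_notMem (fun h => hw (Finset.mem_of_mem_erase h)),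
      Finset.card_erase_add_one hv, ih]

/-- Sets of the same size inside one independent set are reconfigurable into each other. -/
theorem reach_of_subset {M Q : Finset V} (hQ : Indep G Q) (hQM : Q ⊆ M) {A B : Finset V}
    (hA : A ⊆ Q) (hB : B ⊆ Q) (hAB : A.card = B.card) : Reach G M A B := by
  induction hn : (A \ B).card generalizing A with
  | zero =>
    have : A ⊆ B := by
      rw [Finset.card_eq_zero, Finset.sdiff_eq_empty_iff_subset] at hn
      exact hn
    rw [Finset.eq_of_subset_of_card_le this hAB.ge]
    exact Relation.ReflTransGen.refl
  | succ n ih =>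
    obtain ⟨v, hv⟩ : (A \ B).Nonempty := Finset.card_pos.1 (by omega)
    have hBA : (B \ A).card = (A \ B).card := Finset.card_sdiff_comm hAB.symm
    obtain ⟨w, hw⟩ : (B \ A).Nonempty := Finset.card_pos.1 (by omega)
    rw [Finset.mem_sdiff] at hv hw
    have hA' : insert w (A.erase v) ⊆ Q :=
      Finset.insert_subset (hB hw.1) ((Finset.erase_subset _ _).trans hA)
    have hstep : JumpIn G M A (insert w (A.erase v)) :=
      ⟨hA.trans hQM, hA'.trans hQM, hQ.mono G hA, hQ.mono G hA', v, hv.1, w, hw.2, rfl⟩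
    refine Relation.ReflTransGen.head hstep (ih hA' ?_ ?_)
    · rw [Finset.card_insert_of_notMem (fun h => hw.2 (Finset.mem_of_mem_erase h)),
        Finset.card_erase_add_one hv.1, hAB]
    · have : insert w (A.erase v) \ B = (A \ B).erase v := by
        ext x
        simp only [Finset.mem_sdiff, Finset.mem_insert, Finset.mem_erase]
        constructor
        · rintro ⟨rfl | h, hx⟩
          · exact absurd hw.1 hx
          · exact ⟨h.1, h.2, hx⟩
        · rintro ⟨h1, h2, h3⟩; exact ⟨Or.inr ⟨h1, h2⟩, h3⟩
      rw [this, Finset.card_erase_of_mem (Finset.mem_sdiff.2 hv), hn]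
      rfl

/-- Either a reconfiguration stays inside `K`, or there is a first jump out of `K`. -/
theorem reach_or_exit {M K S T : Finset V} (hSK : S ⊆ K) (h : Reach G M S T) :
    Reach G K S T ∨ ∃ S₁, Reach G K S S₁ ∧ S₁ ⊆ K ∧ Indep G S₁ ∧
      ∃ s ∈ S₁, ∃ w, w ∉ K ∧ Indep G (insert w (S₁.erase s)) := by
  suffices H : (T ⊆ K ∧ Reach G K S T) ∨ ∃ S₁, Reach G K S S₁ ∧ S₁ ⊆ K ∧ Indep G S₁ ∧
      ∃ s ∈ S₁, ∃ w, w ∉ K ∧ Indep G (insert w (S₁.erase s)) by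
    exact H.imp And.right id
  induction h with
  | refl => exact Or.inl ⟨hSK, Relation.ReflTransGen.refl⟩
  | tail _ h ih =>
    rcases ih with ⟨hK, hr⟩ | ih
    · obtain ⟨-, -, hi, hi', v, hv, w, hw, rfl⟩ := h
      by_cases hwK : w ∈ K
      · have hsub : insert w (Finset.erase _ v) ⊆ K :=
          Finset.insert_subset hwK ((Finset.erase_subset _ _).trans hK)
        exact Or.inl ⟨hsub, hr.tail ⟨hK, hsub, hi, hi', v, hv, w, hw, rfl⟩⟩
      · exact Or.inr ⟨_, hr, hK, hi, v, hv, w, hwK, hi'⟩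
    · exact Or.inr ih

variable [DecidableRel G.Adj]

/-- A reservoir: an independent set outside `K` whose vertices have at most two neighbours in `K`
and come in large groups with the same neighbours in `K`. -/
structure Reservoir (K Z : Finset V) : Prop where
  disj : ∀ z ∈ Z, z ∉ K
  indep : Indep G Z
  two : ∀ z ∈ Z, (K.filter (G.Adj z)).card ≤ 2
  many : ∀ z ∈ Z, 14 ≤ (Z.filter (fun z' => K.filter (G.Adj z') = K.filter (G.Adj z))).card

/-- A blocked `y` in `Z` is blocked by at most two tokens, all in `K`; move them to the two free
places. This unblocks the whole group of `y`, which is unoccupied because it was blocked before. So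
there are two new free places, with fewer tokens left in `K`. Once nothing in `Z` is blocked, `S ∪
Z` is independent. -/
theorem exists_reach_reservoir {M K Z : Finset V} (hKM : K ⊆ M) (hZM : Z ⊆ M)
    (hZ : Reservoir G K Z) {S : Finset V} (hSZ : S.card ≤ Z.card) (hS : S ⊆ K ∪ Z)
    (hfree : ∃ z ∈ Z, ∃ z' ∈ Z, z ≠ z' ∧ z ∉ S ∧ z' ∉ S ∧ Indep G (S ∪ {z, z'})) :
    ∃ A ⊆ Z, Reach G M S A := by
  induction hn : (S.filter (· ∈ K)).card using Nat.strong_induction_on generalizing S with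
  | _ n ih =>
  subst hn
  obtain ⟨z, hz, z', hz', hne, hzS, hz'S, hind⟩ := hfree
  have hSi : Indep G S := hind.mono G Finset.subset_union_left
  have hSM : S ⊆ M := hS.trans (Finset.union_subset hKM hZM)
  by_cases hlock : ∃ y ∈ Z, ∃ t ∈ S, G.Adj y t
  · obtain ⟨y, hy, t, ht, hyt⟩ := hlock
    set F := S.filter (G.Adj y) with hF
    have hFK : F ⊆ K.filter (G.Adj y) := by
      intro x hx
      obtain ⟨hx, hyx⟩ := Finset.mem_filter.1 hx
      rcases Finset.mem_union.1 (hS hx) with h | h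
      · exact Finset.mem_filter.2 ⟨h, hyx⟩
      · exact absurd hyx (hZ.indep y hy x h)
    have hFS : F ⊆ S := Finset.filter_subset _ _
    have htF : t ∈ F := Finset.mem_filter.2 ⟨ht, hyt⟩
    have hF2 : F.card ≤ ({z, z'} : Finset V).card := by
      rw [Finset.card_pair hne]
      exact (Finset.card_le_card hFK).trans (hZ.two y hy)
    obtain ⟨U, hU, hUF⟩ := Finset.exists_subset_card_eq hF2
    have hUZ : U ⊆ Z := by
      intro x hx
      rcases Finset.mem_insert.1 (hU hx) with rfl | h
      · exact hz
      · rw [Finset.mem_singleton.1 h]; exact hz'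
    have hUS : Disjoint (S \ F) U := by
      rw [Finset.disjoint_left]
      intro x hx hxU
      have hxS := (Finset.mem_sdiff.1 hx).1
      rcases Finset.mem_insert.1 (hU hxU) with rfl | h
      · exact hzS hxS
      · exact hz'S (Finset.mem_singleton.1 h ▸ hxS)
    have hsub : (S \ F) ∪ U ⊆ S ∪ {z, z'} := Finset.union_subset_union Finset.sdiff_subset hU
    have hcard : S.card = ((S \ F) ∪ U).card := by
      rw [Finset.card_union_of_disjoint hUS, hUF, Finset.card_sdiff_add_card_eq_card hFS]
    have hQM : S ∪ {z, z'} ⊆ M :=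
      Finset.union_subset hSM (Finset.insert_subset (hZM hz) (by simpa using hZM hz'))
    have hreach : Reach G M S ((S \ F) ∪ U) :=
      reach_of_subset G hind hQM Finset.subset_union_left hsub hcard
    obtain ⟨a, ha, b, hb, hab⟩ := Finset.one_lt_card.1
      (lt_of_lt_of_le (by norm_num) (hZ.many y hy))
    have hgrp : ∀ a ∈ Z.filter (fun z' => K.filter (G.Adj z') = K.filter (G.Adj y)),
        a ∈ Z ∧ G.Adj a t ∧ a ∉ (S \ F) ∪ U ∧ ∀ x ∈ S \ F, ¬ G.Adj x a := by
      intro a ha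
      obtain ⟨haZ, hak⟩ := Finset.mem_filter.1 ha
      have hat : G.Adj a t := by
        have := hFK htF
        rw [← hak] at this
        exact (Finset.mem_filter.1 this).2
      refine ⟨haZ, hat, fun h => ?_, fun x hx hxa => ?_⟩
      · exact hind a (hsub h) t (Finset.mem_union_left _ ht) hat
      · obtain ⟨hxS, hxF⟩ := Finset.mem_sdiff.1 hx
        rcases Finset.mem_union.1 (hS hxS) with h | h
        · have : x ∈ K.filter (G.Adj a) := Finset.mem_filter.2 ⟨h, hxa.symm⟩
          rw [hak] at this
          exact hxF (Finset.mem_filter.2 ⟨hxS, (Finset.mem_filter.1 this).2⟩)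
        · exact hZ.indep x h a haZ hxa
    obtain ⟨ha1, ha2, ha3, ha4⟩ := hgrp a ha
    obtain ⟨hb1, hb2, hb3, hb4⟩ := hgrp b hb
    have habZ : ∀ x ∈ ({a, b} : Finset V), x ∈ Z := by
      intro x hx
      rcases Finset.mem_insert.1 hx with rfl | h
      · exact ha1
      · rw [Finset.mem_singleton.1 h]; exact hb1
    have hlt : (((S \ F) ∪ U).filter (· ∈ K)).card < (S.filter (· ∈ K)).card := by
      refine Finset.card_lt_card ⟨?_, ?_⟩
      · intro x hx
        obtain ⟨hx, hxK⟩ := Finset.mem_filter.1 hx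
        rcases Finset.mem_union.1 hx with h | h
        · exact Finset.mem_filter.2 ⟨(Finset.mem_sdiff.1 h).1, hxK⟩
        · exact absurd hxK (hZ.disj x (hUZ h))
      · intro hss
        have h1 : t ∈ S.filter (· ∈ K) :=
          Finset.mem_filter.2 ⟨ht, (Finset.mem_filter.1 (hFK htF)).1⟩
        obtain ⟨h2, h3⟩ := Finset.mem_filter.1 (hss h1)
        rcases Finset.mem_union.1 h2 with h | h
        · exact (Finset.mem_sdiff.1 h).2 htF
        · exact hZ.disj t (hUZ h) h3
    have key := ih _ hlt (S := (S \ F) ∪ U) (by rw [← hcard]; exact hSZ)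
      (Finset.union_subset (Finset.sdiff_subset.trans hS) (hUZ.trans Finset.subset_union_right))
      ⟨a, ha1, b, hb1, hab, ha3, hb3, ?_⟩ rfl
    · obtain ⟨A, hA, hAr⟩ := key
      exact ⟨A, hA, hreach.trans hAr⟩
    · refine Indep.union G (hind.mono G hsub) (hZ.indep.mono G habZ) ?_
      intro x hx y' hy'
      rcases Finset.mem_union.1 hx with h | h
      · rcases Finset.mem_insert.1 hy' with rfl | h'
        · exact ha4 x h
        · rw [Finset.mem_singleton.1 h']; exact hb4 x h
      · exact hZ.indep x (hUZ h) y' (habZ y' hy')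
  · push Not at hlock
    obtain ⟨A, hA, hAc⟩ := Finset.exists_subset_card_eq hSZ
    refine ⟨A, hA, reach_of_subset G (Indep.union G hSi hZ.indep ?_) (Finset.union_subset hSM hZM)
      Finset.subset_union_left (hA.trans Finset.subset_union_right) hAc.symm⟩
    exact fun u hu v hv h => hlock v hv u hu h.symm

/-- The size of a class that counts as large. -/
def classConst (r : ℕ) : ℕ := 298 * r + 5

/-- By the density of `U₁ ∪ Z`, at most `256 * r` of `296 * r + 5` vertices see more than a
sixteenth of `Z`; the other `5 * (8 * r + 1)` or more contain five independent ones. -/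
theorem exists_sparse_indep {r : ℕ} (hdeg : ∀ A : Finset V, degSum G A ≤ 8 * r * A.card)
    {U Z : Finset V} (hU : 296 * r + 5 ≤ U.card) (hZ : classConst r ≤ Z.card) :
    ∃ W ⊆ U, W.card = 5 ∧ Indep G W ∧ ∀ u ∈ W, 16 * (Z.filter (G.Adj u)).card ≤ Z.card := by
  obtain ⟨U₁, hU₁, hU₁c⟩ := Finset.exists_subset_card_eq hU
  set bad := U₁.filter (fun u => Z.card < 16 * (Z.filter (G.Adj u)).card) with hbad
  have hbadcard : bad.card ≤ 256 * r := by
    have h1 : Z.card * bad.card ≤ ∑ u ∈ bad, 16 * (Z.filter (G.Adj u)).card := by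
      rw [mul_comm, ← smul_eq_mul]
      exact Finset.card_nsmul_le_sum _ _ _ fun u hu => (Finset.mem_filter.1 hu).2.le
    have h2 : ∑ u ∈ bad, (Z.filter (G.Adj u)).card ≤ degSum G (U₁ ∪ Z) := by
      unfold degSum
      refine (Finset.sum_le_sum fun u _ => Finset.card_le_card
        (Finset.filter_subset_filter (t := U₁ ∪ Z) (G.Adj u) Finset.subset_union_right)).trans ?_
      exact Finset.sum_le_sum_of_subset ((Finset.filter_subset _ _).trans Finset.subset_union_left)
    have h3 := hdeg (U₁ ∪ Z)
    have h4 := Finset.card_union_le U₁ Z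
    rw [← Finset.mul_sum] at h1
    have h5 : U₁.card ≤ Z.card := by unfold classConst at hZ; omega
    have h6 : Z.card * bad.card ≤ Z.card * (256 * r) := by
      calc Z.card * bad.card ≤ 16 * degSum G (U₁ ∪ Z) := h1.trans (Nat.mul_le_mul_left _ h2)
        _ ≤ 16 * (8 * r * (U₁ ∪ Z).card) := Nat.mul_le_mul_left _ h3
        _ ≤ 16 * (8 * r * (Z.card + Z.card)) := by gcongr; omega
        _ = _ := by ring
    exact Nat.le_of_mul_le_mul_left h6 (by unfold classConst at hZ; omega)
  obtain ⟨I, hI, hind, hIc⟩ := exists_indep_subset G (q := 4 * r)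
    (fun A => (hdeg A).trans (by linarith)) (U₁ \ bad)
  have h5 : 5 ≤ I.card := by
    have h1 : (U₁ \ bad).card + bad.card = U₁.card :=
      Finset.card_sdiff_add_card_eq_card (Finset.filter_subset _ _)
    by_contra hlt
    have h2 : I.card ≤ 4 := by omega
    have h3 : (2 * (4 * r) + 1) * I.card ≤ (2 * (4 * r) + 1) * 4 := Nat.mul_le_mul_left _ h2
    omega
  obtain ⟨W, hW, hWc⟩ := Finset.exists_subset_card_eq h5
  refine ⟨W, (hW.trans hI).trans (Finset.sdiff_subset.trans hU₁), hWc,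
    fun u hu v hv => hind u (hW hu) v (hW hv), fun u hu => ?_⟩
  obtain ⟨h1, h2⟩ := Finset.mem_sdiff.1 (hI (hW hu))
  by_contra hlt
  exact h2 (Finset.mem_filter.2 ⟨h1, not_le.1 hlt⟩)

/-- The set `W` spoils little more than five sixteenths of `Z`, in particular less than half. If
every group kept at most six of its at least fourteen members, more than half would be spoiled. -/
theorem exists_free_group {r : ℕ} {K Z W : Finset V} (hZ : Reservoir G K Z)
    (hZc : classConst r ≤ Z.card) (hr : 0 < r) (hWc : W.card = 5)
    (hW : ∀ u ∈ W, 16 * (Z.filter (G.Adj u)).card ≤ Z.card) :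
    ∃ y ∈ Z, ∃ A ⊆ Z, 7 ≤ A.card ∧ (∀ a ∈ A, K.filter (G.Adj a) = K.filter (G.Adj y)) ∧
      ∀ a ∈ A, a ∉ W ∧ ∀ u ∈ W, ¬ G.Adj u a := by
  classical
  set κ : V → Finset V := fun z => K.filter (G.Adj z) with hκ
  set D := Z.filter (fun z => z ∈ W ∨ ∃ u ∈ W, G.Adj u z) with hD
  have hDc : 16 * D.card ≤ 80 + 5 * Z.card := by
    have hsub : D ⊆ W ∪ W.biUnion (fun u => Z.filter (G.Adj u)) := by
      intro z hz
      obtain ⟨hz, h | ⟨u, hu, h⟩⟩ := Finset.mem_filter.1 hz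
      · exact Finset.mem_union_left _ h
      · exact Finset.mem_union_right _ (Finset.mem_biUnion.2 ⟨u, hu, Finset.mem_filter.2 ⟨hz, h⟩⟩)
    have h1 := (Finset.card_le_card hsub).trans (Finset.card_union_le _ _)
    have h2 : (W.biUnion (fun u => Z.filter (G.Adj u))).card ≤ ∑ u ∈ W, (Z.filter (G.Adj u)).card :=
      Finset.card_biUnion_le
    have h3 : ∑ u ∈ W, 16 * (Z.filter (G.Adj u)).card ≤ W.card * Z.card := by
      rw [← smul_eq_mul]
      exact Finset.sum_le_card_nsmul _ _ _ hW
    rw [← Finset.mul_sum, hWc] at h3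
    omega
  have hDsub : D ⊆ Z := Finset.filter_subset _ _
  have hsd := Finset.card_sdiff_add_card_eq_card hDsub
  suffices H : ∃ y ∈ Z, 7 ≤ ((Z \ D).filter (fun z => κ z = κ y)).card by
    obtain ⟨y, hy, h7⟩ := H
    refine ⟨y, hy, (Z \ D).filter (fun z => κ z = κ y),
      (Finset.filter_subset _ _).trans Finset.sdiff_subset, h7,
      fun a ha => (Finset.mem_filter.1 ha).2, fun a ha => ?_⟩
    obtain ⟨haZ, haD⟩ := Finset.mem_sdiff.1 (Finset.mem_filter.1 ha).1
    exact ⟨fun h => haD (Finset.mem_filter.2 ⟨haZ, Or.inl h⟩),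
      fun u hu h => haD (Finset.mem_filter.2 ⟨haZ, Or.inr ⟨u, hu, h⟩⟩)⟩
  by_contra hcon
  push Not at hcon
  have h1 : (Z \ D).card = ∑ b ∈ Z.image κ, ((Z \ D).filter (fun a => κ a = b)).card :=
    Finset.card_eq_sum_card_fiberwise fun x hx =>
      Finset.mem_image_of_mem _ (Finset.mem_sdiff.1 hx).1
  have h2 : Z.card = ∑ b ∈ Z.image κ, (Z.filter (fun a => κ a = b)).card :=
    Finset.card_eq_sum_card_image _ _
  have h3 : 2 * (Z \ D).card ≤ Z.card - (Z.image κ).card := by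
    have : 2 * (Z \ D).card + (Z.image κ).card ≤ Z.card := by
      rw [h1, Finset.card_eq_sum_ones (Z.image κ), Finset.mul_sum, ← Finset.sum_add_distrib]
      conv_rhs => rw [h2]
      refine Finset.sum_le_sum fun b hb => ?_
      obtain ⟨y, hy, rfl⟩ := Finset.mem_image.1 hb
      have e1 := hcon y hy
      have e2 := hZ.many y hy
      simp only [hκ] at e1 ⊢
      omega
    omega
  have h4 : 0 < (Z.image κ).card := by
    rw [Finset.card_pos, Finset.image_nonempty, ← Finset.card_pos]
    unfold classConst at hZc; omega
  unfold classConst at hZc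
  omega

/-- From a configuration with many vertices that are blocked by at most one token, all tokens can be
moved to the reservoir. -/
theorem exists_reach_of_room {r : ℕ} (hr : 0 < r)
    (hdeg : ∀ A : Finset V, degSum G A ≤ 8 * r * A.card) {M K Z : Finset V} (hKM : K ⊆ M)
    (hZM : Z ⊆ M) (hZ : Reservoir G K Z) (hZc : classConst r ≤ Z.card) {S U : Finset V}
    (hSM : S ⊆ M) (hSi : Indep G S) (hSZ : S.card ≤ Z.card) (hSK : (S \ K).card ≤ 2) {s : V}
    (hs : s ∈ S) (hUM : U ⊆ M) (hUc : 296 * r + 5 ≤ U.card) (hUS : ∀ u ∈ U, u ∉ S)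
    (hfree : ∀ u ∈ U, ∀ t ∈ S, G.Adj u t → t = s) : ∃ A ⊆ Z, Reach G M S A := by
  classical
  obtain ⟨W, hWU, hWc, hWi, hWs⟩ := exists_sparse_indep G hdeg hUc hZc
  obtain ⟨y, hy, A, hAZ, hA7, hAκ, hAW⟩ := exists_free_group G hZ hZc hr hWc hWs
  -- The tokens to move: `s`, at most two outside `K`, and at most two in `K` that block the group
  -- of `y`. Five places in `W` suffice for them.
  set F := insert s ((S \ K) ∪ S.filter (G.Adj y)  ∩ K) with hF
  have hFS : F ⊆ S := by
    refine Finset.insert_subset hs (Finset.union_subset Finset.sdiff_subset ?_)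
    exact Finset.inter_subset_left.trans (Finset.filter_subset _ _)
  have hF5 : F.card ≤ 5 := by
    have h1 := Finset.card_insert_le s ((S \ K) ∪ S.filter (G.Adj y) ∩ K)
    have h2 := Finset.card_union_le (S \ K) (S.filter (G.Adj y) ∩ K)
    have h3 : (S.filter (G.Adj y) ∩ K).card ≤ 2 := by
      refine (Finset.card_le_card ?_).trans (hZ.two y hy)
      intro x hx
      obtain ⟨hx, hxK⟩ := Finset.mem_inter.1 hx
      exact Finset.mem_filter.2 ⟨hxK, (Finset.mem_filter.1 hx).2⟩
    rw [hF]
    omega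
  have hSF : ∀ x ∈ S \ F, x ∈ K ∧ ¬ G.Adj y x ∧ x ≠ s := by
    intro x hx
    obtain ⟨hxS, hxF⟩ := Finset.mem_sdiff.1 hx
    simp only [hF, Finset.mem_insert, Finset.mem_union, Finset.mem_sdiff, Finset.mem_inter,
      Finset.mem_filter, not_or] at hxF
    have hxK : x ∈ K := by
      by_contra h
      exact hxF.2.1 ⟨hxS, h⟩
    exact ⟨hxK, fun h => hxF.2.2 ⟨⟨hxS, h⟩, hxK⟩, hxF.1⟩
  obtain ⟨U', hU'W, hU'c⟩ := Finset.exists_subset_card_eq (hF5.trans hWc.ge)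
  have hWS : ∀ u ∈ W, u ∉ S := fun u hu => hUS u (hWU hu)
  have hWM : W ⊆ M := hWU.trans hUM
  have hQ : Indep G (S.erase s ∪ W) := by
    refine Indep.union G (hSi.mono G (Finset.erase_subset _ _)) hWi ?_
    intro t ht u hu h
    exact Finset.ne_of_mem_erase ht
      (hfree u (hWU hu) t (Finset.mem_of_mem_erase ht) h.symm)
  have hQM : S.erase s ∪ W ⊆ M := Finset.union_subset ((Finset.erase_subset _ _).trans hSM) hWM
  have hdisj : Disjoint (S \ F) U' := by
    rw [Finset.disjoint_left]
    exact fun x hx hx' => hWS x (hU'W hx') (Finset.mem_sdiff.1 hx).1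
  have hc3 : ((S \ F) ∪ U').card = S.card := by
    rw [Finset.card_union_of_disjoint hdisj, hU'c, Finset.card_sdiff_add_card_eq_card hFS]
  obtain ⟨u, hu⟩ : U'.Nonempty := by
    rw [← Finset.card_pos, hU'c, Finset.card_pos]
    exact ⟨s, Finset.mem_insert_self _ _⟩
  have hsub1 : insert u (S.erase s) ⊆ S.erase s ∪ W :=
    Finset.insert_subset (Finset.mem_union_right _ (hU'W hu)) Finset.subset_union_left
  have hsub3 : (S \ F) ∪ U' ⊆ S.erase s ∪ W := by
    refine Finset.union_subset_union (fun x hx => ?_) hU'W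
    exact Finset.mem_erase.2 ⟨(hSF x hx).2.2, (Finset.mem_sdiff.1 hx).1⟩
  -- Once `s` sits on `u`, all tokens lie in the independent set `S.erase s ∪ W` and can be
  -- rearranged there at will.
  have r1 : Reach G M S (insert u (S.erase s)) := Relation.ReflTransGen.single
    ⟨hSM, hsub1.trans hQM, hSi, hQ.mono G hsub1, s, hs, u, hWS u (hU'W hu), rfl⟩
  have r2 : Reach G M (insert u (S.erase s)) ((S \ F) ∪ U') := by
    refine reach_of_subset G hQ hQM hsub1 hsub3 ?_
    rw [hc3, Finset.card_insert_of_notMem (fun h => hWS u (hU'W hu) (Finset.mem_of_mem_erase h)),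
      Finset.card_erase_add_one hs]
  have hSFA : ∀ x ∈ S \ F, ∀ a ∈ A, ¬ G.Adj x a := by
    intro x hx a ha h
    obtain ⟨hxK, hxy, -⟩ := hSF x hx
    have : x ∈ K.filter (G.Adj a) := Finset.mem_filter.2 ⟨hxK, h.symm⟩
    rw [hAκ a ha] at this
    exact hxy (Finset.mem_filter.1 this).2
  have hQ' : Indep G (((S \ F) ∪ U') ∪ A) := by
    refine Indep.union G (hQ.mono G hsub3) (hZ.indep.mono G hAZ) ?_
    intro x hx a ha
    rcases Finset.mem_union.1 hx with h | h
    · exact hSFA x h a ha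
    · exact (hAW a ha).2 x (hU'W h)
  have hQ'M : ((S \ F) ∪ U') ∪ A ⊆ M :=
    Finset.union_subset (hsub3.trans hQM) (hAZ.trans hZM)
  -- At most five of the at least seven free places are filled, which leaves the two that
  -- `exists_reach_reservoir` needs.
  obtain ⟨A', hA'A, hA'c⟩ := Finset.exists_subset_card_eq (hF5.trans (le_trans (by norm_num) hA7))
  have hdisj' : ∀ x ∈ S \ F, x ∉ A := fun x hx hxA => hZ.disj x (hAZ hxA) (hSF x hx).1
  have hc4 : ((S \ F) ∪ A').card = S.card := by
    rw [Finset.card_union_of_disjoint, hA'c, Finset.card_sdiff_add_card_eq_card hFS]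
    rw [Finset.disjoint_left]
    exact fun x hx hx' => hdisj' x hx (hA'A hx')
  have hsub4 : (S \ F) ∪ A' ⊆ ((S \ F) ∪ U') ∪ A :=
    Finset.union_subset_union Finset.subset_union_left hA'A
  have r3 : Reach G M ((S \ F) ∪ U') ((S \ F) ∪ A') :=
    reach_of_subset G hQ' hQ'M Finset.subset_union_left hsub4 (hc3.trans hc4.symm)
  have h2 : 1 < (A \ A').card := by
    have := Finset.card_sdiff_add_card_eq_card hA'A
    omega
  obtain ⟨a, ha, b, hb, hab⟩ := Finset.one_lt_card.1 h2
  rw [Finset.mem_sdiff] at ha hb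
  have hnot : ∀ a, a ∈ A → a ∉ A' → a ∉ (S \ F) ∪ A' := by
    intro a ha ha' h
    rcases Finset.mem_union.1 h with h | h
    · exact hdisj' a h ha
    · exact ha' h
  obtain ⟨A₁, hA₁, r4⟩ := exists_reach_reservoir G hKM hZM hZ (S := (S \ F) ∪ A')
    (hc4.le.trans hSZ)
    (Finset.union_subset_union (fun x hx => (hSF x hx).1) (hA'A.trans hAZ))
    ⟨a, hAZ ha.1, b, hAZ hb.1, hab, hnot a ha.1 ha.2, hnot b hb.1 hb.2, hQ'.mono G
      (Finset.union_subset hsub4 (Finset.insert_subset (Finset.mem_union_right _ ha.1) (by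
        rw [Finset.singleton_subset_iff]; exact Finset.mem_union_right _ hb.1)))⟩
  exact ⟨A₁, hA₁, ((r1.trans r2).trans r3).trans r4⟩

variable [Fintype V]

/-- The first jump out of a closed set `K` makes it possible to move all tokens to the
reservoir. -/
theorem exists_reach_of_exit {r : ℕ} (hr : 0 < r)
    (hG : ¬ IsMinor (completeBipartiteGraph (Fin 3) (Fin r)) G) {M K X Z : Finset V} (hKM : K ⊆ M)
    (hXK : X ⊆ K) (hZM : Z ⊆ M) (hZ : Reservoir G K Z) (hZc : classConst r ≤ Z.card)
    (hsup : ∀ w, w ∉ K → Supported G X (classConst r) K w)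
    (hbig : ∀ z, z ∉ K → classConst r ≤ (nbrClass G K z).card →
      classConst r ≤ (nbrClass G K z ∩ M).card)
    (hone : ∀ z, z ∉ K → (nbrClass G K z ∩ M).Nonempty) {S : Finset V} (hSK : S ⊆ K)
    (hSi : Indep G S) (hSZ : S.card ≤ Z.card) {s : V} (hs : s ∈ S) {w : V} (hw : w ∉ K)
    (hSw : Indep G (insert w (S.erase s))) : ∃ A ⊆ Z, Reach G M S A := by
  classical
  have hdeg := degSum_le_of_not_isMinor G hr hG
  obtain ⟨x, hx, hxw, z, hz, hxz, hzB⟩ := hsup w hw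
  set U := nbrClass G K z ∩ M with hU
  have hUc : classConst r ≤ U.card := hbig z hz hzB
  have memU : ∀ u ∈ U, u ∉ K ∧ (∀ t ∈ K, G.Adj u t ↔ G.Adj z t) := by
    intro u hu
    obtain ⟨-, h1, h2⟩ := Finset.mem_filter.1 (Finset.mem_inter.1 hu).1
    refine ⟨h1, fun t ht => ?_⟩
    have := congrArg (t ∈ ·) h2
    simpa [ht] using this
  have hUM : U ⊆ M := Finset.inter_subset_right
  -- The jump to `w` is legal, so its neighbour `x` carries no token other than possibly `s`.
  have hxS : x ∉ S.erase s := fun h =>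
    hSw x (Finset.mem_insert_of_mem h) w (Finset.mem_insert_self _ _) hxw
  by_cases hcase : ∀ t ∈ S.erase s, ¬ G.Adj z t
  · refine exists_reach_of_room G hr hdeg hKM hZM hZ hZc (hSK.trans hKM) hSi hSZ ?_ hs hUM ?_ ?_ ?_
    · rw [Finset.sdiff_eq_empty_iff_subset.2 hSK]; simp
    · unfold classConst at hUc; omega
    · exact fun u hu hu' => (memU u hu).1 (hSK hu')
    · intro u hu t ht hut
      by_contra hne
      exact hcase t (Finset.mem_erase.2 ⟨hne, ht⟩) (((memU u hu).2 t (hSK ht)).1 hut)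
  · push Not at hcase
    obtain ⟨h, hh, hzh⟩ := hcase
    have hhS := Finset.mem_of_mem_erase hh
    have hhK := hSK hhS
    have hxh : x ≠ h := fun e => hxS (e ▸ hh)
    -- A third neighbour of `z` in `K` would be a third common neighbour of the whole class `U`,
    -- which is too large for that.
    have hY : ∀ t ∈ K, G.Adj z t → t = x ∨ t = h := by
      intro t ht hzt
      by_contra hne
      push Not at hne
      have h3 : ({t, x, h} : Finset V).card = 3 :=
        Finset.card_eq_three.2 ⟨_, _, _, hne.1, hne.2, hxh, rfl⟩
      have := card_lt_of_common_nbrs G hG (T := {t, x, h}) (S := U) h3.ge ?_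
      · unfold classConst at hUc; omega
      · intro u hu t' ht'
        simp only [Finset.mem_insert, Finset.mem_singleton] at ht'
        rcases ht' with rfl | rfl | rfl
        · exact ((memU u hu).2 _ ht).2 hzt
        · exact ((memU u hu).2 _ (hXK hx)).2 hxz.symm
        · exact ((memU u hu).2 _ hhK).2 hzh
    -- All of `U` is adjacent to `x` and to `h`, so `v` would be a third common neighbour of the
    -- vertices counted here.
    have hfew : ∀ v, v ∉ K → (U.filter (G.Adj v)).card < r := by
      intro v hv
      refine card_lt_of_common_nbrs G hG (T := {v, x, h}) ?_ ?_
      · rw [Finset.card_eq_three.2 ⟨_, _, _, ?_, ?_, hxh, rfl⟩]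
        · exact fun e => hv (e ▸ hXK hx)
        · exact fun e => hv (e ▸ hhK)
      · intro u hu t ht
        obtain ⟨hu, hvu⟩ := Finset.mem_filter.1 hu
        simp only [Finset.mem_insert, Finset.mem_singleton] at ht
        rcases ht with rfl | rfl | rfl
        · exact hvu.symm
        · exact ((memU u hu).2 _ (hXK hx)).2 hxz.symm
        · exact ((memU u hu).2 _ hhK).2 hzh
    -- The jump to `w` is imitated inside `M` by a member of the class of `w`.
    obtain ⟨w', hw'⟩ := hone w hw
    obtain ⟨hw'c, hw'M⟩ := Finset.mem_inter.1 hw'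
    obtain ⟨-, hw'K, hw'e⟩ := Finset.mem_filter.1 hw'c
    have hTw : ∀ t ∈ S.erase s, ¬ G.Adj w' t := by
      intro t ht hadj
      have htK := hSK (Finset.mem_of_mem_erase ht)
      have : t ∈ K.filter (G.Adj w') := Finset.mem_filter.2 ⟨htK, hadj⟩
      rw [hw'e] at this
      exact hSw w (Finset.mem_insert_self _ _) t (Finset.mem_insert_of_mem ht)
        (Finset.mem_filter.1 this).2
    have hset : ∀ (U : Finset V) (v : V), U.card ≤
        (U.filter (fun u => u ≠ v ∧ ¬ G.Adj v u)).card + (U.filter (G.Adj v)).card + 1 := by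
      intro U v
      have : U ⊆ U.filter (fun u => u ≠ v ∧ ¬ G.Adj v u) ∪ (U.filter (G.Adj v) ∪ {v}) := by
        intro u hu
        simp only [Finset.mem_union, Finset.mem_filter, Finset.mem_singleton, hu, true_and]
        tauto
      have h1 := Finset.card_le_card this
      have h2 := Finset.card_union_le (U.filter (fun u => u ≠ v ∧ ¬ G.Adj v u))
        (U.filter (G.Adj v) ∪ {v})
      have h3 := Finset.card_union_le (U.filter (G.Adj v)) {v}
      rw [Finset.card_singleton] at h3
      omega
    -- Moving `s` to `w'` and `h` to `z'` unblocks all of `U` except what equals or is adjacent to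
    -- `w'` or `z'`. Each of the two costs at most `r` vertices, so `296 * r + 5` out of `298 * r +
    -- 5` remain.
    set U₁ := U.filter (fun u => u ≠ w' ∧ ¬ G.Adj w' u) with hU₁
    have hU₁c : 297 * r + 5 ≤ U₁.card := by
      have h1 := hset U w'
      have h2 := hfew w' hw'K
      unfold classConst at hUc
      rw [hU₁]
      omega
    obtain ⟨z', hz'⟩ : U₁.Nonempty := Finset.card_pos.1 (by omega)
    obtain ⟨hz'U, hz'w, hz'a⟩ := Finset.mem_filter.1 hz'
    have hz'K := (memU z' hz'U).1
    set U₂ := U₁.filter (fun u => u ≠ z' ∧ ¬ G.Adj z' u) with hU₂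
    have hU₂c : 296 * r + 5 ≤ U₂.card := by
      have h1 := hset U₁ z'
      have h2 := hfew z' hz'K
      have h3 : (U₁.filter (G.Adj z')).card ≤ (U.filter (G.Adj z')).card :=
        Finset.card_le_card (Finset.filter_subset_filter _ (Finset.filter_subset _ _))
      rw [hU₂]
      omega
    have hUT : ∀ u ∈ U, ∀ t ∈ (S.erase s).erase h, ¬ G.Adj u t := by
      intro u hu t ht hadj
      have ht' := Finset.mem_of_mem_erase ht
      have htK := hSK (Finset.mem_of_mem_erase ht')
      rcases hY t htK (((memU u hu).2 t htK).1 hadj) with rfl | rfl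
      · exact hxS ht'
      · exact Finset.ne_of_mem_erase ht rfl
    have hTK : ∀ t ∈ S.erase s, t ∈ K := fun t ht => hSK (Finset.mem_of_mem_erase ht)
    set S₁ := insert w' (S.erase s) with hS₁
    have hw'S : w' ∉ S := fun h => hw'K (hSK h)
    have hS₁i : Indep G S₁ := by
      rw [hS₁, Finset.insert_eq]
      refine Indep.union G (fun u hu v hv => ?_) (hSi.mono G (Finset.erase_subset _ _)) ?_
      · rw [Finset.mem_singleton.1 hu, Finset.mem_singleton.1 hv]; exact G.irrefl
      · intro u hu t ht
        rw [Finset.mem_singleton.1 hu]; exact hTw t ht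
    have hS₁M : S₁ ⊆ M := Finset.insert_subset hw'M fun t ht => hKM (hTK t ht)
    have r1 : Reach G M S S₁ := Relation.ReflTransGen.single
      ⟨hSK.trans hKM, hS₁M, hSi, hS₁i, s, hs, w', hw'S, rfl⟩
    have hhw' : h ≠ w' := fun e => hw'K (e ▸ hhK)
    have hS₁e : S₁.erase h = insert w' ((S.erase s).erase h) := by
      rw [hS₁, Finset.erase_insert_of_ne hhw'.symm]
    set S₂ := insert z' (S₁.erase h) with hS₂
    have hz'S₁ : z' ∉ S₁ := by
      intro h'
      rcases Finset.mem_insert.1 h' with h' | h'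
      · exact hz'w h'
      · exact hz'K (hTK _ h')
    have hS₂i : Indep G S₂ := by
      rw [hS₂, Finset.insert_eq]
      refine Indep.union G (fun u hu v hv => ?_) (hS₁i.mono G (Finset.erase_subset _ _)) ?_
      · rw [Finset.mem_singleton.1 hu, Finset.mem_singleton.1 hv]; exact G.irrefl
      · intro u hu t ht
        rw [Finset.mem_singleton.1 hu]
        rw [hS₁e] at ht
        rcases Finset.mem_insert.1 ht with rfl | ht
        · exact fun h' => hz'a h'.symm
        · exact hUT z' hz'U t ht
    have hS₂M : S₂ ⊆ M := Finset.insert_subset (hUM hz'U) ((Finset.erase_subset _ _).trans hS₁M)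
    have r2 : Reach G M S₁ S₂ := Relation.ReflTransGen.single
      ⟨hS₁M, hS₂M, hS₁i, hS₂i, h, Finset.mem_insert_of_mem hh, z', hz'S₁, rfl⟩
    have memS₂ : ∀ t, t ∈ S₂ → t = z' ∨ t = w' ∨ t ∈ (S.erase s).erase h := by
      intro t ht
      rcases Finset.mem_insert.1 ht with h' | h'
      · exact Or.inl h'
      · rw [hS₁e] at h'
        exact Or.inr (Finset.mem_insert.1 h')
    have hcard : S₂.card = S.card := Reach.card_eq G (M := M) (r1.trans r2)
    have key := exists_reach_of_room G hr hdeg hKM hZM hZ hZc (S := S₂) (U := U₂) (s := z')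
      hS₂M hS₂i (hcard.le.trans hSZ) ?_ (Finset.mem_insert_self _ _) ?_ hU₂c ?_ ?_
    · obtain ⟨A, hA, r3⟩ := key
      exact ⟨A, hA, (r1.trans r2).trans r3⟩
    · refine (Finset.card_le_card (t := {z', w'}) ?_).trans Finset.card_le_two
      intro t ht
      obtain ⟨ht, htK⟩ := Finset.mem_sdiff.1 ht
      rcases memS₂ t ht with rfl | rfl | h'
      · simp
      · simp
      · exact absurd (hTK t (Finset.mem_of_mem_erase h')) htK
    · exact ((Finset.filter_subset _ _).trans (Finset.filter_subset _ _)).trans hUM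
    · intro u hu hu'
      obtain ⟨hu1, hu2, hu3⟩ := Finset.mem_filter.1 hu
      obtain ⟨hu4, hu5, hu6⟩ := Finset.mem_filter.1 hu1
      rcases memS₂ u hu' with h' | h' | h'
      · exact hu2 h'
      · exact hu5 h'
      · exact (memU u hu4).1 (hTK u (Finset.mem_of_mem_erase h'))
    · intro u hu t ht hut
      obtain ⟨hu1, hu2, hu3⟩ := Finset.mem_filter.1 hu
      obtain ⟨hu4, hu5, hu6⟩ := Finset.mem_filter.1 hu1
      rcases memS₂ t ht with h' | h' | h'
      · exact h'
      · exact absurd (h' ▸ hut.symm) hu6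
      · exact absurd hut (hUT u hu4 t h')

/-- If the sequence from `S` to `T` or its reverse never leaves `K`, it already lies in `M`.
Otherwise both `S` and `T` can be moved into the independent set `Z`, inside which sets of equal
size are reconfigurable into each other. -/
theorem reach_restrict {r : ℕ} (hr : 0 < r)
    (hG : ¬ IsMinor (completeBipartiteGraph (Fin 3) (Fin r)) G) {M K X Z : Finset V} (hKM : K ⊆ M)
    (hXK : X ⊆ K) (hZM : Z ⊆ M) (hZ : Reservoir G K Z) (hZc : classConst r ≤ Z.card)
    (hsup : ∀ w, w ∉ K → Supported G X (classConst r) K w)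
    (hbig : ∀ z, z ∉ K → classConst r ≤ (nbrClass G K z).card →
      classConst r ≤ (nbrClass G K z ∩ M).card)
    (hone : ∀ z, z ∉ K → (nbrClass G K z ∩ M).Nonempty) {S T : Finset V} (hSK : S ⊆ K)
    (hTK : T ⊆ K) (hSZ : S.card ≤ Z.card) (h : Reach G Finset.univ S T) : Reach G M S T := by
  have hc := h.card_eq
  have hexit : ∀ S T : Finset V, S ⊆ K → S.card ≤ Z.card → Reach G Finset.univ S T →
      Reach G M S T ∨ ∃ A ⊆ Z, Reach G M S A := by
    intro S T hSK hSZ h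
    rcases reach_or_exit G hSK h with h | ⟨S₁, h1, h2, h3, s, hs, w, hw, hw'⟩
    · exact Or.inl (h.mono G hKM)
    · obtain ⟨A, hA, h4⟩ := exists_reach_of_exit G hr hG hKM hXK hZM hZ hZc hsup hbig hone h2 h3
        (h1.card_eq.le.trans hSZ) hs hw hw'
      exact Or.inr ⟨A, hA, (h1.mono G hKM).trans h4⟩
  rcases hexit S T hSK hSZ h with h1 | ⟨A, hA, h1⟩
  · exact h1
  rcases hexit T S hTK (hc.le.trans hSZ) (h.symm G) with h2 | ⟨A', hA', h2⟩
  · exact h2.symm G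
  have h3 : Reach G M A A' := reach_of_subset G hZ.indep hZM hA hA' (by
    rw [h1.card_eq, h2.card_eq, hc])
  exact (h1.trans h3).trans (h2.symm G)

end Reconfiguration

/-! ### The kept vertices: size and correctness -/

section Kernel

variable {n : ℕ}

/-- The first `m` elements of `S`. -/
def firstOf (S : Finset (Fin n)) (m : ℕ) : Finset (Fin n) :=
  S.filter (fun v => (S.filter (· < v)).card < m)

theorem firstOf_subset (S : Finset (Fin n)) (m : ℕ) : firstOf S m ⊆ S := Finset.filter_subset _ _

theorem injOn_rank (S : Finset (Fin n)) :
    Set.InjOn (fun v => (S.filter (· < v)).card) (S : Set (Fin n)) := by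
  have key : ∀ u ∈ S, ∀ v ∈ S, u < v → (S.filter (· < u)).card < (S.filter (· < v)).card := by
    intro u hu v _ huv
    refine Finset.card_lt_card ⟨fun x hx => ?_, fun h => ?_⟩
    · obtain ⟨h1, h2⟩ := Finset.mem_filter.1 hx
      exact Finset.mem_filter.2 ⟨h1, h2.trans huv⟩
    · exact lt_irrefl u (Finset.mem_filter.1 (h (Finset.mem_filter.2 ⟨hu, huv⟩))).2
  intro u hu v hv huv
  simp only at huv
  rcases lt_trichotomy u v with h | h | h
  · exact absurd (key u hu v hv h) (by omega)
  · exact h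
  · exact absurd (key v hv u hu h) (by omega)

theorem rank_lt {S : Finset (Fin n)} {v : Fin n} (hv : v ∈ S) :
    (S.filter (· < v)).card < S.card :=
  Finset.card_lt_card ⟨Finset.filter_subset _ _, fun h =>
    lt_irrefl v (Finset.mem_filter.1 (h hv)).2⟩

theorem card_firstOf_le (S : Finset (Fin n)) (m : ℕ) : (firstOf S m).card ≤ m := by
  have := Finset.card_le_card_of_injOn (s := firstOf S m) (t := Finset.range m)
    (fun v => (S.filter (· < v)).card)
    (fun v hv => Finset.mem_coe.2 (Finset.mem_range.2 (Finset.mem_filter.1 hv).2))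
    ((injOn_rank S).mono (Finset.coe_subset.2 (firstOf_subset S m)))
  simpa using this

theorem le_card_firstOf {S : Finset (Fin n)} {m : ℕ} (h : m ≤ S.card) :
    m ≤ (firstOf S m).card := by
  have := Finset.card_le_card_of_injOn (s := S \ firstOf S m) (t := Finset.Ico m S.card)
    (fun v => (S.filter (· < v)).card) (fun v hv => ?_)
    ((injOn_rank S).mono (Finset.coe_subset.2 Finset.sdiff_subset))
  · have h2 := Finset.card_sdiff_add_card_eq_card (firstOf_subset S m)
    rw [Nat.card_Ico] at this
    omega
  · obtain ⟨h1, h2⟩ := Finset.mem_sdiff.1 (Finset.mem_coe.1 hv)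
    refine Finset.mem_coe.2 (Finset.mem_Ico.2 ⟨?_, rank_lt h1⟩)
    by_contra hlt
    exact h2 (Finset.mem_filter.2 ⟨h1, not_le.1 hlt⟩)

theorem firstOf_eq_self {S : Finset (Fin n)} {m : ℕ} (h : S.card ≤ m) : firstOf S m = S :=
  Finset.filter_true_of_mem fun _ hv => (rank_lt hv).trans_le h

variable (G : SimpleGraph (Fin n)) [DecidableRel G.Adj]

/-- The vertices that are neither in `X` nor adjacent to a vertex of `X`. -/
def freeOf (X : Finset (Fin n)) : Finset (Fin n) :=
  Finset.univ.filter (fun v => v ∉ X ∧ ∀ x ∈ X, ¬ G.Adj x v)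

/-- The first `B` vertices of each class. -/
def classReps (B : ℕ) (K : Finset (Fin n)) : Finset (Fin n) :=
  Finset.univ.filter (fun w => w ∉ K ∧ ((nbrClass G K w).filter (· < w)).card < B)

theorem nbrClass_eq {K : Finset (Fin n)} {z w : Fin n} (h : w ∈ nbrClass G K z) :
    nbrClass G K w = nbrClass G K z := by
  obtain ⟨-, -, h⟩ := Finset.mem_filter.1 h
  unfold nbrClass
  rw [h]

theorem mem_nbrClass_self {K : Finset (Fin n)} {z : Fin n} (h : z ∉ K) : z ∈ nbrClass G K z :=
  Finset.mem_filter.2 ⟨Finset.mem_univ _, h, rfl⟩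

theorem firstOf_subset_classReps {B : ℕ} {K : Finset (Fin n)} {z : Fin n} :
    firstOf (nbrClass G K z) B ⊆ classReps G B K := by
  intro w hw
  obtain ⟨h1, h2⟩ := Finset.mem_filter.1 hw
  refine Finset.mem_filter.2 ⟨Finset.mem_univ _, (Finset.mem_filter.1 h1).2.1, ?_⟩
  rw [nbrClass_eq G h1]
  exact h2

/-- Bound for the number of classes outside a set, per vertex of that set. -/
def groupConst (r : ℕ) : ℕ := tripleConst r + 4 * r + 2

/-- Traces of size at least three are bounded by the vertices that have them, and traces of size two
by the pair bound. At most `K.card + 1` traces are smaller, which is at most `2 * K.card` as `K` is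
nonempty. -/
theorem card_image_nbrs_le {r : ℕ} (hr : 0 < r)
    (hG : ¬ IsMinor (completeBipartiteGraph (Fin 3) (Fin r)) G) {K W : Finset (Fin n)}
    (hd : Disjoint K W) (hK : 0 < K.card) :
    (W.image (fun z => K.filter (G.Adj z))).card ≤ groupConst r * K.card := by
  classical
  set κ : Fin n → Finset (Fin n) := fun z => K.filter (G.Adj z) with hκ
  set W₃ := W.filter (fun z => 3 ≤ (κ z).card)
  set W₂ := W.filter (fun z => (κ z).card = 2)
  have h3 : W₃.card ≤ tripleConst r * K.card :=
    card_le_of_three_nbrs G hr hG (hd.mono_right (Finset.filter_subset _ _))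
      fun w hw => (Finset.mem_filter.1 hw).2
  have h2 : (W₂.image κ).card ≤ 4 * r * K.card := by
    have hex : ∀ z, ∃ p : Fin n × Fin n, z ∈ W₂ → p.1 ≠ p.2 ∧ κ z = {p.1, p.2} := by
      intro z
      by_cases hz : z ∈ W₂
      · obtain ⟨a, b, hab, h⟩ := Finset.card_eq_two.1 (Finset.mem_filter.1 hz).2
        exact ⟨(a, b), fun _ => ⟨hab, h⟩⟩
      · exact ⟨(z, z), fun h => absurd h hz⟩
    choose p hp using hex
    have hm1 : ∀ z ∈ W₂, (p z).1 ∈ κ z := fun z hz => by rw [(hp z hz).2]; simp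
    have hm2 : ∀ z ∈ W₂, (p z).2 ∈ κ z := fun z hz => by rw [(hp z hz).2]; simp
    have := card_pairs_le G hr hG (R := K) (Z := W₂) (u := fun z => (p z).1)
      (v := fun z => (p z).2) (hd.mono_right (Finset.filter_subset _ _))
      (fun z hz => (Finset.mem_filter.1 (hm1 z hz)).2)
      (fun z hz => (Finset.mem_filter.1 (hm2 z hz)).2)
      (fun z hz => (Finset.mem_filter.1 (hm1 z hz)).1)
      (fun z hz => (Finset.mem_filter.1 (hm2 z hz)).1) (fun z hz => (hp z hz).1)
    refine le_trans ?_ this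
    have him : (W₂.image κ) ⊆ (W₂.image (fun z => s((p z).1, (p z).2))).image
        (fun e => K.filter (fun x => x ∈ e)) := by
      intro c hc
      obtain ⟨z, hz, rfl⟩ := Finset.mem_image.1 hc
      refine Finset.mem_image.2 ⟨s((p z).1, (p z).2), Finset.mem_image_of_mem _ hz, ?_⟩
      ext x
      have hx : x ∈ κ z ↔ x = (p z).1 ∨ x = (p z).2 := by rw [(hp z hz).2]; simp
      rw [Finset.mem_filter, Sym2.mem_iff, ← hx]
      exact ⟨fun h => h.2, fun h => ⟨(Finset.mem_filter.1 h).1, h⟩⟩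
    exact (Finset.card_le_card him).trans Finset.card_image_le
  have hsub : W.image κ ⊆ ((W₃.image κ) ∪ (W₂.image κ)) ∪
      ((K.image (fun x => ({x} : Finset (Fin n)))) ∪ {∅}) := by
    intro c hc
    obtain ⟨z, hz, rfl⟩ := Finset.mem_image.1 hc
    have hcases : 3 ≤ (κ z).card ∨ (κ z).card = 2 ∨ (κ z).card = 1 ∨ (κ z).card = 0 := by omega
    rcases hcases with h | h | h | h
    · exact Finset.mem_union_left _ (Finset.mem_union_left _
        (Finset.mem_image_of_mem _ (Finset.mem_filter.2 ⟨hz, h⟩)))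
    · exact Finset.mem_union_left _ (Finset.mem_union_right _
        (Finset.mem_image_of_mem _ (Finset.mem_filter.2 ⟨hz, h⟩)))
    · obtain ⟨x, hx⟩ := Finset.card_eq_one.1 h
      refine Finset.mem_union_right _ (Finset.mem_union_left _ (Finset.mem_image.2 ⟨x, ?_, hx.symm⟩))
      have : x ∈ κ z := by rw [hx]; simp
      exact (Finset.mem_filter.1 this).1
    · refine Finset.mem_union_right _ (Finset.mem_union_right _ ?_)
      rw [Finset.mem_singleton]
      exact Finset.card_eq_zero.1 h
  have c1 := Finset.card_le_card hsub
  have c2 := Finset.card_union_le ((W₃.image κ) ∪ (W₂.image κ))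
      ((K.image (fun x => ({x} : Finset (Fin n)))) ∪ {∅})
  have c3 := Finset.card_union_le (W₃.image κ) (W₂.image κ)
  have c4 := Finset.card_union_le (K.image (fun x => ({x} : Finset (Fin n)))) {∅}
  have c5 : (K.image (fun x => ({x} : Finset (Fin n)))).card ≤ K.card := Finset.card_image_le
  have c6 : (W₃.image κ).card ≤ W₃.card := Finset.card_image_le
  rw [Finset.card_singleton] at c4
  have : groupConst r * K.card = tripleConst r * K.card + 4 * r * K.card + 2 * K.card := by
    unfold groupConst; ring
  omega

theorem card_classReps_le {r : ℕ} (hr : 0 < r)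
    (hG : ¬ IsMinor (completeBipartiteGraph (Fin 3) (Fin r)) G) (B : ℕ) {K : Finset (Fin n)}
    (hK : 0 < K.card) : (classReps G B K).card ≤ B * (groupConst r * K.card) := by
  classical
  have hd : Disjoint K (classReps G B K) := by
    rw [Finset.disjoint_right]
    exact fun w hw => (Finset.mem_filter.1 hw).2.1
  refine (Finset.card_le_mul_card_image (f := fun z => K.filter (G.Adj z)) _ B ?_).trans
    (Nat.mul_le_mul_left _ (card_image_nbrs_le G hr hG hd hK))
  intro c hc
  obtain ⟨z, hz, rfl⟩ := Finset.mem_image.1 hc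
  refine (Finset.card_le_card fun w hw => ?_).trans (card_firstOf_le (nbrClass G K z) B)
  obtain ⟨hw, hwz⟩ := Finset.mem_filter.1 hw
  obtain ⟨-, h1, h2⟩ := Finset.mem_filter.1 hw
  have hmem : w ∈ nbrClass G K z := Finset.mem_filter.2 ⟨Finset.mem_univ _, h1, hwz⟩
  rw [nbrClass_eq G hmem] at h2
  exact Finset.mem_filter.2 ⟨hmem, h2⟩

/-- Every large set outside `K` contains a large reservoir. -/
theorem exists_reservoir {r : ℕ} (hr : 0 < r)
    (hG : ¬ IsMinor (completeBipartiteGraph (Fin 3) (Fin r)) G) {K Z₀ : Finset (Fin n)}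
    (hd : Disjoint K Z₀) (hK : 0 < K.card) {m : ℕ}
    (h : (8 * r + 1) * (m + 13 * (groupConst r * K.card)) + tripleConst r * K.card ≤ Z₀.card) :
    ∃ Z ⊆ Z₀, Reservoir G K Z ∧ m ≤ Z.card := by
  classical
  set κ : Fin n → Finset (Fin n) := fun z => K.filter (G.Adj z) with hκ
  -- Three losses occur: vertices with three neighbours in `K`, a factor `8 * r + 1` for
  -- independence, and at most `13` vertices from each group that is too small.
  set Z₁ := Z₀.filter (fun z => (κ z).card ≤ 2) with hZ₁
  have hsplit : Z₀.card ≤ Z₁.card + tripleConst r * K.card := by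
    have h3 : (Z₀.filter (fun z => ¬ (κ z).card ≤ 2)).card ≤ tripleConst r * K.card :=
      card_le_of_three_nbrs G hr hG (hd.mono_right (Finset.filter_subset _ _))
        fun w hw => by have := (Finset.mem_filter.1 hw).2; simp only [hκ] at this; omega
    have := Finset.card_filter_add_card_filter_not (s := Z₀) (fun z => (κ z).card ≤ 2)
    rw [← hZ₁] at this
    omega
  obtain ⟨Z₂, hZ₂, hind, hc⟩ := exists_indep_subset G (q := 4 * r)
    (fun A => (degSum_le_of_not_isMinor G hr hG A).trans (by linarith)) Z₁
  have hZ₂c : m + 13 * (groupConst r * K.card) ≤ Z₂.card := by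
    have : (8 * r + 1) * (m + 13 * (groupConst r * K.card)) ≤ (8 * r + 1) * Z₂.card := by
      have e : 2 * (4 * r) + 1 = 8 * r + 1 := by ring
      rw [e] at hc
      omega
    exact Nat.le_of_mul_le_mul_left this (by omega)
  set grp : Fin n → Finset (Fin n) := fun z => Z₂.filter (fun z' => κ z' = κ z) with hgrp
  have hsmall : (Z₂.filter (fun z => ¬ 14 ≤ (grp z).card)).card ≤ 13 * (groupConst r * K.card) := by
    set Y := Z₂.filter (fun z => ¬ 14 ≤ (grp z).card) with hY
    have hY0 : Y ⊆ Z₀ :=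
      ((Finset.filter_subset _ _).trans hZ₂).trans (Finset.filter_subset _ _)
    refine (Finset.card_le_mul_card_image (f := κ) _ 13 ?_).trans
      (Nat.mul_le_mul_left _ (card_image_nbrs_le G hr hG (hd.mono_right hY0) hK))
    intro c hc
    obtain ⟨z, hz, rfl⟩ := Finset.mem_image.1 hc
    have h1 : Y.filter (fun w => κ w = κ z) ⊆ grp z :=
      Finset.filter_subset_filter _ (Finset.filter_subset _ _)
    have h2 := (Finset.mem_filter.1 hz).2
    have h3 := Finset.card_le_card h1
    omega
  have hsp := Finset.card_filter_add_card_filter_not (s := Z₂) (fun z => 14 ≤ (grp z).card)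
  have hZ₁0 : Z₂ ⊆ Z₀ := hZ₂.trans (Finset.filter_subset _ _)
  refine ⟨Z₂.filter (fun z => 14 ≤ (grp z).card), (Finset.filter_subset _ _).trans hZ₁0,
    ⟨fun z hz => ?_, fun u hu v hv => ?_, fun z hz => ?_, fun z hz => ?_⟩, by omega⟩
  · exact Finset.disjoint_right.1 hd (hZ₁0 (Finset.mem_filter.1 hz).1)
  · exact hind u (Finset.mem_filter.1 hu).1 v (Finset.mem_filter.1 hv).1
  · exact (Finset.mem_filter.1 (hZ₂ (Finset.mem_filter.1 hz).1)).2
  · obtain ⟨hz, h14⟩ := Finset.mem_filter.1 hz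
    refine h14.trans (Finset.card_le_card fun w hw => ?_)
    obtain ⟨hw, hwz⟩ := Finset.mem_filter.1 hw
    refine Finset.mem_filter.2 ⟨Finset.mem_filter.2 ⟨hw, ?_⟩, hwz⟩
    have : grp w = grp z := by simp only [hgrp, hwz]
    rw [this]; exact h14

/-- A chain that grows strictly `Fintype.card V + 1` times would outgrow the universe. -/
theorem iterate_card_fixed {V : Type*} [Fintype V] {f : Finset V → Finset V} (hf : ∀ K, K ⊆ f K)
    (X : Finset V) : f (f^[Fintype.card V] X) = f^[Fintype.card V] X := by
  by_contra hne
  have hall : ∀ i ≤ Fintype.card V, f (f^[i] X) ≠ f^[i] X := by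
    intro i hi he
    obtain ⟨j, hj⟩ := Nat.exists_eq_add_of_le hi
    have : f^[Fintype.card V] X = f^[i] X := by
      rw [hj, add_comm, Function.iterate_add_apply]
      exact Function.iterate_fixed he j
    rw [this] at hne
    exact hne he
  have hcard : ∀ i ≤ Fintype.card V + 1, i ≤ (f^[i] X).card := by
    intro i
    induction i with
    | zero => simp
    | succ i ih =>
      intro hi
      rw [Function.iterate_succ_apply']
      have := Finset.card_lt_card
        (Finset.ssubset_iff_subset_ne.2 ⟨hf (f^[i] X), (hall i (by omega)).symm⟩)
      have := ih (by omega)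
      omega
  have h1 := hcard _ le_rfl
  have h2 := Finset.card_le_univ (f^[Fintype.card V + 1] X)
  omega

/-- The closure of `X`. -/
noncomputable def closureOf (X : Finset (Fin n)) (B : ℕ) : Finset (Fin n) :=
  (closureStep G X B)^[n] X

theorem subset_closureStep (X : Finset (Fin n)) (B : ℕ) (K : Finset (Fin n)) :
    K ⊆ closureStep G X B K := Finset.subset_union_left

theorem closure_iterate (X : Finset (Fin n)) (B i : ℕ) :
    X ⊆ (closureStep G X B)^[i] X ∧
      ∃ KK, ClosureRecord G X B ((closureStep G X B)^[i] X) KK := by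
  induction i with
  | zero => exact ⟨subset_rfl, exists_closureRecord_self G X B⟩
  | succ i ih =>
    rw [Function.iterate_succ_apply']
    exact ⟨ih.1.trans (subset_closureStep G X B _), exists_closureRecord_step G ih.1 ih.2⟩

theorem supported_of_notMem_closureOf {X : Finset (Fin n)} {B : ℕ} {w : Fin n}
    (hw : w ∉ closureOf G X B) : Supported G X B (closureOf G X B) w := by
  classical
  by_contra hs
  have h := iterate_card_fixed (subset_closureStep G X B) X
  rw [Fintype.card_fin] at h
  refine hw ?_
  unfold closureOf at hs ⊢
  rw [← h]
  exact Finset.mem_union_right _ (Finset.mem_filter.2 ⟨Finset.mem_univ _, hs⟩)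

/-- Bound for the size of the closure, per token. -/
def coreConst (r : ℕ) : ℕ := closureConst r (classConst r) * (8 * r + 3)

/-- The number of further vertices outside the closure that are kept, per token. -/
def extraConst (r : ℕ) : ℕ :=
  (8 * r + 1) * (classConst r + 13 * (groupConst r * coreConst r)) + tripleConst r * coreConst r

/-- The vertices to be kept. -/
noncomputable def keepSet (r : ℕ) (S T : Finset (Fin n)) : Finset (Fin n) :=
  let F := freeOf G (S ∪ T)
  let X := (S ∪ T) ∪ firstOf F ((8 * r + 1) * S.card)
  let K := closureOf G X (classConst r)
  if (8 * r + 1) * S.card ≤ F.card then X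
  else K ∪ classReps G (classConst r) K ∪ firstOf (Finset.univ \ K) (extraConst r * S.card)

/-- Bound for the number of vertices to be kept, per token. -/
def keepConst (r : ℕ) : ℕ :=
  coreConst r + classConst r * (groupConst r * coreConst r) + extraConst r + (8 * r + 3)

/-- With many free vertices the answer is yes inside `X`. Otherwise `X` contains all free vertices
and hence dominates, so the closure is linear. The class representatives and the reservoir found
among the extra vertices supply the hypotheses of `reach_restrict`. -/
theorem keepSet_spec {r : ℕ} (hr : 0 < r)
    (hG : ¬ IsMinor (completeBipartiteGraph (Fin 3) (Fin r)) G) {S T : Finset (Fin n)}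
    (hS : Indep G S) (hT : Indep G T) (hST : S.card = T.card) :
    S ∪ T ⊆ keepSet G r S T ∧ (keepSet G r S T).card ≤ keepConst r * S.card ∧
      (Reach G (keepSet G r S T) S T ↔ Reach G Finset.univ S T) := by
  classical
  set F := freeOf G (S ∪ T) with hF
  set m := (8 * r + 1) * S.card with hm
  set X := (S ∪ T) ∪ firstOf F m with hX
  set K := closureOf G X (classConst r) with hK
  have hSX : S ⊆ X := Finset.subset_union_left.trans Finset.subset_union_left
  have hTX : T ⊆ X := Finset.subset_union_right.trans Finset.subset_union_left
  have hXc : X.card ≤ (8 * r + 3) * S.card := by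
    have h1 := Finset.card_union_le (S ∪ T) (firstOf F m)
    have h2 := Finset.card_union_le S T
    have h3 := card_firstOf_le F m
    have : (8 * r + 3) * S.card = m + 2 * S.card := by rw [hm]; ring
    rw [← hX] at h1
    omega
  by_cases hbig : m ≤ F.card
  · have hkeep : keepSet G r S T = X := if_pos hbig
    rw [hkeep]
    refine ⟨Finset.subset_union_left, hXc.trans (Nat.mul_le_mul_right _ (by
      unfold keepConst; omega)), ?_⟩
    -- An independent set of free vertices is parking space for all tokens, from the source and from
    -- the target alike.
    obtain ⟨Q, hQ, hQi, hQc⟩ := exists_indep_subset G (q := 4 * r)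
      (fun A => (degSum_le_of_not_isMinor G hr hG A).trans (by linarith)) (firstOf F m)
    have hQc : S.card ≤ Q.card := by
      have h1 : (8 * r + 1) * S.card ≤ (8 * r + 1) * Q.card := by
        have e : 2 * (4 * r) + 1 = 8 * r + 1 := by ring
        rw [e] at hQc
        exact (le_card_firstOf hbig).trans hQc
      exact Nat.le_of_mul_le_mul_left h1 (by omega)
    obtain ⟨J, hJQ, hJc⟩ := Finset.exists_subset_card_eq hQc
    have hQX : Q ⊆ X := hQ.trans Finset.subset_union_right
    have hfree : ∀ A ⊆ S ∪ T, ∀ u ∈ A, ∀ v ∈ Q, ¬ G.Adj u v := fun A hA u hu v hv =>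
      (Finset.mem_filter.1 (firstOf_subset _ _ (hQ hv))).2.2 u (hA hu)
    have hgo : ∀ A, Indep G A → A ⊆ S ∪ T → A.card = S.card → Reach G X A J := by
      intro A hA hAS hAc
      exact reach_of_subset G (Indep.union G hA hQi (hfree A hAS))
        (Finset.union_subset (hAS.trans Finset.subset_union_left) hQX) Finset.subset_union_left
        (hJQ.trans Finset.subset_union_right) (by omega)
    have hyes : Reach G X S T := (hgo S hS Finset.subset_union_left rfl).trans
      ((hgo T hT Finset.subset_union_right hST.symm).symm G)
    exact ⟨fun h => h.mono G (Finset.subset_univ _), fun _ => hyes⟩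
  · have hkeep : keepSet G r S T = K ∪ classReps G (classConst r) K ∪
        firstOf (Finset.univ \ K) (extraConst r * S.card) := if_neg hbig
    rw [hkeep]
    set M := K ∪ classReps G (classConst r) K ∪
        firstOf (Finset.univ \ K) (extraConst r * S.card) with hM
    -- An empty token set would have passed the comparison `hbig`.
    have hk : 0 < S.card := by
      rcases Nat.eq_zero_or_pos S.card with h | h
      · rw [hm, h, mul_zero] at hbig; exact absurd (Nat.zero_le _) hbig
      · exact h
    have hXK : X ⊆ K := (closure_iterate G X (classConst r) n).1
    have hKpos : 0 < K.card := hk.trans_le (Finset.card_le_card (hSX.trans hXK))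
    have hFX : F ⊆ X := by
      rw [hX, firstOf_eq_self (by omega)]
      exact Finset.subset_union_right
    have hdom : ∀ z, z ∉ X → ∃ x ∈ X, G.Adj x z := by
      intro z hz
      by_contra hno
      push Not at hno
      refine hz (hFX (Finset.mem_filter.2 ⟨Finset.mem_univ _, fun h => hz ?_, fun x hx => ?_⟩))
      · exact Finset.mem_union_left _ h
      · exact hno x (Finset.mem_union_left _ hx)
    have hKc : K.card ≤ coreConst r * S.card := by
      refine (card_closure_le G hr hG (fun z _ => hdom z)
        (closure_iterate G X (classConst r) n).2).trans ?_
      rw [coreConst, mul_assoc]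
      exact Nat.mul_le_mul_left _ hXc
    have hKM : K ⊆ M := Finset.subset_union_left.trans Finset.subset_union_left
    refine ⟨(Finset.union_subset hSX hTX).trans (hXK.trans hKM), ?_, ?_⟩
    · have h1 := Finset.card_union_le (K ∪ classReps G (classConst r) K)
        (firstOf (Finset.univ \ K) (extraConst r * S.card))
      have h2 := Finset.card_union_le K (classReps G (classConst r) K)
      have h3 := card_firstOf_le (Finset.univ \ K) (extraConst r * S.card)
      have h4 := card_classReps_le G hr hG (classConst r) hKpos
      have h5 : classConst r * (groupConst r * K.card) ≤
          classConst r * (groupConst r * (coreConst r * S.card)) := by gcongr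
      have h6 : keepConst r * S.card = coreConst r * S.card +
        classConst r * (groupConst r * (coreConst r * S.card)) + extraConst r * S.card +
        (8 * r + 3) * S.card := by unfold keepConst; ring
      rw [← hM] at h1
      omega
    · refine ⟨fun h => h.mono G (Finset.subset_univ _), fun h => ?_⟩
      -- With few vertices outside `K`, everything is kept.
      by_cases hfew : (Finset.univ \ K).card ≤ extraConst r * S.card
      · have : M = Finset.univ := by
          rw [hM, firstOf_eq_self hfew]
          ext x
          simp only [Finset.mem_union, Finset.mem_sdiff, Finset.mem_univ, true_and, iff_true]
          tauto
        rw [this]; exact h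
      · set Z₀ := firstOf (Finset.univ \ K) (extraConst r * S.card) with hZ₀
        have hd : Disjoint K Z₀ := by
          rw [Finset.disjoint_right]
          exact fun x hx => (Finset.mem_sdiff.1 (firstOf_subset _ _ hx)).2
        have hZ₀c : extraConst r * S.card ≤ Z₀.card := le_card_firstOf (by omega)
        -- As `S.card` is positive, a reservoir of size `classConst r * S.card` has both at least
        -- `classConst r` and at least `S.card` elements.
        obtain ⟨Z, hZZ, hZ, hZc⟩ := exists_reservoir G hr hG hd hKpos (m := classConst r * S.card) (by
          refine le_trans ?_ hZ₀c
          calc (8 * r + 1) * (classConst r * S.card + 13 * (groupConst r * K.card)) +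
                tripleConst r * K.card
              ≤ (8 * r + 1) * (classConst r * S.card +
                13 * (groupConst r * (coreConst r * S.card))) +
                tripleConst r * (coreConst r * S.card) := by gcongr
            _ = extraConst r * S.card := by unfold extraConst; ring)
        have hB : 0 < classConst r := by unfold classConst; omega
        have hsub : ∀ z, firstOf (nbrClass G K z) (classConst r) ⊆ nbrClass G K z ∩ M := fun z =>
          Finset.subset_inter (firstOf_subset _ _) ((firstOf_subset_classReps G).trans
            (Finset.subset_union_right.trans Finset.subset_union_left))
        refine reach_restrict G hr hG hKM hXK (hZZ.trans Finset.subset_union_right) hZ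
          ((Nat.le_mul_of_pos_right _ hk).trans hZc)
          (fun w hw => supported_of_notMem_closureOf G hw) (fun z _ hz => ?_) (fun z hz => ?_)
          (hSX.trans hXK) (hTX.trans hXK) ((Nat.le_mul_of_pos_left _ hB).trans hZc) h
        · exact (le_card_firstOf hz).trans (Finset.card_le_card (hsub z))
        · have h1 : 1 ≤ (nbrClass G K z).card :=
            Finset.card_pos.2 ⟨z, mem_nbrClass_self G hz⟩
          have h2 : firstOf (nbrClass G K z) 1 ⊆ firstOf (nbrClass G K z) (classConst r) :=
            Finset.monotone_filter_right _ fun v _ hv => lt_of_lt_of_le hv hB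
          have h3 := (le_card_firstOf h1).trans (Finset.card_le_card (h2.trans (hsub z)))
          exact Finset.card_pos.1 h3

end Kernel

/-! ### Passing to an induced subgraph -/

section Restriction

theorem isMinor_comap {V W : Type*} (G : SimpleGraph V) (φ : W ↪ V) :
    IsMinor (G.comap φ) G := by
  refine ⟨fun w => {φ w}, fun w => connected_induce_singleton G _, fun w w' h => ?_,
    fun w w' h => ⟨φ w, rfl, φ w', rfl, h⟩⟩
  simpa using fun e => h (φ.injective e)

variable {m n : ℕ} (G : SimpleGraph (Fin n))

theorem indep_map {φ : Fin m ↪ Fin n} {A : Finset (Fin m)} :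
    Indep G (A.map φ) ↔ Indep (G.comap φ) A := by
  simp [Indep]

theorem reach_map {φ : Fin m ↪ Fin n} {M : Finset (Fin n)} (hφ : ∀ u, φ u ∈ M)
    {A B : Finset (Fin m)} (hA : Indep (G.comap φ) A)
    (h : Relation.ReflTransGen (Jump (G.comap φ)) A B) :
    Indep (G.comap φ) B ∧ Reach G M (A.map φ) (B.map φ) := by
  have hsub : ∀ A : Finset (Fin m), A.map φ ⊆ M := by
    intro A x hx
    obtain ⟨u, -, rfl⟩ := Finset.mem_map.1 hx
    exact hφ u
  induction h with
  | refl => exact ⟨hA, Relation.ReflTransGen.refl⟩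
  | tail _ h ih =>
    obtain ⟨v, hv, w, hw, rfl, hB⟩ := h
    have hB' := (indep_iff _).2 hB
    refine ⟨hB', ih.2.tail ⟨hsub _, hsub _, (indep_map G).2 ih.1, (indep_map G).2 hB', φ v,
      Finset.mem_map_of_mem _ hv, φ w, by simpa using hw, ?_⟩⟩
    rw [Finset.map_insert, Finset.map_erase]

theorem exists_map_of_reach {φ : Fin m ↪ Fin n} {M : Finset (Fin n)} (hφ : ∀ x ∈ M, ∃ u, φ u = x)
    {A : Finset (Fin m)} {B : Finset (Fin n)} (h : Reach G M (A.map φ) B) :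
    ∃ B', B = B'.map φ ∧ Relation.ReflTransGen (Jump (G.comap φ)) A B' := by
  induction h with
  | refl => exact ⟨A, rfl, Relation.ReflTransGen.refl⟩
  | tail _ h ih =>
    obtain ⟨B', rfl, hr⟩ := ih
    obtain ⟨-, hM, -, hB, v, hv, w, hw, rfl⟩ := h
    obtain ⟨v, hvB, rfl⟩ := Finset.mem_map.1 hv
    obtain ⟨w, rfl⟩ := hφ w (hM (Finset.mem_insert_self _ _))
    have e : insert (φ w) ((B'.map φ).erase (φ v)) = (insert w (B'.erase v)).map φ := by
      rw [Finset.map_insert, Finset.map_erase]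
    rw [e] at hB
    refine ⟨_, e, hr.tail ⟨v, hvB, w, by simpa using hw, rfl, ?_⟩⟩
    exact (indep_iff _).1 ((indep_map G).1 hB)

/-- The increasing enumeration of `M`. -/
def nameOf (M : Finset (Fin n)) : Fin M.card ↪ Fin n := (M.orderEmbOfFin rfl).toEmbedding

theorem nameOf_mem (M : Finset (Fin n)) (u : Fin M.card) : nameOf M u ∈ M :=
  M.orderEmbOfFin_mem rfl u

theorem exists_nameOf {M : Finset (Fin n)} {x : Fin n} (hx : x ∈ M) : ∃ u, nameOf M u = x := by
  have := M.range_orderEmbOfFin rfl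
  rw [← Finset.mem_coe, ← this] at hx
  exact hx

theorem nameOf_lt_iff {M : Finset (Fin n)} {u v : Fin M.card} :
    nameOf M u < nameOf M v ↔ u < v := (M.orderEmbOfFin rfl).lt_iff_lt

/-- The name of the `i`-th element of `M` is the number of vertices up to which there are at most
`i` elements of `M`. -/
theorem card_filter_rank_le (M : Finset (Fin n)) (i : Fin M.card) :
    (Finset.univ.filter (fun u : Fin n => (M.filter (· ≤ u)).card ≤ i)).card = nameOf M i := by
  rw [← Fin.card_Iio (nameOf M i)]
  congr 1
  ext u
  simp only [Finset.mem_filter, Finset.mem_univ, true_and, Finset.mem_Iio]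
  constructor
  · intro h
    by_contra hle
    push Not at hle
    have hsub : (Finset.Iic i).map (nameOf M) ⊆ M.filter (· ≤ u) := by
      intro x hx
      obtain ⟨j, hj, rfl⟩ := Finset.mem_map.1 hx
      refine Finset.mem_filter.2 ⟨nameOf_mem M j, le_trans ?_ hle⟩
      exact not_lt.1 fun h => absurd (nameOf_lt_iff.1 h) (not_lt.2 (Finset.mem_Iic.1 hj))
    have := Finset.card_le_card hsub
    rw [Finset.card_map, Fin.card_Iic] at this
    omega
  · intro h
    have hsub : M.filter (· ≤ u) ⊆ (Finset.Iio i).map (nameOf M) := by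
      intro x hx
      obtain ⟨hx, hxu⟩ := Finset.mem_filter.1 hx
      obtain ⟨j, rfl⟩ := exists_nameOf hx
      exact Finset.mem_map_of_mem _ (Finset.mem_Iio.2 (nameOf_lt_iff.1 (hxu.trans_lt h)))
    have := Finset.card_le_card hsub
    rwa [Finset.card_map, Fin.card_Iio] at this

theorem map_filter_nameOf {M S : Finset (Fin n)} (hS : S ⊆ M) :
    (Finset.univ.filter (fun u => nameOf M u ∈ S)).map (nameOf M) = S := by
  ext x
  simp only [Finset.mem_map, Finset.mem_filter, Finset.mem_univ, true_and]
  constructor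
  · rintro ⟨u, hu, rfl⟩; exact hu
  · intro hx
    obtain ⟨u, rfl⟩ := exists_nameOf (hS hx)
    exact ⟨u, hx, rfl⟩

/-- The instance induced by `I` on a set of vertices containing the source and the target. -/
def Instance.restrict (I : Instance) (M : Finset (Fin I.n)) (hM : I.source ∪ I.target ⊆ M) :
    Instance where
  n := M.card
  graph := I.graph.comap (nameOf M)
  source := Finset.univ.filter (fun u => nameOf M u ∈ I.source)
  target := Finset.univ.filter (fun u => nameOf M u ∈ I.target)
  source_indep := by
    rw [← indep_iff, ← indep_map, map_filter_nameOf (Finset.subset_union_left.trans hM), indep_iff]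
    exact I.source_indep
  target_indep := by
    rw [← indep_iff, ← indep_map, map_filter_nameOf (Finset.subset_union_right.trans hM), indep_iff]
    exact I.target_indep
  card_eq := by
    rw [← Finset.card_map (nameOf M), map_filter_nameOf (Finset.subset_union_left.trans hM),
      ← Finset.card_map (nameOf M), map_filter_nameOf (Finset.subset_union_right.trans hM)]
    exact I.card_eq

theorem mem_source_restrict {I : Instance} {M : Finset (Fin I.n)} (hM : I.source ∪ I.target ⊆ M)
    (u : Fin M.card) : nameOf M u ∈ I.source ↔ u ∈ (I.restrict M hM).source :=
  ⟨fun h => Finset.mem_filter.2 ⟨Finset.mem_univ u, h⟩, fun h => (Finset.mem_filter.1 h).2⟩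

theorem mem_target_restrict {I : Instance} {M : Finset (Fin I.n)} (hM : I.source ∪ I.target ⊆ M)
    (u : Fin M.card) : nameOf M u ∈ I.target ↔ u ∈ (I.restrict M hM).target :=
  ⟨fun h => Finset.mem_filter.2 ⟨Finset.mem_univ u, h⟩, fun h => (Finset.mem_filter.1 h).2⟩

theorem isSubinstance_restrict (I : Instance) (M : Finset (Fin I.n))
    (hM : I.source ∪ I.target ⊆ M) : IsSubinstance (I.restrict M hM) I (nameOf M) :=
  ⟨fun _ _ h => h, map_filter_nameOf (Finset.subset_union_left.trans hM),
    map_filter_nameOf (Finset.subset_union_right.trans hM)⟩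

theorem isYes_restrict (I : Instance) (M : Finset (Fin I.n)) (hM : I.source ∪ I.target ⊆ M) :
    (I.restrict M hM).IsYes ↔ Reach I.graph M I.source I.target := by
  have hs := map_filter_nameOf (Finset.subset_union_left.trans hM)
  have ht := map_filter_nameOf (Finset.subset_union_right.trans hM)
  constructor
  · intro h
    have := (reach_map I.graph (nameOf_mem M) ((indep_iff _).2 (I.restrict M hM).source_indep) h).2
    change Reach I.graph M (Finset.map (nameOf M) (Finset.univ.filter _))
      (Finset.map (nameOf M) (Finset.univ.filter _)) at this
    rwa [hs, ht] at this
  · intro h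
    rw [← hs] at h
    obtain ⟨B, hB, hr⟩ := exists_map_of_reach I.graph (fun x hx => exists_nameOf hx) h
    rw [← ht] at hB
    obtain rfl := Finset.map_injective _ hB
    exact hr

theorem isYes_iff_reach (I : Instance) :
    I.IsYes ↔ Reach I.graph Finset.univ I.source I.target := by
  constructor
  · intro h
    have hi := (indep_iff _).2 I.source_indep
    unfold Instance.IsYes at h
    suffices H : ∀ B, Relation.ReflTransGen (Jump I.graph) I.source B →
        Indep I.graph B ∧ Reach I.graph Finset.univ I.source B from (H _ h).2
    intro B h
    induction h with
    | refl => exact ⟨hi, Relation.ReflTransGen.refl⟩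
    | tail _ h ih =>
      obtain ⟨v, hv, w, hw, rfl, hB⟩ := h
      have hB' := (indep_iff _).2 hB
      exact ⟨hB', ih.2.tail ⟨Finset.subset_univ _, Finset.subset_univ _, ih.1, hB', v, hv, w, hw,
        rfl⟩⟩
  · intro h
    unfold Instance.IsYes
    unfold Reach at h
    generalize I.target = B at h ⊢
    induction h with
    | refl => exact Relation.ReflTransGen.refl
    | tail _ h ih =>
      obtain ⟨-, -, -, hB, v, hv, w, hw, rfl⟩ := h
      exact ih.tail ⟨v, hv, w, hw, rfl, (indep_iff _).1 hB⟩

end Restriction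

/-! ### Programs for counting terms and their running time -/

section Machine

/-- The program `p`, started on `σ`, halts after at most `c` steps with a memory satisfying `Q`. -/
def Runs (p : Prog) (σ : Store) (c : ℕ) (Q : Store → Prop) : Prop :=
  ∃ t σ', Exec p σ t σ' ∧ t ≤ c ∧ Q σ'

/-- The memory after `v` is written to cell `i` of array `a`. -/
def setCell (σ : Store) (a i v : ℕ) : Store :=
  Function.update σ a (Function.update (σ a) i v)

theorem setCell_self (σ : Store) (a i v : ℕ) : setCell σ a i v a i = v := by simp [setCell]

theorem setCell_of_ne_cell (σ : Store) (a v : ℕ) {i j : ℕ} (h : j ≠ i) :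
    setCell σ a i v a j = σ a j := by simp [setCell, h]

theorem setCell_of_ne (σ : Store) (i v : ℕ) {a b : ℕ} (h : b ≠ a) :
    setCell σ a i v b = σ b := by simp [setCell, h]

theorem Runs.mono {p : Prog} {σ : Store} {c c' : ℕ} {Q Q' : Store → Prop} (h : Runs p σ c Q)
    (hc : c ≤ c') (hQ : ∀ σ', Q σ' → Q' σ') : Runs p σ c' Q' := by
  obtain ⟨t, σ', h1, h2, h3⟩ := h
  exact ⟨t, σ', h1, h2.trans hc, hQ _ h3⟩

theorem Runs.seq {p q : Prog} {σ : Store} {c c' : ℕ} {Q R : Store → Prop} (h : Runs p σ c Q)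
    (h' : ∀ σ', Q σ' → Runs q σ' c' R) : Runs (.seq p q) σ (c + c') R := by
  obtain ⟨t, σ', h1, h2, h3⟩ := h
  obtain ⟨t', σ'', h1', h2', h3'⟩ := h' _ h3
  exact ⟨_, _, .seq h1 h1', Nat.add_le_add h2 h2', h3'⟩

theorem Runs.write {a : ℕ} {i e : Expr} {σ : Store} {Q : Store → Prop}
    (h : Q (setCell σ a (i.eval σ) (e.eval σ))) :
    Runs (.write a i e) σ (i.cost + e.cost + 1) Q :=
  ⟨_, _, .write a i e σ, le_rfl, h⟩

/-- The guard is the number of rounds left, so it first vanishes after round `m`. -/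
theorem Runs.loop {e : Expr} {p : Prog} {Inv : ℕ → Store → Prop} {m c : ℕ}
    (hg : ∀ i σ, i ≤ m → Inv i σ → e.eval σ = m - i)
    (hb : ∀ i σ, i < m → Inv i σ → Runs p σ c (Inv (i + 1))) {σ : Store} (h0 : Inv 0 σ) :
    Runs (.loop e p) σ ((m + 1) * (c + e.cost + 1)) (Inv m) := by
  suffices H : ∀ j i σ, i + j = m → Inv i σ →
      Runs (.loop e p) σ ((j + 1) * (c + e.cost + 1)) (Inv m) from H m 0 σ (by omega) h0
  intro j
  induction j with
  | zero =>
    intro i σ hi h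
    obtain rfl : i = m := by omega
    exact ⟨_, _, .loop_false (by rw [hg i σ le_rfl h]; omega), by omega, h⟩
  | succ j ih =>
    intro i σ hi h
    obtain ⟨t, σ', h1, h2, h3⟩ := hb i σ (by omega) h
    obtain ⟨t', σ'', h1', h2', h3'⟩ := ih (i + 1) σ' (by omega) h3
    refine ⟨_, _, .loop_true (by rw [hg i σ (by omega) h]; omega) h1 h1', ?_, h3'⟩
    have : (j + 1 + 1) * (c + e.cost + 1) = (j + 1) * (c + e.cost + 1) + (c + e.cost + 1) := by ring
    omega

/-- Repeats `p` with cell `0` of array `x` running from `0` up to the value of `N`. -/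
def forTo (x : ℕ) (N : Expr) (p : Prog) : Prog :=
  .seq (.write x (.const 0) (.const 0))
    (.loop (.monus N (.read x (.const 0)))
      (.seq p (.write x (.const 0) (.plus (.read x (.const 0)) (.const 1)))))

/-- The body has to return the counter unchanged, and the invariant is demanded only after the
increment. -/
theorem Runs.forTo {x : ℕ} {N : Expr} {p : Prog} {Inv : ℕ → Store → Prop} {m c : ℕ}
    (hN : ∀ i σ, i ≤ m → Inv i σ → N.eval σ = m) (hx : ∀ i σ, i ≤ m → Inv i σ → σ x 0 = i)
    (hb : ∀ i σ, i < m → Inv i σ → Runs p σ c (fun σ' => σ' x 0 = i ∧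
      Inv (i + 1) (setCell σ' x 0 (i + 1)))) {σ : Store} (h0 : Inv 0 (setCell σ x 0 0)) :
    Runs (forTo x N p) σ ((m + 1) * (c + N.cost + 10) + 3) (Inv m) := by
  refine Runs.mono (Runs.seq (Runs.write (Q := Inv 0) h0) fun σ' h =>
    Runs.loop (c := c + 6) (fun i σ hi hσ => ?_) (fun i σ hi hσ => ?_) h) ?_ fun _ h => h
  · simp only [Expr.eval]
    rw [hN i σ hi hσ, hx i σ hi hσ]
  · refine Runs.mono (Runs.seq (hb i σ hi hσ) fun σ' h => Runs.write (Q := Inv (i + 1)) ?_)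
      (by simp [Expr.cost]) fun _ h => h
    simp only [Expr.eval]
    rw [h.1]
    exact h.2
  · simp only [Expr.cost]
    have : m + 1 ≤ (m + 1) * (c + N.cost + 10) := Nat.le_mul_of_pos_right _ (by omega)
    have e : c + 6 + (N.cost + (1 + 1) + 1) + 1 = c + N.cost + 10 := by ring
    rw [e]
    omega

/-- The array that holds the `j`-th variable. -/
def varArr (j : ℕ) : ℕ := 100 + 2 * j

/-- The array that holds the `j`-th intermediate result. -/
def outArr (j : ℕ) : ℕ := 101 + 2 * j

/-- Arithmetic terms with finite sums over the vertices. -/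
inductive Term where
  | const (c : ℕ)
  | var (j : ℕ)
  | read (a : ℕ) (t : Term)
  | plus (s t : Term)
  | monus (s t : Term)
  | sum (t : Term)

/-- The value of a term, where `d` variables are bound to the values `ρ`. -/
def Term.eval (n : ℕ) (σ : Store) : (ℕ → ℕ) → ℕ → Term → ℕ
  | _, _, .const c => c
  | ρ, _, .var j => ρ j
  | ρ, d, .read a t => σ a (t.eval n σ ρ d)
  | ρ, d, .plus s t => s.eval n σ ρ d + t.eval n σ ρ d
  | ρ, d, .monus s t => s.eval n σ ρ d - t.eval n σ ρ d
  | ρ, d, .sum t => ∑ i : Fin n, t.eval n σ (Function.update ρ d i) (d + 1)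

/-- The variables of the term are bound, and it reads arrays below `100` other than `a` only. -/
def Term.Ok (a : ℕ) : ℕ → Term → Prop
  | _, .const _ => True
  | d, .var j => j < d
  | d, .read b t => b < 100 ∧ b ≠ a ∧ t.Ok a d
  | d, .plus s t => s.Ok a d ∧ t.Ok a d
  | d, .monus s t => s.Ok a d ∧ t.Ok a d
  | d, .sum t => t.Ok a (d + 1)

/-- Excluding `a` allows a term to be evaluated while array `a` is partly overwritten with its
values. -/
theorem Term.eval_congr {n a : ℕ} {σ τ : Store} (hσ : ∀ b < 100, b ≠ a → σ b = τ b) (t : Term) :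
    ∀ {d : ℕ} {ρ ρ' : ℕ → ℕ}, (∀ j < d, ρ j = ρ' j) → t.Ok a d →
      t.eval n σ ρ d = t.eval n τ ρ' d := by
  induction t with
  | const c => intros; rfl
  | var j => intro d ρ ρ' hρ h; exact hρ j h
  | read b t ih =>
    intro d ρ ρ' hρ h
    simp only [Term.eval]
    rw [hσ b h.1 h.2.1, ih hρ h.2.2]
  | plus s t ihs iht =>
    intro d ρ ρ' hρ h
    simp only [Term.eval]
    rw [ihs hρ h.1, iht hρ h.2]
  | monus s t ihs iht =>
    intro d ρ ρ' hρ h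
    simp only [Term.eval]
    rw [ihs hρ h.1, iht hρ h.2]
  | sum t ih =>
    intro d ρ ρ' hρ h
    simp only [Term.eval]
    refine Finset.sum_congr rfl fun i _ => ih (fun j hj => ?_) h
    rcases eq_or_ne j d with rfl | hne
    · simp
    · simp [hne, hρ j (by omega)]

/-- A program that evaluates a term into the intermediate result `l`. -/
def Term.compile : ℕ → ℕ → Term → Prog
  | _, l, .const c => .write (outArr l) (.const 0) (.const c)
  | _, l, .var j => .write (outArr l) (.const 0) (.read (varArr j) (.const 0))
  | d, l, .read a t => .seq (t.compile d l)
      (.write (outArr l) (.const 0) (.read a (.read (outArr l) (.const 0))))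
  | d, l, .plus s t => .seq (s.compile d l) (.seq (t.compile d (l + 1))
      (.write (outArr l) (.const 0)
        (.plus (.read (outArr l) (.const 0)) (.read (outArr (l + 1)) (.const 0)))))
  | d, l, .monus s t => .seq (s.compile d l) (.seq (t.compile d (l + 1))
      (.write (outArr l) (.const 0)
        (.monus (.read (outArr l) (.const 0)) (.read (outArr (l + 1)) (.const 0)))))
  | d, l, .sum t => .seq (.write (outArr l) (.const 0) (.const 0))
      (forTo (varArr d) (.read 0 (.const 0)) (.seq (t.compile (d + 1) (l + 1))
        (.write (outArr l) (.const 0)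
          (.plus (.read (outArr l) (.const 0)) (.read (outArr (l + 1)) (.const 0))))))

/-- `σ'` agrees with `σ` on the arrays below `100`, the first `d` variables and the first `l`
intermediate results. -/
structure Frame (d l : ℕ) (σ σ' : Store) : Prop where
  low : ∀ b < 100, σ' b = σ b
  var : ∀ j < d, σ' (varArr j) = σ (varArr j)
  out : ∀ j < l, σ' (outArr j) = σ (outArr j)

theorem Frame.refl (d l : ℕ) (σ : Store) : Frame d l σ σ :=
  ⟨fun _ _ => rfl, fun _ _ => rfl, fun _ _ => rfl⟩

theorem Frame.trans {d l : ℕ} {σ σ' σ'' : Store} (h : Frame d l σ σ') (h' : Frame d l σ' σ'') :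
    Frame d l σ σ'' :=
  ⟨fun b hb => (h'.low b hb).trans (h.low b hb), fun b hb => (h'.var b hb).trans (h.var b hb),
    fun b hb => (h'.out b hb).trans (h.out b hb)⟩

theorem Frame.mono {d l d' l' : ℕ} {σ σ' : Store} (h : Frame d l σ σ') (hd : d' ≤ d)
    (hl : l' ≤ l) : Frame d' l' σ σ' :=
  ⟨h.low, fun j hj => h.var j (by omega), fun j hj => h.out j (by omega)⟩

theorem Frame.setOut {d l : ℕ} {σ σ' : Store} (h : Frame d l σ σ') (v : ℕ) :
    Frame d l σ (setCell σ' (outArr l) 0 v) := by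
  refine h.trans ⟨fun b hb => ?_, fun j hj => ?_, fun j hj => ?_⟩ <;> refine setCell_of_ne _ _ _ ?_
  · unfold outArr; omega
  · unfold outArr varArr; omega
  · unfold outArr; omega

theorem Frame.setVar {d l : ℕ} {σ σ' : Store} (h : Frame d l σ σ') (v : ℕ) :
    Frame d l σ (setCell σ' (varArr d) 0 v) := by
  refine h.trans ⟨fun b hb => ?_, fun j hj => ?_, fun j hj => ?_⟩ <;> refine setCell_of_ne _ _ _ ?_
  · unfold varArr; omega
  · unfold varArr; omega
  · unfold outArr varArr; omega

theorem outArr_ne_varArr (i j : ℕ) : outArr i ≠ varArr j := by unfold outArr varArr; omega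

open Polynomial in
-- Structural induction. A sum costs `n + 1` rounds of its summand plus constant overhead per round,
-- so the bound stays polynomial. The frame protects enclosing loop variables and pending results.
theorem Term.runs_compile {a : ℕ} (t : Term) : ∀ d l : ℕ, t.Ok a d →
    ∃ P : ℕ[X], ∀ (n : ℕ) (σ : Store) (ρ : ℕ → ℕ), σ 0 0 = n →
      (∀ j < d, σ (varArr j) 0 = ρ j) →
      Runs (t.compile d l) σ (P.eval n) (fun σ' =>
        σ' (outArr l) 0 = t.eval n σ ρ d ∧ Frame d l σ σ') := by
  -- Common to both binary operations: the second operand goes to slot `l + 1` and leaves slot `l`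
  -- intact.
  have hop : ∀ (e : Expr → Expr → Expr) (f : ℕ → ℕ → ℕ) (s t : Term) (d l : ℕ),
      (∀ x y σ, (e x y).eval σ = f (x.eval σ) (y.eval σ)) →
      (∀ x y, (e x y).cost = x.cost + y.cost + 1) → t.Ok a d →
      (∃ P : ℕ[X], ∀ (n : ℕ) (σ : Store) (ρ : ℕ → ℕ), σ 0 0 = n →
        (∀ j < d, σ (varArr j) 0 = ρ j) → Runs (s.compile d l) σ (P.eval n) (fun σ' =>
          σ' (outArr l) 0 = s.eval n σ ρ d ∧ Frame d l σ σ')) →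
      (∃ P : ℕ[X], ∀ (n : ℕ) (σ : Store) (ρ : ℕ → ℕ), σ 0 0 = n →
        (∀ j < d, σ (varArr j) 0 = ρ j) → Runs (t.compile d (l + 1)) σ (P.eval n) (fun σ' =>
          σ' (outArr (l + 1)) 0 = t.eval n σ ρ d ∧ Frame d (l + 1) σ σ')) →
      ∃ P : ℕ[X], ∀ (n : ℕ) (σ : Store) (ρ : ℕ → ℕ), σ 0 0 = n →
        (∀ j < d, σ (varArr j) 0 = ρ j) →
        Runs (.seq (s.compile d l) (.seq (t.compile d (l + 1)) (.write (outArr l) (.const 0)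
          (e (.read (outArr l) (.const 0)) (.read (outArr (l + 1)) (.const 0)))))) σ (P.eval n)
          (fun σ' => σ' (outArr l) 0 = f (s.eval n σ ρ d) (t.eval n σ ρ d) ∧ Frame d l σ σ') := by
    rintro e f s t d l he hc ht ⟨P, hP⟩ ⟨Q, hQ⟩
    refine ⟨P + (Q + 7), fun n σ ρ hn hρ => ?_⟩
    refine Runs.mono (Runs.seq (hP n σ ρ hn hρ) fun σ₁ h₁ => Runs.seq
      (hQ n σ₁ ρ (by rw [h₁.2.low 0 (by norm_num)]; exact hn)
        fun j hj => by rw [h₁.2.var j hj]; exact hρ j hj)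
      fun σ₂ h₂ => Runs.write (Q := fun σ' => σ' (outArr l) 0 =
        f (s.eval n σ ρ d) (t.eval n σ ρ d) ∧ Frame d l σ σ') ?_)
      (by simp [hc, Expr.cost]) fun _ h => h
    rw [he]
    simp only [Expr.eval]
    rw [h₂.1, h₂.2.out l (by omega), h₁.1,
      t.eval_congr (a := a) (fun b hb _ => h₁.2.low b hb) (fun _ _ => rfl) ht]
    exact ⟨setCell_self _ _ _ _, (h₁.2.trans (h₂.2.mono le_rfl (by omega))).setOut _⟩
  induction t with
  | const c =>
    intro d l _
    exact ⟨3, fun n σ ρ _ _ => Runs.mono (Runs.write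
      ⟨setCell_self _ _ _ _, (Frame.refl d l σ).setOut _⟩) (by simp [Expr.cost]) fun _ h => h⟩
  | var j =>
    intro d l hj
    refine ⟨4, fun n σ ρ _ hρ => Runs.mono (Runs.write (Q := fun σ' =>
        σ' (outArr l) 0 = ρ j ∧ Frame d l σ σ')
      ⟨?_, (Frame.refl d l σ).setOut _⟩) (by simp [Expr.cost]) fun _ h => h⟩
    simp only [Expr.eval]
    rw [setCell_self, hρ j hj]
  | read b t ih =>
    intro d l h
    obtain ⟨P, hP⟩ := ih d l h.2.2
    refine ⟨P + 5, fun n σ ρ hn hρ => ?_⟩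
    refine Runs.mono (Runs.seq (hP n σ ρ hn hρ) fun σ₁ h₁ => Runs.write (Q := fun σ' =>
        σ' (outArr l) 0 = σ b (t.eval n σ ρ d) ∧ Frame d l σ σ') ⟨?_, h₁.2.setOut _⟩)
      (by simp [Expr.cost]) fun _ h => h
    simp only [Expr.eval]
    rw [setCell_self, h₁.1, h₁.2.low b h.1]
  | plus s t ihs iht =>
    intro d l h
    exact hop Expr.plus (· + ·) s t d l (fun _ _ _ => rfl) (fun _ _ => rfl) h.2
      (ihs d l h.1) (iht d (l + 1) h.2)
  | monus s t ihs iht =>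
    intro d l h
    exact hop Expr.monus (· - ·) s t d l (fun _ _ _ => rfl) (fun _ _ => rfl) h.2
      (ihs d l h.1) (iht d (l + 1) h.2)
  | sum t ih =>
    intro d l h
    obtain ⟨P, hP⟩ := ih (d + 1) (l + 1) h
    refine ⟨(X + 1) * (P + 19) + 6, fun n σ ρ hn hρ => ?_⟩
    let Inv : ℕ → Store → Prop := fun i σ' => σ' (varArr d) 0 = i ∧ Frame d l σ σ' ∧
      σ' (outArr l) 0 = ∑ j ∈ Finset.range i, t.eval n σ (Function.update ρ d j) (d + 1)
    have hinit : ∀ σ₁, (σ₁ (outArr l) 0 = 0 ∧ Frame d l σ σ₁) →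
        Inv 0 (setCell σ₁ (varArr d) 0 0) := by
      rintro σ₁ ⟨h1, h2⟩
      refine ⟨setCell_self _ _ _ _, h2.setVar _, ?_⟩
      rw [setCell_of_ne _ _ _ (outArr_ne_varArr l d), h1]
      rfl
    refine Runs.mono (Runs.seq (Runs.write (Q := fun σ' => σ' (outArr l) 0 = 0 ∧ Frame d l σ σ')
      ⟨setCell_self _ _ _ _, (Frame.refl d l σ).setOut _⟩) fun σ₁ h₁ =>
      Runs.forTo (Inv := Inv) (m := n) (c := P.eval n + 7) ?_ ?_ ?_ (hinit σ₁ h₁)) ?_ ?_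
    · intro i σ' _ hI
      simp only [Expr.eval]
      rw [hI.2.1.low 0 (by norm_num), hn]
    · exact fun i σ' _ hI => hI.1
    · intro i σ' hi hI
      have hρ' : ∀ j < d + 1, σ' (varArr j) 0 = Function.update ρ d i j := by
        intro j hj
        rcases eq_or_ne j d with rfl | hne
        · simp [hI.1]
        · rw [Function.update_of_ne hne, hI.2.1.var j (by omega), hρ j (by omega)]
      refine Runs.mono (Runs.seq (hP n σ' (Function.update ρ d i)
        (by rw [hI.2.1.low 0 (by norm_num)]; exact hn) hρ') fun σ₂ h₂ => Runs.write
        (Q := fun σ' => σ' (varArr d) 0 = i ∧ Inv (i + 1) (setCell σ' (varArr d) 0 (i + 1))) ?_)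
        (by simp [Expr.cost]) fun _ h => h
      refine ⟨?_, setCell_self _ _ _ _, ?_, ?_⟩
      · rw [setCell_of_ne _ _ _ (outArr_ne_varArr l d).symm, h₂.2.var d (by omega)]
        exact hI.1
      · exact ((hI.2.1.trans (h₂.2.mono (by omega) (by omega))).setOut _).setVar _
      · simp only [Expr.eval]
        rw [setCell_of_ne _ _ _ (outArr_ne_varArr l d), setCell_self, h₂.1,
          h₂.2.out l (by omega), hI.2.2, Finset.sum_range_succ,
          t.eval_congr (a := a) (fun b hb _ => hI.2.1.low b hb) (fun _ _ => rfl) h]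
    · simp only [Expr.cost, eval_add, eval_mul, eval_X, eval_one, eval_ofNat]
      have : (n + 1) * (P.eval n + 7 + (1 + 1) + 10) = (n + 1) * (P.eval n + 19) := by ring
      omega
    · intro σ' hI
      refine ⟨?_, hI.2.1⟩
      rw [hI.2.2, Finset.sum_range]
      rfl

/-- Writes the value of a closed term to cell `0` of array `a`. -/
def assign (a : ℕ) (t : Term) : Prog :=
  .seq (t.compile 0 0) (.write a (.const 0) (.read (outArr 0) (.const 0)))

/-- Writes the values of a term with one variable to the first cells of array `a`. -/
def fill (a : ℕ) (t : Term) : Prog :=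
  forTo (varArr 0) (.read 0 (.const 0)) (.seq (t.compile 1 0)
    (.write a (.read (varArr 0) (.const 0)) (.read (outArr 0) (.const 0))))

open Polynomial in
theorem runs_assign {a : ℕ} (t : Term) (ht : t.Ok a 0) :
    ∃ P : ℕ[X], ∀ (n : ℕ) (σ : Store), σ 0 0 = n → Runs (assign a t) σ (P.eval n) (fun σ' =>
      (∀ b < 100, b ≠ a → σ' b = σ b) ∧ σ' a 0 = t.eval n σ (fun _ => 0) 0) := by
  obtain ⟨P, hP⟩ := t.runs_compile 0 0 ht
  refine ⟨P + 4, fun n σ hn => ?_⟩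
  refine Runs.mono (Runs.seq (hP n σ (fun _ => 0) hn fun j hj => absurd hj (by omega)) fun σ₁ h₁ =>
    Runs.write (Q := fun σ' => (∀ b < 100, b ≠ a → σ' b = σ b) ∧
      σ' a 0 = t.eval n σ (fun _ => 0) 0) ⟨fun b hb hba => ?_, ?_⟩)
    (by simp [Expr.cost]) fun _ h => h
  · rw [setCell_of_ne _ _ _ hba, h₁.2.low b hb]
  · simp only [Expr.eval]
    rw [setCell_self, h₁.1]

open Polynomial in
theorem runs_fill {a : ℕ} (ha : a ≠ 0) (ha' : a < 100) (t : Term) (ht : t.Ok a 1) :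
    ∃ P : ℕ[X], ∀ (n : ℕ) (σ : Store), σ 0 0 = n → Runs (fill a t) σ (P.eval n) (fun σ' =>
      (∀ b < 100, b ≠ a → σ' b = σ b) ∧
      ∀ w : Fin n, σ' a w = t.eval n σ (fun _ => (w : ℕ)) 1) := by
  obtain ⟨P, hP⟩ := t.runs_compile 1 0 ht
  refine ⟨(X + 1) * (P + 17) + 3, fun n σ hn => ?_⟩
  have hav : a ≠ varArr 0 := by unfold varArr; omega
  let Inv : ℕ → Store → Prop := fun i σ' => σ' (varArr 0) 0 = i ∧
    (∀ b < 100, b ≠ a → σ' b = σ b) ∧ ∀ w < i, σ' a w = t.eval n σ (fun _ => w) 1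
  refine Runs.mono (Runs.forTo (Inv := Inv) (m := n) (c := P.eval n + 5) ?_ ?_ ?_ ?_) ?_ ?_
  · intro i σ' _ hI
    simp only [Expr.eval]
    rw [hI.2.1 0 (by norm_num) ha.symm, hn]
  · exact fun i σ' _ hI => hI.1
  · intro i σ' hi hI
    refine Runs.mono (Runs.seq (hP n σ' (fun _ => i)
      (by rw [hI.2.1 0 (by norm_num) ha.symm]; exact hn) fun j hj => ?_) fun σ₂ h₂ => Runs.write
      (Q := fun σ' => σ' (varArr 0) 0 = i ∧ Inv (i + 1) (setCell σ' (varArr 0) 0 (i + 1))) ?_)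
      (by simp [Expr.cost]) fun _ h => h
    · obtain rfl : j = 0 := by omega
      exact hI.1
    · have hv : σ₂ (varArr 0) 0 = i := by rw [h₂.2.var 0 (by omega)]; exact hI.1
      simp only [Expr.eval]
      rw [hv]
      refine ⟨?_, setCell_self _ _ _ _, fun b hb hba => ?_, fun w hw => ?_⟩
      · rw [setCell_of_ne _ _ _ hav.symm, hv]
      · have hb' : b ≠ varArr 0 := by unfold varArr; omega
        rw [setCell_of_ne _ _ _ hb', setCell_of_ne _ _ _ hba, h₂.2.low b hb, hI.2.1 b hb hba]
      · rw [setCell_of_ne _ _ _ hav]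
        rcases eq_or_ne w i with rfl | hne
        · rw [setCell_self, h₂.1]
          exact t.eval_congr (a := a) hI.2.1 (fun _ _ => rfl) ht
        · rw [setCell_of_ne_cell _ _ _ hne, h₂.2.low a ha', hI.2.2 w (by omega)]
  · refine ⟨setCell_self _ _ _ _, fun b hb _ => ?_, fun w hw => absurd hw (by omega)⟩
    have hb' : b ≠ varArr 0 := by unfold varArr; omega
    rw [setCell_of_ne _ _ _ hb']
  · simp only [Expr.cost, eval_add, eval_mul, eval_X, eval_one, eval_ofNat]
    have : (n + 1) * (P.eval n + 5 + (1 + 1) + 10) = (n + 1) * (P.eval n + 17) := by ring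
    omega
  · exact fun σ' hI => ⟨hI.2.1, fun w => hI.2.2 w w.2⟩

end Machine

/-! ### The kept set as a counting term -/

section Program

open Classical in
/-- The truth value of `P` as a number. -/
noncomputable def bit (P : Prop) : ℕ := if P then 1 else 0

theorem bit_congr {P Q : Prop} (h : P ↔ Q) : bit P = bit Q := by rw [propext h]

theorem bit_eq_ite {P Q : Prop} [Decidable Q] (h : P ↔ Q) : bit P = if Q then 1 else 0 := by
  by_cases hQ : Q <;> simp [bit, h, hQ]

theorem bit_of_true {P : Prop} (h : P) : bit P = 1 := if_pos h

theorem bit_of_false {P : Prop} (h : ¬ P) : bit P = 0 := if_neg h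

theorem bit_eq_zero (P : Prop) : bit P = 0 ↔ ¬ P := by
  by_cases h : P <;> simp [bit, h]

theorem bit_and (P Q : Prop) : bit P + bit Q - 1 = bit (P ∧ Q) := by
  by_cases h : P <;> by_cases h' : Q <;> simp [bit, h, h']

theorem bit_add_pos (P Q : Prop) : 0 < bit P + bit Q ↔ P ∨ Q := by
  by_cases h : P <;> by_cases h' : Q <;> simp [bit, h, h']

theorem bit_ne (P Q : Prop) : bit P - bit Q + (bit Q - bit P) = bit (¬ (P ↔ Q)) := by
  by_cases h : P <;> by_cases h' : Q <;> simp [bit, h, h']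

theorem sum_bit {n : ℕ} {p : Fin n → Prop} {S : Finset (Fin n)} (h : ∀ i, p i ↔ i ∈ S) :
    ∑ i, bit (p i) = S.card := by
  classical
  have : S = Finset.univ.filter p := by ext i; simp [h]
  rw [this, Finset.card_filter]
  exact Finset.sum_congr rfl fun i _ => by unfold bit; congr

theorem sum_bit_eq_zero {n : ℕ} (p : Fin n → Prop) : ∑ i, bit (p i) = 0 ↔ ∀ i, ¬ p i := by
  simp [bit_eq_zero]

theorem sum_bit_pos {n : ℕ} (p : Fin n → Prop) : 0 < ∑ i, bit (p i) ↔ ∃ i, p i := by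
  rw [Nat.pos_iff_ne_zero, Ne, sum_bit_eq_zero]
  push Not
  rfl

namespace Term

/-- Negation of a truth value. -/
def not (t : Term) : Term := .monus (.const 1) t

/-- Conjunction of truth values. -/
def and (s t : Term) : Term := .monus (.plus s t) (.const 1)

/-- Disjunction of truth values. -/
def or (s t : Term) : Term := .not (.not (.plus s t))

/-- Whether two numbers differ, for truth values. -/
def ne (s t : Term) : Term := .plus (.monus s t) (.monus t s)

/-- The truth value of `s ≤ t`. -/
def le (s t : Term) : Term := .monus (.const 1) (.monus s t)

/-- The truth value of `s < t`. -/
def lt (s t : Term) : Term := .monus (.const 1) (.monus (.plus s (.const 1)) t)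

/-- Existential quantification over the vertices. -/
def any (t : Term) : Term := .not (.not (.sum t))

/-- Multiplication by a constant. -/
def scale : ℕ → Term → Term
  | 0, _ => .const 0
  | c + 1, t => .plus (scale c t) t

/-- The entry of the adjacency matrix, where array `9` holds the offsets of the rows. -/
def adj (s t : Term) : Term := .read 1 (.plus (.read 9 s) t)

variable (n : ℕ) (σ : Store) (ρ : ℕ → ℕ) (d : ℕ)

theorem eval_not (t : Term) : t.not.eval n σ ρ d = bit (t.eval n σ ρ d = 0) := by
  simp only [Term.not, Term.eval]
  by_cases h : t.eval n σ ρ d = 0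
  · rw [bit_of_true h, h]
  · rw [bit_of_false h]; omega

theorem eval_or (s t : Term) :
    (s.or t).eval n σ ρ d = bit (0 < s.eval n σ ρ d + t.eval n σ ρ d) := by
  rw [Term.or, eval_not, eval_not]
  refine bit_congr ?_
  rw [bit_eq_zero, Nat.pos_iff_ne_zero]
  rfl

theorem eval_any (t : Term) :
    t.any.eval n σ ρ d = bit (0 < ∑ i : Fin n, t.eval n σ (Function.update ρ d i) (d + 1)) := by
  rw [Term.any, eval_not, eval_not]
  refine bit_congr ?_
  rw [bit_eq_zero, Nat.pos_iff_ne_zero]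
  rfl

theorem eval_le (s t : Term) :
    (s.le t).eval n σ ρ d = bit (s.eval n σ ρ d ≤ t.eval n σ ρ d) := by
  simp only [Term.le, Term.eval]
  by_cases h : s.eval n σ ρ d ≤ t.eval n σ ρ d
  · rw [bit_of_true h]; omega
  · rw [bit_of_false h]; omega

theorem eval_lt (s t : Term) :
    (s.lt t).eval n σ ρ d = bit (s.eval n σ ρ d < t.eval n σ ρ d) := by
  simp only [Term.lt, Term.eval]
  by_cases h : s.eval n σ ρ d < t.eval n σ ρ d
  · rw [bit_of_true h]; omega
  · rw [bit_of_false h]; omega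

theorem eval_scale (c : ℕ) (t : Term) :
    (scale c t).eval n σ ρ d = c * t.eval n σ ρ d := by
  induction c with
  | zero => simp [scale, Term.eval]
  | succ c ih => simp only [scale, Term.eval, ih]; ring

theorem ok_scale {a d c : ℕ} {t : Term} (h : t.Ok a d) : (scale c t).Ok a d := by
  induction c with
  | zero => trivial
  | succ c ih => exact ⟨ih, h⟩

end Term

open scoped Classical in
/-- The set from which the closure starts. -/
noncomputable def startSet (I : Instance) (r : ℕ) : Finset (Fin I.n) :=
  (I.source ∪ I.target) ∪ firstOf (freeOf I.graph (I.source ∪ I.target)) ((8 * r + 1) * I.k)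

open scoped Classical in
/-- The vertices to be kept, computed from the closure `K`. -/
noncomputable def keepFrom (I : Instance) (r : ℕ) (K : Finset (Fin I.n)) : Finset (Fin I.n) :=
  if (8 * r + 1) * I.k ≤ (freeOf I.graph (I.source ∪ I.target)).card then startSet I r
  else K ∪ classReps I.graph (classConst r) K ∪
    firstOf (Finset.univ \ K) (extraConst r * I.k)

open scoped Classical in
/-- The intended contents of the arrays, while `K` is the current stage of the closure. -/
def Spec (I : Instance) (r : ℕ) (K : Finset (Fin I.n)) : ℕ → (ℕ → ℕ) → Prop
  | 0, f => f 0 = I.n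
  | 1, f => ∀ u v : Fin I.n, f (u * I.n + v) = bit (I.graph.Adj u v)
  | 2, f => ∀ u : Fin I.n, f u = bit (u ∈ I.source)
  | 3, f => ∀ u : Fin I.n, f u = bit (u ∈ I.target)
  | 9, f => ∀ u : Fin I.n, f u = u * I.n
  | 10, f => f 0 = I.k
  | 11, f => ∀ u : Fin I.n, f u = bit (u ∈ I.source ∪ I.target)
  | 12, f => ∀ u : Fin I.n, f u = bit (u ∈ freeOf I.graph (I.source ∪ I.target))
  | 13, f => ∀ u : Fin I.n, f u = bit (u ∈ startSet I r)
  | 14, f => ∀ u : Fin I.n, f u = bit (u ∈ K)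
  | 15, f => ∀ u : Fin I.n, f u = bit (u ∈ keepFrom I r K)
  | _, _ => True

/-- The arrays below `m` have their intended contents. -/
def Done (I : Instance) (r : ℕ) (K : Finset (Fin I.n)) (m : ℕ) (σ : Store) : Prop :=
  ∀ a < m, Spec I r K a (σ a)

theorem Done.mono {I : Instance} {r : ℕ} {K : Finset (Fin I.n)} {m m' : ℕ} {σ : Store}
    (h : Done I r K m σ) (hm : m' ≤ m) : Done I r K m' σ := fun a ha => h a (by omega)

theorem Done.congr {I : Instance} {r : ℕ} {K : Finset (Fin I.n)} {m : ℕ} {σ σ' : Store}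
    (h : Done I r K m σ) (hσ : ∀ a < m, σ' a = σ a) : Done I r K m σ' :=
  fun a ha => by rw [hσ a ha]; exact h a ha

theorem Done.succ {I : Instance} {r : ℕ} {K : Finset (Fin I.n)} {m : ℕ} {σ σ' : Store}
    (h : Done I r K m σ) (hm : m ≤ 100) (hσ : ∀ a < 100, a ≠ m → σ' a = σ a)
    (hs : Spec I r K m (σ' m)) : Done I r K (m + 1) σ' := by
  intro a ha
  rcases eq_or_ne a m with rfl | hne
  · exact hs
  · rw [hσ a (by omega) hne]
    exact h a (by omega)

variable {I : Instance} {r : ℕ} {K : Finset (Fin I.n)} {σ : Store}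

/-- The machine has no multiplication, so the offset `u * n` is looked up in array `9`. -/
theorem eval_adj (h : Done I r K 10 σ) {s t : Term} {ρ : ℕ → ℕ} {d : ℕ} {u v : Fin I.n}
    (hs : s.eval I.n σ ρ d = u) (ht : t.eval I.n σ ρ d = v) :
    (Term.adj s t).eval I.n σ ρ d = bit (I.graph.Adj u v) := by
  simp only [Term.adj, Term.eval, hs, ht]
  rw [h 9 (by norm_num) u]
  exact h 1 (by norm_num) u v

/-- The offsets of the rows of the adjacency matrix. -/
def rowTerm : Term := .sum (.var 0)

/-- The product is a sum of `n` copies of the bound vertex. -/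
theorem eval_rowTerm (w : Fin I.n) : rowTerm.eval I.n σ (fun _ => (w : ℕ)) 1 = w * I.n := by
  simp [rowTerm, Term.eval, mul_comm]

/-- The number of tokens. -/
def sizeTerm : Term := .sum (.read 2 (.var 0))

theorem eval_sizeTerm (h : Done I r K 10 σ) : sizeTerm.eval I.n σ (fun _ => 0) 0 = I.k := by
  have h2 : ∀ u : Fin I.n, σ 2 u = bit (u ∈ I.source) := h 2 (by norm_num)
  simp only [sizeTerm, Term.eval, Function.update_self, h2]
  exact sum_bit fun _ => Iff.rfl

/-- Membership in the source or the target. -/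
def terminalTerm : Term := .or (.read 2 (.var 0)) (.read 3 (.var 0))

theorem eval_terminalTerm (h : Done I r K 11 σ) (w : Fin I.n) :
    terminalTerm.eval I.n σ (fun _ => (w : ℕ)) 1 = bit (w ∈ I.source ∪ I.target) := by
  have h2 : ∀ u : Fin I.n, σ 2 u = bit (u ∈ I.source) := h 2 (by norm_num)
  have h3 : ∀ u : Fin I.n, σ 3 u = bit (u ∈ I.target) := h 3 (by norm_num)
  simp only [terminalTerm, Term.eval_or, Term.eval, h2, h3, bit_add_pos, Finset.mem_union]

/-- Membership in the set of free vertices. -/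
def freeTerm : Term :=
  .and (.not (.read 11 (.var 0))) (.not (.sum (.and (.read 11 (.var 1)) (.adj (.var 1) (.var 0)))))

open scoped Classical in
theorem eval_freeTerm (h : Done I r K 12 σ) (w : Fin I.n) :
    freeTerm.eval I.n σ (fun _ => (w : ℕ)) 1 =
      bit (w ∈ freeOf I.graph (I.source ∪ I.target)) := by
  have h11 : ∀ u : Fin I.n, σ 11 u = bit (u ∈ I.source ∪ I.target) := h 11 (by norm_num)
  have hadj : ∀ i : Fin I.n, (Term.adj (.var 1) (.var 0)).eval I.n σ
      (Function.update (fun _ => (w : ℕ)) 1 i) 2 = bit (I.graph.Adj i w) := fun i =>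
    eval_adj (h.mono (by norm_num)) (by simp [Term.eval]) (by simp [Term.eval])
  simp only [freeTerm, Term.and, Term.eval_not, Term.eval, Function.update_self, h11, hadj, bit_eq_zero,
    bit_and, sum_bit_eq_zero]
  refine bit_congr ?_
  simp only [freeOf, Finset.mem_filter, Finset.mem_univ, true_and, not_and]

/-- A constant multiple of the number of tokens. -/
def tokensTerm (c : ℕ) : Term := .scale c (.read 10 (.const 0))

theorem eval_tokensTerm (h : Done I r K 11 σ) (c : ℕ) (ρ : ℕ → ℕ) (d : ℕ) :
    (tokensTerm c).eval I.n σ ρ d = c * I.k := by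
  have h10 : σ 10 0 = I.k := h 10 (by norm_num)
  rw [tokensTerm, Term.eval_scale]
  simp only [Term.eval, h10]

/-- Membership in the set from which the closure starts. -/
def startTerm (r : ℕ) : Term :=
  .or (.read 11 (.var 0)) (.and (.read 12 (.var 0))
    (.lt (.sum (.and (.read 12 (.var 1)) (.lt (.var 1) (.var 0)))) (tokensTerm (8 * r + 1))))

theorem eval_startTerm (h : Done I r K 13 σ) (w : Fin I.n) :
    (startTerm r).eval I.n σ (fun _ => (w : ℕ)) 1 = bit (w ∈ startSet I r) := by
  classical
  have h11 : ∀ u : Fin I.n, σ 11 u = bit (u ∈ I.source ∪ I.target) := h 11 (by norm_num)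
  have h12 : ∀ u : Fin I.n, σ 12 u = bit (u ∈ freeOf I.graph (I.source ∪ I.target)) :=
    h 12 (by norm_num)
  have hk := eval_tokensTerm (h.mono (m' := 11) (by norm_num)) (8 * r + 1)
  have h01 : (0 : ℕ) ≠ 1 := by norm_num
  simp only [startTerm, Term.eval_or, Term.and, Term.eval_lt, Term.eval, Function.update_self,
    Function.update_of_ne h01, h11, h12, hk, bit_and, bit_add_pos]
  rw [sum_bit (S := (freeOf I.graph (I.source ∪ I.target)).filter (· < w))
    (by simp)]
  refine bit_congr ?_
  simp only [startSet, firstOf, Finset.mem_union, Finset.mem_filter]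

/-- Whether vertex `1` is in the class of vertex `0`. -/
def classTerm : Term :=
  .and (.not (.read 14 (.var 1))) (.not (.sum (.and (.read 14 (.var 2))
    (.ne (.adj (.var 1) (.var 2)) (.adj (.var 0) (.var 2))))))

open scoped Classical in
theorem eval_classTerm (h : Done I r K 15 σ) (u w : Fin I.n) :
    classTerm.eval I.n σ (Function.update (fun _ => (w : ℕ)) 1 u) 2 =
      bit (u ∈ nbrClass I.graph K w) := by
  have h14 : ∀ u : Fin I.n, σ 14 u = bit (u ∈ K) := h 14 (by norm_num)
  have hadj1 : ∀ i : Fin I.n, (Term.adj (.var 1) (.var 2)).eval I.n σ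
      (Function.update (Function.update (fun _ => (w : ℕ)) 1 u) 2 i) 3 = bit (I.graph.Adj u i) :=
    fun i => eval_adj (h.mono (by norm_num)) (by simp [Term.eval]) (by simp [Term.eval])
  have hadj0 : ∀ i : Fin I.n, (Term.adj (.var 0) (.var 2)).eval I.n σ
      (Function.update (Function.update (fun _ => (w : ℕ)) 1 u) 2 i) 3 = bit (I.graph.Adj w i) :=
    fun i => eval_adj (h.mono (by norm_num)) (by simp [Term.eval]) (by simp [Term.eval])
  simp only [classTerm, Term.and, Term.eval_not, Term.ne, Term.eval, Function.update_self, h14, hadj1,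
    hadj0, bit_eq_zero, bit_ne, bit_and, sum_bit_eq_zero]
  refine bit_congr ?_
  simp only [nbrClass, Finset.mem_filter, Finset.mem_univ, true_and, not_and, not_not,
    Finset.ext_iff, and_congr_right_iff]

/-- The size of the class of a vertex. -/
def classSizeTerm : Term := .sum classTerm

open scoped Classical in
theorem eval_classSizeTerm (h : Done I r K 15 σ) (w : Fin I.n) :
    classSizeTerm.eval I.n σ (fun _ => (w : ℕ)) 1 = (nbrClass I.graph K w).card := by
  simp only [classSizeTerm, Term.eval, eval_classTerm h]
  exact sum_bit fun _ => Iff.rfl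

/-- Membership in the next stage of the closure, where array `20` holds the sizes of the
classes. -/
def closureTerm (r : ℕ) : Term :=
  .or (.read 14 (.var 0)) (.not (.any (.and (.and (.read 13 (.var 1)) (.adj (.var 1) (.var 0)))
    (.any (.and (.not (.read 14 (.var 2))) (.and (.adj (.var 1) (.var 2))
      (.le (.const (classConst r)) (.read 20 (.var 2)))))))))

open scoped Classical in
theorem eval_closureTerm (h : Done I r K 15 σ)
    (h20 : ∀ u : Fin I.n, σ 20 u = (nbrClass I.graph K u).card) (w : Fin I.n) :
    (closureTerm r).eval I.n σ (fun _ => (w : ℕ)) 1 =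
      bit (w ∈ closureStep I.graph (startSet I r) (classConst r) K) := by
  have h13 : ∀ u : Fin I.n, σ 13 u = bit (u ∈ startSet I r) := h 13 (by norm_num)
  have h14 : ∀ u : Fin I.n, σ 14 u = bit (u ∈ K) := h 14 (by norm_num)
  have hadj1 : ∀ x : Fin I.n, (Term.adj (.var 1) (.var 0)).eval I.n σ
      (Function.update (fun _ => (w : ℕ)) 1 x) 2 = bit (I.graph.Adj x w) :=
    fun i => eval_adj (h.mono (by norm_num)) (by simp [Term.eval]) (by simp [Term.eval])
  have hadj2 : ∀ x z : Fin I.n, (Term.adj (.var 1) (.var 2)).eval I.n σ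
      (Function.update (Function.update (fun _ => (w : ℕ)) 1 x) 2 z) 3 = bit (I.graph.Adj x z) :=
    fun x z => eval_adj (h.mono (by norm_num)) (by simp [Term.eval]) (by simp [Term.eval])
  simp only [closureTerm, Term.eval_or, Term.eval_any, Term.and, Term.eval_not, Term.eval_le, Term.eval,
    Function.update_self, h13, h14, h20, hadj1, hadj2, bit_eq_zero, bit_and, sum_bit_pos,
    bit_add_pos]
  refine bit_congr ?_
  rw [closureStep, Finset.mem_union, Finset.mem_filter]
  simp only [Supported, Finset.mem_univ, true_and, and_assoc]

/-- Membership in the set of vertices to be kept. -/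
def keepTerm (r : ℕ) : Term :=
  .or (.and (.le (tokensTerm (8 * r + 1)) (.sum (.read 12 (.var 1)))) (.read 13 (.var 0)))
    (.and (.not (.le (tokensTerm (8 * r + 1)) (.sum (.read 12 (.var 1)))))
      (.or (.or (.read 14 (.var 0)) (.and (.not (.read 14 (.var 0)))
          (.lt (.sum (.and classTerm (.lt (.var 1) (.var 0)))) (.const (classConst r)))))
        (.and (.not (.read 14 (.var 0))) (.lt (.sum (.and (.not (.read 14 (.var 1)))
          (.lt (.var 1) (.var 0)))) (tokensTerm (extraConst r))))))

theorem eval_keepTerm (h : Done I r K 15 σ) (w : Fin I.n) :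
    (keepTerm r).eval I.n σ (fun _ => (w : ℕ)) 1 = bit (w ∈ keepFrom I r K) := by
  classical
  have h12 : ∀ u : Fin I.n, σ 12 u = bit (u ∈ freeOf I.graph (I.source ∪ I.target)) :=
    h 12 (by norm_num)
  have h13 : ∀ u : Fin I.n, σ 13 u = bit (u ∈ startSet I r) := h 13 (by norm_num)
  have h14 : ∀ u : Fin I.n, σ 14 u = bit (u ∈ K) := h 14 (by norm_num)
  have hk := eval_tokensTerm (h.mono (m' := 11) (by norm_num))
  have h01 : (0 : ℕ) ≠ 1 := by norm_num
  have hF : ∑ u, bit (u ∈ freeOf I.graph (I.source ∪ I.target)) =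
    (freeOf I.graph (I.source ∪ I.target)).card := sum_bit fun _ => Iff.rfl
  have hC : ∑ u, bit (u ∈ nbrClass I.graph K w ∧ (u : ℕ) < w) =
    ((nbrClass I.graph K w).filter (· < w)).card := sum_bit (by simp)
  have hE : ∑ u, bit (u ∉ K ∧ (u : ℕ) < w) = ((Finset.univ \ K).filter (· < w)).card :=
    sum_bit (by simp)
  simp only [keepTerm, Term.eval_or, Term.and, Term.eval_not, Term.eval_le, Term.eval_lt, Term.eval,
    Function.update_self, Function.update_of_ne h01, eval_classTerm h, h12, h13, h14, hk,
    bit_eq_zero, bit_and, bit_add_pos, hF, hC, hE]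
  refine bit_congr ?_
  unfold keepFrom
  split_ifs with hc
  · simp [hc]
  · simp only [hc, false_and, false_or, not_false_eq_true, true_and, classReps, firstOf,
      Finset.mem_union, Finset.mem_filter, Finset.mem_univ, Finset.mem_sdiff]

/-- The number of vertices to be kept. -/
def countTerm : Term := .sum (.read 15 (.var 0))

theorem eval_countTerm (h : Done I r K 16 σ) :
    countTerm.eval I.n σ (fun _ => 0) 0 = (keepFrom I r K).card := by
  have h15 : ∀ u : Fin I.n, σ 15 u = bit (u ∈ keepFrom I r K) := h 15 (by norm_num)
  simp only [countTerm, Term.eval, Function.update_self, h15]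
  exact sum_bit fun _ => Iff.rfl

/-- The name of a vertex of the output. -/
def nameTerm : Term :=
  .sum (.le (.sum (.and (.read 15 (.var 2)) (.le (.var 2) (.var 1)))) (.var 0))

/-- By `card_filter_rank_le` the name is a number of vertices. The index `i` enters as the vertex
`w` of the same value, because arrays are filled along the vertices. -/
theorem eval_nameTerm (h : Done I r K 16 σ) (w : Fin I.n) (i : Fin (keepFrom I r K).card)
    (hi : (w : ℕ) = i) :
    nameTerm.eval I.n σ (fun _ => (w : ℕ)) 1 = nameOf (keepFrom I r K) i := by
  have h15 : ∀ u : Fin I.n, σ 15 u = bit (u ∈ keepFrom I r K) := h 15 (by norm_num)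
  have h12 : (1 : ℕ) ≠ 2 := by norm_num
  have h01 : (0 : ℕ) ≠ 1 := by norm_num
  have hC : ∀ u : Fin I.n, ∑ v, bit (v ∈ keepFrom I r K ∧ (v : ℕ) ≤ u) =
    ((keepFrom I r K).filter (· ≤ u)).card := fun u => sum_bit (by simp)
  simp only [nameTerm, Term.and, Term.eval_le, Term.eval, Function.update_self,
    Function.update_of_ne h12, Function.update_of_ne h01, h15,
    bit_and, hC]
  rw [← card_filter_rank_le, hi]
  exact sum_bit (by simp)

end Program

/-! ### The kernelization program -/

section Algorithm

/-- One round of the closure. -/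
def closurePass (r : ℕ) : Prog :=
  .seq (fill 20 classSizeTerm) (.seq (fill 21 (closureTerm r)) (fill 14 (.read 21 (.var 0))))

/-- An entry of the adjacency matrix of the output, at the indices in the arrays `23` and `24`. -/
def entryExpr : Expr :=
  .read 1 (.plus (.read 9 (.read 8 (.read 23 (.const 0)))) (.read 8 (.read 24 (.const 0))))

/-- Writes the adjacency matrix of the output. -/
def matrixProg : Prog :=
  .seq (.write 25 (.const 0) (.const 0)) (forTo 23 (.read 4 (.const 0))
    (forTo 24 (.read 4 (.const 0)) (.seq (.write 5 (.read 25 (.const 0)) entryExpr)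
      (.write 25 (.const 0) (.plus (.read 25 (.const 0)) (.const 1))))))

/-- Writes the output. -/
def outputProg : Prog :=
  .seq (assign 4 countTerm) (.seq (fill 8 nameTerm) (.seq (fill 6 (.read 2 (.read 8 (.var 0))))
    (.seq (fill 7 (.read 3 (.read 8 (.var 0)))) matrixProg)))

/-- The kernelization. -/
def kernelProg (r : ℕ) : Prog :=
  .seq (fill 9 rowTerm) (.seq (assign 10 sizeTerm) (.seq (fill 11 terminalTerm)
    (.seq (fill 12 freeTerm) (.seq (fill 13 (startTerm r)) (.seq (fill 14 (.read 13 (.var 0)))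
      (.seq (forTo 22 (.read 0 (.const 0)) (closurePass r)) (.seq (fill 15 (keepTerm r))
        outputProg)))))))

/-- Array `25` holds the running position `i * N + j`, so no product has to be computed. -/
theorem runs_matrix {N : ℕ} {σ : Store} {F : ℕ → ℕ} (hN : σ 4 0 = N)
    (hF : ∀ (τ : Store) (i j : ℕ), i < N → j < N → (∀ b < 20, b ≠ 5 → τ b = σ b) → τ 23 0 = i →
      τ 24 0 = j → entryExpr.eval τ = F (i * N + j)) :
    Runs matrixProg σ ((N + 1) * ((N + 1) * 42 + 15) + 6) (fun σ' =>
      (∀ b < 20, b ≠ 5 → σ' b = σ b) ∧ ∀ p < N * N, σ' 5 p = F p) := by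
  let Inv : ℕ → ℕ → Store → Prop := fun i j τ => (∀ b < 20, b ≠ 5 → τ b = σ b) ∧ τ 23 0 = i ∧
    τ 25 0 = i * N + j ∧ ∀ p < i * N + j, τ 5 p = F p
  have hlow : ∀ (τ : Store) (a v : ℕ), 20 ≤ a → (∀ b < 20, b ≠ 5 → τ b = σ b) →
      ∀ b < 20, b ≠ 5 → setCell τ a 0 v b = σ b := fun τ a v ha h b hb hb' => by
    rw [setCell_of_ne _ _ _ (by omega), h b hb hb']
  have hread : ∀ i j τ, Inv i j τ → Expr.eval τ (.read 4 (.const 0)) = N := fun i j τ h => by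
    simp only [Expr.eval]
    rw [h.1 4 (by norm_num) (by norm_num), hN]
  refine Runs.mono (Runs.seq (Runs.write (Q := fun τ => (∀ b < 20, b ≠ 5 → τ b = σ b) ∧ τ 25 0 = 0)
    ⟨hlow σ _ _ (by norm_num) fun _ _ _ => rfl, setCell_self _ _ _ _⟩) fun σ₁ h₁ =>
    Runs.forTo (Inv := fun i => Inv i 0) (m := N) (c := (N + 1) * 42 + 3)
      (fun i τ _ h => hread i 0 τ h) (fun i τ _ h => h.2.1) ?_ ?_) ?_ ?_
  · intro i τ hi h
    refine Runs.mono (Runs.forTo (Inv := fun j τ => Inv i j τ ∧ τ 24 0 = j) (m := N) (c := 30)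
      (fun j τ _ h => hread i j τ h.1) (fun j τ _ h => h.2) ?_ ?_) ?_ ?_
    · rintro j τ hj ⟨⟨h1, h2, h3, h4⟩, h5⟩
      refine Runs.mono (Runs.seq (Runs.write (Q := fun τ => Inv i j τ ∧ τ 24 0 = j ∧
        τ 5 (i * N + j) = F (i * N + j)) ?_) fun τ' h' => Runs.write (Q := fun τ =>
        τ 24 0 = j ∧ Inv i (j + 1) (setCell τ 24 0 (j + 1)) ∧
          setCell τ 24 0 (j + 1) 24 0 = j + 1) ?_) (by simp [Expr.cost, entryExpr]) fun _ h => h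
      · rw [hF τ i j hi hj h1 h2 h5]
        simp only [Expr.eval, h3]
        refine ⟨⟨fun b hb hb' => ?_, ?_, ?_, fun p hp => ?_⟩, ?_, setCell_self _ _ _ _⟩
        · rw [setCell_of_ne _ _ _ hb', h1 b hb hb']
        · rw [setCell_of_ne _ _ _ (by norm_num), h2]
        · rw [setCell_of_ne _ _ _ (by norm_num), h3]
        · rw [setCell_of_ne_cell _ _ _ (by omega), h4 p hp]
        · rw [setCell_of_ne _ _ _ (by norm_num), h5]
      · obtain ⟨⟨h1, h2, h3, h4⟩, h5, h6⟩ := h'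
        simp only [Expr.eval, h3]
        refine ⟨?_, ⟨hlow _ _ _ (by norm_num) (hlow _ _ _ (by norm_num) h1), ?_, ?_,
          fun p hp => ?_⟩, setCell_self _ _ _ _⟩
        · rw [setCell_of_ne _ _ _ (by norm_num), h5]
        · rw [setCell_of_ne _ _ _ (by norm_num), setCell_of_ne _ _ _ (by norm_num), h2]
        · rw [setCell_of_ne _ _ _ (by norm_num), setCell_self]
          rfl
        · rw [setCell_of_ne _ _ _ (by norm_num), setCell_of_ne _ _ _ (by norm_num)]
          rcases eq_or_ne p (i * N + j) with rfl | hne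
          · exact h6
          · exact h4 p (by omega)
    · obtain ⟨h1, h2, h3, h4⟩ := h
      refine ⟨⟨hlow _ _ _ (by norm_num) h1, ?_, ?_, fun p hp => ?_⟩, setCell_self _ _ _ _⟩
      · rw [setCell_of_ne _ _ _ (by norm_num), h2]
      · rw [setCell_of_ne _ _ _ (by norm_num), h3]
      · rw [setCell_of_ne _ _ _ (by norm_num), h4 p hp]
    · simp [Expr.cost]
    · rintro τ' ⟨⟨h1, h2, h3, h4⟩, -⟩
      have e : (i + 1) * N + 0 = i * N + N := by ring
      refine ⟨h2, hlow _ _ _ (by norm_num) h1, setCell_self _ _ _ _, ?_, fun p hp => ?_⟩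
      · rw [setCell_of_ne _ _ _ (by norm_num), h3, e]
      · rw [setCell_of_ne _ _ _ (by norm_num), h4 p (by omega)]
  · refine ⟨hlow _ _ _ (by norm_num) h₁.1, setCell_self _ _ _ _, ?_, fun p hp => ?_⟩
    · rw [setCell_of_ne _ _ _ (by norm_num), h₁.2]; omega
    · omega
  · simp only [Expr.cost]
    have : (N + 1) * ((N + 1) * 42 + 3 + (1 + 1) + 10) = (N + 1) * ((N + 1) * 42 + 15) := by ring
    omega
  · exact fun τ h => ⟨h.1, fun p hp => h.2.2.2 p (by omega)⟩

/-- The output describes the restriction of the instance to `M`. -/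
structure OutputSpec (I : Instance) (M : Finset (Fin I.n)) (σ : Store) : Prop where
  card : σ 4 0 = M.card
  name : ∀ u : Fin M.card, σ 8 u = nameOf M u
  source : ∀ u : Fin M.card, σ 6 u = bit (nameOf M u ∈ I.source)
  target : ∀ u : Fin M.card, σ 7 u = bit (nameOf M u ∈ I.target)
  adj : ∀ u v : Fin M.card,
    σ 5 (u * M.card + v) = bit (I.graph.Adj (nameOf M u) (nameOf M v))

/-- The arrays `4` to `8` are reserved for the output and carry no specification in `Spec`. -/
theorem Done.congr_output {I : Instance} {r : ℕ} {K : Finset (Fin I.n)} {σ σ' : Store}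
    (h : Done I r K 16 σ) (hσ : ∀ a < 16, a < 4 ∨ 8 < a → σ' a = σ a) : Done I r K 16 σ' := by
  intro a ha
  by_cases hc : a < 4 ∨ 8 < a
  · rw [hσ a ha hc]; exact h a ha
  · have : a = 4 ∨ a = 5 ∨ a = 6 ∨ a = 7 ∨ a = 8 := by omega
    rcases this with rfl | rfl | rfl | rfl | rfl <;> trivial

open Polynomial in
theorem runs_output (r : ℕ) : ∃ P : ℕ[X], ∀ (I : Instance) (K : Finset (Fin I.n)) (σ : Store),
    Done I r K 16 σ → Runs outputProg σ (P.eval I.n) (OutputSpec I (keepFrom I r K)) := by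
  obtain ⟨P₄, h₄⟩ := runs_assign (a := 4) countTerm (by simp [countTerm, Term.Ok])
  obtain ⟨P₈, h₈⟩ := runs_fill (a := 8) (by norm_num) (by norm_num) nameTerm
    (by simp [nameTerm, Term.Ok, Term.le, Term.and])
  obtain ⟨P₆, h₆⟩ := runs_fill (a := 6) (by norm_num) (by norm_num) (.read 2 (.read 8 (.var 0)))
    (by simp [Term.Ok])
  obtain ⟨P₇, h₇⟩ := runs_fill (a := 7) (by norm_num) (by norm_num) (.read 3 (.read 8 (.var 0)))
    (by simp [Term.Ok])
  refine ⟨P₄ + (P₈ + (P₆ + (P₇ + ((X + 1) * ((X + 1) * 42 + 15) + 6)))), fun I K σ hσ => ?_⟩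
  set M := keepFrom I r K with hM
  have hMn : M.card ≤ I.n := by simpa using M.card_le_univ
  -- `fill` writes one cell per vertex of `I`; only the first `M.card` cells matter.
  let up : Fin M.card → Fin I.n := Fin.castLE hMn
  simp only [eval_add, eval_mul, eval_X, eval_one, eval_ofNat]
  refine Runs.seq (h₄ I.n σ (hσ 0 (by norm_num))) fun σ₁ f₁ => ?_
  have d₁ : Done I r K 16 σ₁ := hσ.congr_output fun a ha _ => f₁.1 a (by omega) (by omega)
  refine Runs.seq (h₈ I.n σ₁ (d₁ 0 (by norm_num))) fun σ₂ f₂ => ?_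
  have d₂ : Done I r K 16 σ₂ := d₁.congr_output fun a ha _ => f₂.1 a (by omega) (by omega)
  have n₂ : ∀ u : Fin M.card, σ₂ 8 u = nameOf M u := fun u =>
    (f₂.2 (up u)).trans (eval_nameTerm d₁ (up u) u rfl)
  refine Runs.seq (h₆ I.n σ₂ (d₂ 0 (by norm_num))) fun σ₃ f₃ => ?_
  have d₃ : Done I r K 16 σ₃ := d₂.congr_output fun a ha _ => f₃.1 a (by omega) (by omega)
  have n₃ : ∀ u : Fin M.card, σ₃ 8 u = nameOf M u := fun u => by
    rw [f₃.1 8 (by norm_num) (by norm_num), n₂]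
  refine Runs.seq (h₇ I.n σ₃ (d₃ 0 (by norm_num))) fun σ₄ f₄ => ?_
  have d₄ : Done I r K 16 σ₄ := d₃.congr_output fun a ha _ => f₄.1 a (by omega) (by omega)
  have n₄ : ∀ u : Fin M.card, σ₄ 8 u = nameOf M u := fun u => by
    rw [f₄.1 8 (by norm_num) (by norm_num), n₃]
  have c₄ : σ₄ 4 0 = M.card := by
    rw [f₄.1 4 (by norm_num) (by norm_num), f₃.1 4 (by norm_num) (by norm_num),
      f₂.1 4 (by norm_num) (by norm_num), f₁.2, eval_countTerm hσ]
  have key := runs_matrix (σ := σ₄) (N := M.card) (F := fun p =>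
    σ₄ 1 (σ₄ 9 (σ₄ 8 (p / M.card)) + σ₄ 8 (p % M.card))) c₄ ?_
  · refine key.mono (by gcongr) fun σ₅ f₅ => ⟨?_, fun u => ?_, fun u => ?_, fun u => ?_,
      fun u v => ?_⟩
    · rw [f₅.1 4 (by norm_num) (by norm_num), c₄]
    · rw [f₅.1 8 (by norm_num) (by norm_num), n₄]
    · rw [f₅.1 6 (by norm_num) (by norm_num), f₄.1 6 (by norm_num) (by norm_num)]
      refine (f₃.2 (up u)).trans ?_
      simp only [Term.eval]
      rw [show ((up u : Fin I.n) : ℕ) = u from rfl, n₂]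
      exact d₂ 2 (by norm_num) _
    · rw [f₅.1 7 (by norm_num) (by norm_num)]
      refine (f₄.2 (up u)).trans ?_
      simp only [Term.eval]
      rw [show ((up u : Fin I.n) : ℕ) = u from rfl, n₃]
      exact d₃ 3 (by norm_num) _
    · have hpos : 0 < M.card := u.pos
      rw [f₅.2 _ (by nlinarith [u.2, v.2])]
      have e1 : ((u : ℕ) * M.card + v) / M.card = u := by
        rw [mul_comm, Nat.mul_add_div hpos, Nat.div_eq_of_lt v.2, add_zero]
      have e2 : ((u : ℕ) * M.card + v) % M.card = v := by
        rw [mul_comm, Nat.mul_add_mod, Nat.mod_eq_of_lt v.2]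
      simp only [e1, e2]
      rw [n₄, n₄, d₄ 9 (by norm_num) (nameOf M u)]
      exact d₄ 1 (by norm_num) _ _
  · intro τ i j hi hj hτ h23 h24
    have hpos : 0 < M.card := by omega
    have e1 : (i * M.card + j) / M.card = i := by
      rw [mul_comm, Nat.mul_add_div hpos, Nat.div_eq_of_lt hj, add_zero]
    have e2 : (i * M.card + j) % M.card = j := by
      rw [mul_comm, Nat.mul_add_mod, Nat.mod_eq_of_lt hj]
    simp only [entryExpr, Expr.eval, h23, h24, e1, e2]
    rw [hτ 1 (by norm_num) (by norm_num), hτ 9 (by norm_num) (by norm_num),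
      hτ 8 (by norm_num) (by norm_num)]

/-- Only the arrays `14` and `15` depend on the stage of the closure. -/
theorem Spec.of_ne {I : Instance} {r : ℕ} {K K' : Finset (Fin I.n)} {a : ℕ} {f : ℕ → ℕ}
    (ha : a < 14) (h : Spec I r K a f) : Spec I r K' a f := by
  interval_cases a <;> exact h

open Polynomial in
open scoped Classical in
-- The new stage is assembled in array `21` before it replaces array `14`, so all tests of a round
-- refer to the old stage.
theorem runs_closurePass (r : ℕ) : ∃ P : ℕ[X], ∀ (I : Instance) (K : Finset (Fin I.n)) (σ : Store),
    Done I r K 15 σ → Runs (closurePass r) σ (P.eval I.n) (fun σ' => σ' 22 = σ 22 ∧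
      Done I r (closureStep I.graph (startSet I r) (classConst r) K) 15 σ') := by
  obtain ⟨P₁, h₁⟩ := runs_fill (a := 20) (by norm_num) (by norm_num) classSizeTerm
    (by simp [classSizeTerm, classTerm, Term.Ok, Term.not, Term.and, Term.adj, Term.ne])
  obtain ⟨P₂, h₂⟩ := runs_fill (a := 21) (by norm_num) (by norm_num) (closureTerm r)
    (by simp [closureTerm, Term.Ok, Term.not, Term.and, Term.adj, Term.or, Term.any, Term.le])
  obtain ⟨P₃, h₃⟩ := runs_fill (a := 14) (by norm_num) (by norm_num) (.read 21 (.var 0))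
    (by simp [Term.Ok])
  refine ⟨P₁ + (P₂ + P₃), fun I K σ hσ => ?_⟩
  simp only [eval_add]
  refine Runs.seq (h₁ I.n σ (hσ 0 (by norm_num))) fun σ₁ f₁ => ?_
  have d₁ : Done I r K 15 σ₁ := hσ.congr fun a ha => f₁.1 a (by omega) (by omega)
  refine Runs.seq (h₂ I.n σ₁ (d₁ 0 (by norm_num))) fun σ₂ f₂ => ?_
  have d₂ : Done I r K 15 σ₂ := d₁.congr fun a ha => f₂.1 a (by omega) (by omega)
  refine (h₃ I.n σ₂ (d₂ 0 (by norm_num))).mono le_rfl fun σ₃ f₃ => ⟨?_, ?_⟩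
  · rw [f₃.1 22 (by norm_num) (by norm_num), f₂.1 22 (by norm_num) (by norm_num),
      f₁.1 22 (by norm_num) (by norm_num)]
  · refine Done.succ (σ := σ₂) (fun a ha => Spec.of_ne ha (d₂ a (by omega))) (by norm_num) f₃.1 ?_
    intro u
    refine (f₃.2 u).trans ?_
    simp only [Term.eval]
    rw [f₂.2 u]
    exact eval_closureTerm d₁ (fun w => (f₁.2 w).trans (eval_classSizeTerm hσ w)) u

open Polynomial in
theorem runs_fill_done {r m : ℕ} (hm0 : m ≠ 0) (hm : m < 100) (t : Term) (ht : t.Ok m 1)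
    (hs : ∀ (I : Instance) (K : Finset (Fin I.n)) (σ : Store) (f : ℕ → ℕ), Done I r K m σ →
      (∀ w : Fin I.n, f w = t.eval I.n σ (fun _ => (w : ℕ)) 1) → Spec I r K m f) :
    ∃ P : ℕ[X], ∀ (I : Instance) (K : Finset (Fin I.n)) (σ : Store), Done I r K m σ →
      Runs (fill m t) σ (P.eval I.n) (Done I r K (m + 1)) := by
  obtain ⟨P, hP⟩ := runs_fill hm0 hm t ht
  refine ⟨P, fun I K σ hσ => (hP I.n σ (hσ 0 (by omega))).mono le_rfl fun σ' f => ?_⟩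
  exact hσ.succ hm.le f.1 (hs I K σ _ hσ f.2)

open scoped Classical in
/-- The vertices of the kernel. -/
noncomputable def kernelSet (I : Instance) (r : ℕ) : Finset (Fin I.n) :=
  keepFrom I r (closureOf I.graph (startSet I r) (classConst r))

theorem done_input (I : Instance) (r : ℕ) (K : Finset (Fin I.n)) : Done I r K 9 I.input := by
  obtain ⟨h0, h1, h2, h3⟩ := I.stored_input
  intro a ha
  interval_cases a
  · exact h0
  · exact fun u v => (h1 u v).trans (by unfold bit; congr)
  · exact fun u => (h2 u).trans (by unfold bit; congr)
  · exact fun u => (h3 u).trans (by unfold bit; congr)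
  all_goals trivial

open Polynomial in
theorem runs_kernelProg (r : ℕ) : ∃ P : ℕ[X], ∀ I : Instance,
    Runs (kernelProg r) I.input (P.eval I.n) (OutputSpec I (kernelSet I r)) := by
  classical
  have hk : ∀ {a d c : ℕ}, a ≠ 10 → (tokensTerm c).Ok a d := fun h =>
    Term.ok_scale ⟨by norm_num, h.symm, trivial⟩
  obtain ⟨P₁, h₁⟩ := runs_fill_done (r := r) (m := 9) (by norm_num) (by norm_num) rowTerm
    (by simp [rowTerm, Term.Ok]) fun I K σ f _ h u => (h u).trans (eval_rowTerm u)
  obtain ⟨P₂, h₂⟩ := runs_assign (a := 10) sizeTerm (by simp [sizeTerm, Term.Ok])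
  obtain ⟨P₃, h₃⟩ := runs_fill_done (r := r) (m := 11) (by norm_num) (by norm_num) terminalTerm
    (by simp [terminalTerm, Term.Ok, Term.or, Term.not])
    fun I K σ f d h u => (h u).trans (eval_terminalTerm d u)
  obtain ⟨P₄, h₄⟩ := runs_fill_done (r := r) (m := 12) (by norm_num) (by norm_num) freeTerm
    (by simp [freeTerm, Term.Ok, Term.and, Term.not, Term.adj])
    fun I K σ f d h u => (h u).trans (eval_freeTerm d u)
  obtain ⟨P₅, h₅⟩ := runs_fill_done (r := r) (m := 13) (by norm_num) (by norm_num) (startTerm r)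
    (by simp [startTerm, Term.Ok, Term.and, Term.not, Term.or, Term.lt, hk])
    fun I K σ f d h u => (h u).trans (eval_startTerm d u)
  obtain ⟨P₆, h₆⟩ := runs_fill (a := 14) (by norm_num) (by norm_num) (.read 13 (.var 0))
    (by simp [Term.Ok])
  obtain ⟨P₇, h₇⟩ := runs_closurePass r
  obtain ⟨P₈, h₈⟩ := runs_fill_done (r := r) (m := 15) (by norm_num) (by norm_num) (keepTerm r)
    (by simp [keepTerm, classTerm, Term.Ok, Term.and, Term.not, Term.or, Term.lt, Term.le, Term.ne,
      Term.adj, hk])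
    fun I K σ f d h u => (h u).trans (eval_keepTerm d u)
  obtain ⟨P₉, h₉⟩ := runs_output r
  refine ⟨P₁ + (P₂ + (P₃ + (P₄ + (P₅ + (P₆ + (((X + 1) * (P₇ + 12) + 3) + (P₈ + P₉))))))),
    fun I => ?_⟩
  simp only [eval_add, eval_mul, eval_X, eval_one, eval_ofNat]
  set X₀ := startSet I r
  refine Runs.seq (h₁ I X₀ _ (done_input I r X₀)) fun σ₁ d₁ => ?_
  refine Runs.seq (h₂ I.n σ₁ (d₁ 0 (by norm_num))) fun σ₂ f₂ => ?_
  have d₂ : Done I r X₀ 11 σ₂ := d₁.succ (by norm_num) f₂.1 (f₂.2.trans (eval_sizeTerm d₁))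
  refine Runs.seq (h₃ I X₀ _ d₂) fun σ₃ d₃ => ?_
  refine Runs.seq (h₄ I X₀ _ d₃) fun σ₄ d₄ => ?_
  refine Runs.seq (h₅ I X₀ _ d₄) fun σ₅ d₅ => ?_
  refine Runs.seq (h₆ I.n σ₅ (d₅ 0 (by norm_num))) fun σ₆ f₆ => ?_
  have d₆ : Done I r X₀ 15 σ₆ := d₅.succ (by norm_num) f₆.1 fun u => by
    rw [f₆.2 u]
    exact d₅ 13 (by norm_num) u
  -- All `n` rounds are run without testing for a fixed point, exactly as in `closureOf`.
  have key := Runs.forTo (x := 22) (N := .read 0 (.const 0)) (p := closurePass r) (σ := σ₆)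
    (m := I.n) (c := P₇.eval I.n) (Inv := fun i τ => τ 22 0 = i ∧
      Done I r ((closureStep I.graph X₀ (classConst r))^[i] X₀) 15 τ)
    (fun i τ _ h => h.2 0 (by norm_num)) (fun i τ _ h => h.1) (fun i τ hi h => ?_)
    ⟨setCell_self _ _ _ _, d₆.congr fun a ha => setCell_of_ne _ _ _ (by omega)⟩
  · refine Runs.seq (key.mono (by simp [Expr.cost, add_assoc]) fun _ h => h) fun σ₇ f₇ => ?_
    refine Runs.seq (h₈ I _ σ₇ f₇.2) fun σ₈ d₈ => ?_
    exact h₉ I _ σ₈ d₈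
  · refine (h₇ I _ τ h.2).mono le_rfl fun τ' f => ⟨by rw [f.1]; exact h.1, setCell_self _ _ _ _, ?_⟩
    rw [Function.iterate_succ_apply']
    exact f.2.congr fun a ha => setCell_of_ne _ _ _ (by omega)

end Algorithm

end TokenJumping

open TokenJumping in
theorem mainTheorem1 (r : ℕ) (hr : 0 < r) :
    ∃ (c : ℕ) (kernel : Prog) (P : Polynomial ℕ),
      ∀ I : Instance, ¬ IsMinor (completeBipartiteGraph (Fin 3) (Fin r)) I.graph →
        ∃ (t : ℕ) (σ : Store) (J : Instance) (φ : Fin J.n ↪ Fin I.n),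
          -- in polynomial time, the program outputs `J` and the names `φ` of its vertices
          Exec kernel I.input t σ ∧ t ≤ P.eval I.n ∧
          Stored σ 4 J ∧ (∀ u : Fin J.n, σ 8 u = φ u) ∧
          -- `J` is an equivalent instance `(G', I_s, I_t)` with `G'` a subgraph of order `O(k)`
          IsSubinstance J I φ ∧
          ¬ IsMinor (completeBipartiteGraph (Fin 3) (Fin r)) J.graph ∧
          (J.IsYes ↔ I.IsYes) ∧
          J.n ≤ c * I.k := by
  classical
  obtain ⟨P, hP⟩ := runs_kernelProg r
  refine ⟨keepConst r, kernelProg r, P, fun I hI => ?_⟩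
  obtain ⟨t, σ, hexec, ht, hσ⟩ := hP I
  obtain ⟨hsub, hcard, hreach⟩ := keepSet_spec I.graph hr hI ((indep_iff _).2 I.source_indep)
    ((indep_iff _).2 I.target_indep) I.card_eq
  -- Both sides unfold to the same expression; `keepFrom` differs only in taking the stage `K` as a
  -- parameter.
  have hM : keepSet I.graph r I.source I.target = kernelSet I r := rfl
  rw [hM] at hsub hcard hreach
  refine ⟨t, σ, I.restrict (kernelSet I r) hsub, nameOf (kernelSet I r), hexec, ht,
    ⟨hσ.card, fun u v => (hσ.adj u v).trans ?_, fun u => (hσ.source u).trans ?_,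
      fun u => (hσ.target u).trans ?_⟩, hσ.name, isSubinstance_restrict I _ hsub,
    fun h => hI (h.trans (isMinor_comap I.graph _)), ?_, hcard⟩
  · exact bit_eq_ite Iff.rfl
  · exact bit_eq_ite (mem_source_restrict hsub u)
  · exact bit_eq_ite (mem_target_restrict hsub u)
  · rw [isYes_restrict, isYes_iff_reach]
    exact hreach
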